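/- Let $F = A_1 * \cdots * A_n * F_k$, where $A_1,\dots,A_n$ are groups and $F_k$ is free of finite rank $k$ with basis $s_1,\dots,s_k$, and let $\mathscr{A}$ be the set of conjugacy classes of the $A_i$. Let $T$ be the Bass--Serre tree of this decomposition: its vertices are the elements $g$ of $F$ and the cosets $gA_i$, and $g$ is joined by an edge to each $gA_i$ and to each $gs_j$. Let $\partial_\infty(F,\mathscr{A}) = \partial_\infty T$ be the Gromov boundary of $T$, and let $\partial(F,\mathscr{A})$ be the union of $\partial_\infty T$ and the set of vertices of $T$ with infinite stabilizer, with the observer's topology (the topology induced from the one on $T \cup \partial_\infty T$ that has the half-trees as a sub-basis). For a subgroup $H \le F$ with minimal subtree $T_H$, let $\partial(H,\mathscr{A}|_H) \subset \partial(F,\mathscr{A})$ be the union of $\partial_\infty T_H$ and the set of vertices of $T_H$ with infinite stabilizer in $H$. A nontrivial element $c \in F$ that is not conjugate into any $A_i$ has exactly two fixed points $\hat T_c^{+}, \hat T_c^{-}$ in $\partial(F,\mathscr{A})$, the endpoints of its axis. Let $\Phi$ be an automorphism of $F$ that permutes the conjugacy classes in $\mathscr{A}$. Then $\Phi$ extends,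 by continuity along the orbit map $F \to T$, to a unique map $\hat\Phi$ of $\partial(F,\mathscr{A})$ to itself, and $\hat\Phi$ is a homeomorphism. Write $\mathbb{F} = \operatorname{Fix}(\Phi)$ and suppose that $\operatorname{Fix}(\hat\Phi)$ contains at least three points of $\partial_\infty(F,\mathscr{A})$. Let $E$ be the set of all points $\hat T_c^{\pm}$, where $c \in \mathbb{F}$ is nontrivial and not conjugate into any $A_i$, and let $\overline{E}$ be its closure in $\partial(F,\mathscr{A})$. 1. $\partial(\mathbb{F},\mathscr{A}|_{\mathbb{F}}) \cap \partial_\infty(F,\mathscr{A}) = \overline{E} \cap \partial_\infty(F,\mathscr{A})$. If this set is nonempty, then moreover $\partial(\mathbb{F},\mathscr{A}|_{\mathbb{F}}) = \overline{E}$, this set is contained in $\operatorname{Fix}(\hat\Phi)$, and none of its points is isolated in $\operatorname{Fix}(\hat\Phi)$. 2. Every point $\xi$ of $\bigl(\operatorname{Fix}(\hat\Phi) \setminus \partial(\mathbb{F},\mathscr{A}|_{\mathbb{F}})\bigr) \cap \partial_\infty(F,\mathscr{A})$ is isolated in $\operatorname{Fix}(\hat\Phi)$ and is an attractor or a repeller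 for $\hat\Phi$; that is, $\xi$ has an open neighbourhood in $\partial(F,\mathscr{A})$ all of whose points converge to $\xi$ under iteration of $\hat\Phi$, or one all of whose points converge to $\xi$ under iteration of $\hat\Phi^{-1}$. -/

import Mathlib

open Filter Topology

namespace FreeProductBoundary

universe u v

/-! ### Trees, half-trees and the observer's topology -/

section Trees

variable {V : Type v}

/-- A singly infinite tight edge path (a path without backtracking) in a graph. -/
structure TightRay (G : SimpleGraph V) where
  /-- the successive vertices of the path -/
  vert : ℕ → V
  adj : ∀ m, G.Adj (vert m) (vert (m + 1))
  tight : ∀ m, vert (m + 2) ≠ vert m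

/-- Two tight rays have the same endpoint at infinity if they share a tail. -/
def tailSetoid (G : SimpleGraph V) : Setoid (TightRay G) where
  r ρ σ := ∃ m m', ∀ j, ρ.vert (m + j) = σ.vert (m' + j)
  iseqv :=
    { refl := fun _ => ⟨0, 0, fun _ => rfl⟩
      symm := fun ⟨m, m', h⟩ => ⟨m', m, fun j => (h j).symm⟩
      trans := by
        rintro ρ σ τ ⟨m, m', h⟩ ⟨p, p', h'⟩
        refine ⟨m + p, p' + m', fun j => ?_⟩
        have h1 := h (p + j)
        have h2 := h' (m' + j)
        rw [show m + p + j = m + (p + j) by ring, h1,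
          show m' + (p + j) = p + (m' + j) by ring, h2,
          show p' + (m' + j) = p' + m' + j by ring] }

/-- The Gromov boundary `∂_∞ T` of a tree `T`. In a tree every class contains exactly one tight ray
starting at a given vertex. -/
def GromovBoundary (G : SimpleGraph V) : Type v := Quotient (tailSetoid G)

/-- The end `e` eventually lies in the vertex set `C`. -/
def GromovBoundary.EventuallyIn {G : SimpleGraph V} (e : GromovBoundary G) (C : Set V) : Prop :=
  Quotient.liftOn e (fun ρ => ∀ᶠ m in atTop, ρ.vert m ∈ C) (by
    have key : ∀ ρ σ : TightRay G, (∃ m m', ∀ j, ρ.vert (m + j) = σ.vert (m' + j)) →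
        (∀ᶠ m in atTop, ρ.vert m ∈ C) → ∀ᶠ m in atTop, σ.vert m ∈ C := by
      rintro ρ σ ⟨m, m', h⟩ hρ
      obtain ⟨N, hN⟩ := eventually_atTop.1 hρ
      refine eventually_atTop.2 ⟨m' + N, fun q hq => ?_⟩
      obtain ⟨d, rfl⟩ := Nat.exists_eq_add_of_le hq
      rw [show m' + N + d = m' + (N + d) by ring, ← h]
      exact hN _ (by omega)
    intro ρ σ h
    exact propext ⟨key ρ σ h, key σ ρ ((tailSetoid G).symm h)⟩)

/-- The union of the vertex set of a tree `T` and of `∂_∞ T`. -/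
inductive Completion (G : SimpleGraph V) : Type v
  | vertex (x : V) : Completion G
  | atInfinity (e : GromovBoundary G) : Completion G

/-- The vertices of the component of `T ∖ {x}` that contains the vertex `y ≠ x`. -/
def component (G : SimpleGraph V) (x y : V) : Set V :=
  {z | ∃ p : G.Walk y z, x ∉ p.support}

/-- The half-tree based at `x` that contains `y ≠ x`: a component of `T ∖ {x}` together with the
ends whose rays run into that component. -/
def halfTree (G : SimpleGraph V) (x y : V) : Set (Completion G) :=
  {z | match z with
    | .vertex w => w ∈ component G x y
    | .atInfinity e => e.EventuallyIn (component G x y)}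

/-- The observer's topology, generated by the half-trees. (Half-trees based at interior points of
edges have the same traces on vertices and ends as those based at vertices.) -/
instance observersTopology (G : SimpleGraph V) : TopologicalSpace (Completion G) :=
  TopologicalSpace.generateFrom {U | ∃ x y : V, y ≠ x ∧ U = halfTree G x y}

end Trees

/-! ### Free products and their Bass–Serre trees -/

variable {F : Type u} [Group F] {n k : ℕ}

/-- `F = A₁ * ⋯ * Aₙ * F_k`, where `F_k` is free on `s₁, …, s_k`. -/
def IsFreeProductDecomposition (A : Fin n → Subgroup F) (s : Fin k → F) : Prop :=
  Function.Bijective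
    (Monoid.Coprod.lift (Monoid.CoprodI.lift fun i => (A i).subtype) (FreeGroup.lift s))

/-- The automorphism `Φ` permutes the conjugacy classes of the subgroups `A i`. -/
def PermutesFactors (A : Fin n → Subgroup F) (Φ : F ≃* F) : Prop :=
  ∃ σ : Equiv.Perm (Fin n), ∀ i, ∃ g : F, ∀ x : F,
    x ∈ (A i).map Φ.toMonoidHom ↔ g⁻¹ * x * g ∈ A (σ i)

/-- The element `c` is conjugate into some `A i`. -/
def IsPeripheral (A : Fin n → Subgroup F) (c : F) : Prop :=
  ∃ i, ∃ g : F, g⁻¹ * c * g ∈ A i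

/-- The vertices of the Bass–Serre tree of the thistle with `n` prickles and `k` petals: the lifts
`g.⋆` of the vertex `⋆` with trivial group, and the cosets `g A i`. -/
abbrev TreeVertex (A : Fin n → Subgroup F) : Type u := F ⊕ (Σ i, F ⧸ A i)

/-- The Bass–Serre tree of the thistle: `g.⋆` is joined to `g A i` for each prickle, and to
`g s_j.⋆` for each petal. -/
def bassSerreTree (A : Fin n → Subgroup F) (s : Fin k → F) : SimpleGraph (TreeVertex A) :=
  SimpleGraph.fromRel fun x y =>
    (∃ (g : F) (i : Fin n), x = Sum.inl g ∧ y = Sum.inr ⟨i, (g : F ⧸ A i)⟩) ∨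
    (∃ (g : F) (j : Fin k), x = Sum.inl g ∧ y = Sum.inl (g * s j))

theorem bassSerreTree_adj_smul (A : Fin n → Subgroup F) (s : Fin k → F) (c : F)
    {x y : TreeVertex A} (h : (bassSerreTree A s).Adj x y) :
    (bassSerreTree A s).Adj (c • x) (c • y) := by
  have key : ∀ x y : TreeVertex A,
      ((∃ (g : F) (i : Fin n), x = Sum.inl g ∧ y = Sum.inr ⟨i, (g : F ⧸ A i)⟩) ∨
        (∃ (g : F) (j : Fin k), x = Sum.inl g ∧ y = Sum.inl (g * s j))) →
      ((∃ (g : F) (i : Fin n), c • x = Sum.inl g ∧ c • y = Sum.inr ⟨i, (g : F ⧸ A i)⟩) ∨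
        (∃ (g : F) (j : Fin k), c • x = Sum.inl g ∧ c • y = Sum.inl (g * s j))) := by
    rintro x y (⟨g, i, rfl, rfl⟩ | ⟨g, j, rfl, rfl⟩)
    · exact Or.inl ⟨c * g, i, rfl, rfl⟩
    · refine Or.inr ⟨c * g, j, rfl, ?_⟩
      rw [mul_assoc]
      rfl
  rw [bassSerreTree, SimpleGraph.fromRel_adj] at h ⊢
  exact ⟨fun e => h.1 (MulAction.injective c e), h.2.imp (key x y) (key y x)⟩

/-- The image of a tight ray under the action of `c`. -/
def TightRay.translate {A : Fin n → Subgroup F} {s : Fin k → F} (c : F)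
    (ρ : TightRay (bassSerreTree A s)) : TightRay (bassSerreTree A s) where
  vert m := c • ρ.vert m
  adj m := bassSerreTree_adj_smul A s c (ρ.adj m)
  tight m h := ρ.tight m (MulAction.injective c h)

/-- The action of `c` on the ends of the Bass–Serre tree. -/
def GromovBoundary.translate {A : Fin n → Subgroup F} {s : Fin k → F} (c : F)
    (e : GromovBoundary (bassSerreTree A s)) : GromovBoundary (bassSerreTree A s) :=
  Quotient.map (sa := tailSetoid _) (sb := tailSetoid _) (TightRay.translate c)
    (by
      rintro ρ σ ⟨m, m', h⟩
      exact ⟨m, m', fun j => congrArg (c • ·) (h j)⟩) e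

/-- The map `T_c` of `T ∪ ∂_∞ T` induced by the action of `c` on the Bass–Serre tree `T`. -/
def translate {A : Fin n → Subgroup F} {s : Fin k → F} (c : F) :
    Completion (bassSerreTree A s) → Completion (bassSerreTree A s)
  | .vertex x => .vertex (c • x)
  | .atInfinity e => .atInfinity (e.translate c)

/-! ### The Bowditch boundary -/

/-- The points of the Bowditch boundary: the ends of the Bass–Serre tree, and its vertices with
infinite stabilizer. -/
def IsBoundaryPoint {A : Fin n → Subgroup F} {s : Fin k → F} :
    Completion (bassSerreTree A s) → Prop
  | .vertex x => Infinite (MulAction.stabilizer F x)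
  | .atInfinity _ => True

/-- The Bowditch boundary `∂(F, 𝒜)`, with the subspace topology of the observer's topology. -/
abbrev Boundary (A : Fin n → Subgroup F) (s : Fin k → F) : Type u :=
  {x : Completion (bassSerreTree A s) // IsBoundaryPoint x}

/-- The subspace `∂_∞(F, 𝒜)` of ends. -/
def boundaryInfty (A : Fin n → Subgroup F) (s : Fin k → F) : Set (Boundary A s) :=
  {ξ | ∃ e, ξ.1 = Completion.atInfinity e}

/-- The orbit map `g ↦ g.⋆`. -/
def orbitPoint (A : Fin n → Subgroup F) (s : Fin k → F) (g : F) :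
    Completion (bassSerreTree A s) :=
  .vertex (Sum.inl g)

/-- The self-map `h` of the boundary is the continuous extension of `Φ`, where `F` is viewed in
`T ∪ ∂_∞ T` by the orbit map: `Φ(g) → h ξ` as `g → ξ`. -/
def IsBoundaryExtension (A : Fin n → Subgroup F) (s : Fin k → F) (Φ : F ≃* F)
    (h : Boundary A s → Boundary A s) : Prop :=
  ∀ ξ : Boundary A s, Tendsto (fun g => orbitPoint A s (Φ g))
    (comap (orbitPoint A s) (𝓝 ξ.1)) (𝓝 (h ξ).1)

/-! ### The boundary of a subgroup -/

/-- The vertex set of the `H`-minimal subtree: the intersection of all (nonempty) `H`-invariant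
subtrees. For trivial `H`, where no minimal subtree is distinguished, it is empty unless the tree
is a point. -/
def minimalSubtree (A : Fin n → Subgroup F) (s : Fin k → F) (H : Subgroup F) :
    Set (TreeVertex A) :=
  ⋂₀ {S | ((bassSerreTree A s).induce S).Connected ∧ ∀ c ∈ H, ∀ x ∈ S, c • x ∈ S}

/-- `∂(H, 𝒜|_H)` as a subset of `∂(F, 𝒜)`: the ends of the minimal subtree of `H`, and its vertices
whose stabilizer in `H` is infinite. -/
def subgroupBoundary (A : Fin n → Subgroup F) (s : Fin k → F) (H : Subgroup F) :
    Set (Boundary A s) :=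
  {ξ | match ξ.1 with
    | .vertex x => x ∈ minimalSubtree A s H ∧
        (H ⊓ MulAction.stabilizer F x : Subgroup F).carrier.Infinite
    | .atInfinity e => ∃ ρ : TightRay (bassSerreTree A s),
        Quotient.mk (tailSetoid _) ρ = e ∧ ∀ m, ρ.vert m ∈ minimalSubtree A s H}

/-- The endpoints of the axes of the nontrivial nonperipheral elements `c` of `H`, that is, the
fixed points of such `c` on the boundary (its source and its sink). -/
def axisEndpoints (A : Fin n → Subgroup F) (s : Fin k → F) (H : Subgroup F) :
    Set (Boundary A s) :=
  {ξ | ∃ c ∈ H, c ≠ 1 ∧ ¬ IsPeripheral A c ∧ translate c ξ.1 = ξ.1}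

/-- The fixed subgroup of an automorphism. -/
def fixedSubgroup (Φ : F ≃* F) : Subgroup F where
  carrier := {c | Φ c = c}
  mul_mem' {a b} (ha : Φ a = a) (hb : Φ b = b) := show Φ (a * b) = a * b by rw [map_mul, ha, hb]
  one_mem' := map_one Φ
  inv_mem' {a} (ha : Φ a = a) := show Φ a⁻¹ = a⁻¹ by rw [map_inv, ha]

/-! ### Dynamics -/

/-- The point `ξ` of `S` is isolated in `S`. -/
def IsIsolatedIn {X : Type*} [TopologicalSpace X] (S : Set X) (ξ : X) : Prop :=
  ∃ U : Set X, IsOpen U ∧ U ∩ S = {ξ}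

/-- The set of points whose forward orbit converges to `ξ` contains an open neighbourhood of
`ξ`. -/
def IsAttractor {X : Type*} [TopologicalSpace X] (h : X ≃ₜ X) (ξ : X) : Prop :=
  ∃ U : Set X, IsOpen U ∧ ξ ∈ U ∧ ∀ ζ ∈ U, Tendsto (fun m : ℕ => h^[m] ζ) atTop (𝓝 ξ)

/-- A repeller is an attractor for the inverse. -/
def IsRepeller {X : Type*} [TopologicalSpace X] (h : X ≃ₜ X) (ξ : X) : Prop :=
  IsAttractor h.symm ξ

end FreeProductBoundary

open FreeProductBoundary

/-! The tree is encoded by the two sides of each edge, so that a vertex or an end is a consistent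
choice of sides and the observer's topology is the one induced from `E → Bool`. For the Bass–Serre
tree the sides come from an affine action of `F` on functions on edges modulo two, built from the
universal property of the free product.

An automorphism `Φ` permuting the conjugacy classes of the factors induces a permutation `f` of the
vertices that is equivariant up to `Φ`. It need not be a graph map, but there are finitely many
orbits of edges and geodesics are finite, so only finitely many edges have images running over a
given edge (`pullback_finite`). Hence preimages of half-trees have finite coboundary, and `f`
extends continuously to the completion; this is `boundaryHomeo`. The same finiteness, made uniform
by translation, drives everything below: a configuration forced by `f` at an edge confines some
group element to a finite set independent of the edge, and repetition of a value produces elements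
fixed by `Φ`.

For part 1, the minimal subtree of a subgroup containing an element with an axis is the convex hull
of the axis endpoints (`minimalSubtree_eq_hull`), which identifies the ends. Infinite stabilizers in
the hull rotate axis endpoints towards the vertex; conversely, if endpoints of axes of fixed
elements accumulate at a vertex, a pigeonhole argument gives infinitely many fixed elements in its
stabilizer (`infinite_stabilizer_of_mem_closure`). An axis endpoint is not isolated because powers
of the fixed element push one of two further fixed ends arbitrarily close to it.

For part 2, let a fixed end lie outside the closure of the axis endpoints. If `Φ` displaced
infinitely many edges of a ray to it by finitely many elements, two such edges of equal type,
direction and displacement would differ by a fixed element with an axis, and these axes would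
accumulate at the end (`exists_forall_displacement_notMem`). Far out this excludes all bounded
configurations. Consequently the half-trees at the end are mapped into themselves by `f`, or all by
its inverse (`exists_shadow_invariant`), and no point stays between two consecutive half-trees for
three successive times (`exists_finite_stalling`). So orbits descend through all the half-trees, and
the end is an attractor or a repeller. -/

namespace FreeProductBoundary

universe v w

/-! ### Trees described by the sides of their edges -/

/-- A connected graph with a labelling of its edges by `E`, together with, for each edge, a
two-colouring of the vertices that changes across that edge only. Such a graph is a tree, and the
colour classes are the two sides of the edge. -/
structure SidedTree {V : Type v} (G : SimpleGraph V) (E : Type w) where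
  /-- the initial vertex of an edge -/
  src : E → V
  /-- the terminal vertex of an edge -/
  tgt : E → V
  /-- the side of an edge on which a vertex lies -/
  sd : E → V → Bool
  adj_iff : ∀ x y, G.Adj x y ↔ ∃ ε, (src ε = x ∧ tgt ε = y) ∨ (src ε = y ∧ tgt ε = x)
  sd_src : ∀ ε, sd ε (src ε) = false
  sd_tgt : ∀ ε, sd ε (tgt ε) = true
  sd_eq : ∀ ε ε', ε ≠ ε' → sd ε (src ε') = sd ε (tgt ε')
  conn : G.Preconnected

namespace SidedTree

variable {V : Type v} {G : SimpleGraph V} {E : Type w} (S : SidedTree G E)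

/-- The edge `ε` joins `x` and `y`. -/
def Joins (ε : E) (x y : V) : Prop :=
  (S.src ε = x ∧ S.tgt ε = y) ∨ (S.src ε = y ∧ S.tgt ε = x)

/-- The edges separating two vertices. -/
def sep (x y : V) : Set E := {ε | S.sd ε x ≠ S.sd ε y}

/-- The edges with exactly one endpoint in `C`. -/
def coboundary (C : Set V) : Set E := {ε | ¬ (S.src ε ∈ C ↔ S.tgt ε ∈ C)}

variable {S}

/-! ### Separating edges, geodesics and half-trees -/

theorem mem_sep {ε : E} {x y : V} : ε ∈ S.sep x y ↔ S.sd ε x ≠ S.sd ε y := Iff.rfl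

theorem notMem_sep {ε : E} {x y : V} : ε ∉ S.sep x y ↔ S.sd ε x = S.sd ε y := not_not

theorem Joins.symm {ε : E} {x y : V} (h : S.Joins ε x y) : S.Joins ε y x := Or.symm h

theorem Joins.adj {ε : E} {x y : V} (h : S.Joins ε x y) : G.Adj x y :=
  (S.adj_iff x y).2 ⟨ε, h⟩

theorem Joins.ne {ε : E} {x y : V} (h : S.Joins ε x y) : S.sd ε x ≠ S.sd ε y := by
  rcases h with ⟨rfl, rfl⟩ | ⟨rfl, rfl⟩ <;> simp [S.sd_src, S.sd_tgt]

theorem Joins.sd_eq {ε ε' : E} {x y : V} (h : S.Joins ε x y) (h' : ε' ≠ ε) :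
    S.sd ε' x = S.sd ε' y := by
  rcases h with ⟨rfl, rfl⟩ | ⟨rfl, rfl⟩
  · exact S.sd_eq _ _ h'
  · exact (S.sd_eq _ _ h').symm

theorem Joins.mem_sep_iff {ε ε' : E} {x y : V} (h : S.Joins ε x y) :
    ε' ∈ S.sep x y ↔ ε' = ε :=
  ⟨fun h' => by_contra fun hne => h' (h.sd_eq hne), fun e => e ▸ h.ne⟩

theorem joins_src_tgt (ε : E) : S.Joins ε (S.src ε) (S.tgt ε) := Or.inl ⟨rfl, rfl⟩

theorem exists_joins {x y : V} (h : G.Adj x y) : ∃ ε, S.Joins ε x y := (S.adj_iff x y).1 h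

/-- The endpoint of an edge on a given side is unique. -/
theorem Joins.eq_of_sd_eq {ε : E} {x y x' y' : V} (h : S.Joins ε x y) (h' : S.Joins ε x' y')
    (hs : S.sd ε x = S.sd ε x') : x = x' ∧ y = y' := by
  rcases h with ⟨rfl, rfl⟩ | ⟨rfl, rfl⟩ <;> rcases h' with ⟨rfl, rfl⟩ | ⟨rfl, rfl⟩ <;>
    simp_all [S.sd_src, S.sd_tgt]

theorem sep_comm (x y : V) : S.sep x y = S.sep y x := by
  ext ε; exact ne_comm

theorem mem_sep_trans {ε : E} {x y z : V} (h : ε ∈ S.sep x z) : ε ∈ S.sep x y ∨ ε ∈ S.sep y z := by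
  by_contra! hc
  exact h ((notMem_sep.1 hc.1).trans (notMem_sep.1 hc.2))

theorem notMem_sep_of_mem {ε : E} {x y z : V} (h : ε ∈ S.sep x y) (h' : ε ∈ S.sep y z) :
    ε ∉ S.sep x z := by
  rw [mem_sep] at h h'
  rw [notMem_sep]
  cases h1 : S.sd ε x <;> cases h2 : S.sd ε y <;> cases h3 : S.sd ε z <;> simp_all

theorem sep_finite (x y : V) : (S.sep x y).Finite := by
  obtain ⟨p⟩ := S.conn x y
  induction p with
  | nil => convert Set.finite_empty; ext; simp [sep]
  | cons h p ih =>
    obtain ⟨ε, hε⟩ := exists_joins (S := S) h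
    refine (ih.insert ε).subset fun ε' h' => ?_
    rcases mem_sep_trans h' with h1 | h1
    · exact Or.inl (hε.mem_sep_iff.1 h1)
    · exact Or.inr h1

/-- A walk avoiding `x` does not cross an edge incident to `x`. -/
theorem sd_eq_of_walk {ε : E} {x x' y z : V} (h : S.Joins ε x x') (p : G.Walk y z)
    (hp : x ∉ p.support) : S.sd ε y = S.sd ε z := by
  induction p with
  | nil => rfl
  | @cons a b c hab p ih =>
    rw [SimpleGraph.Walk.support_cons, List.mem_cons, not_or] at hp
    obtain ⟨ε', hε'⟩ := exists_joins (S := S) hab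
    rw [← ih hp.2]
    refine hε'.sd_eq ?_
    rintro rfl
    have hb : x ≠ b := fun e => hp.2 (e ▸ p.start_mem_support)
    rcases h with ⟨h1, h2⟩ | ⟨h1, h2⟩ <;> rcases hε' with ⟨h3, h4⟩ | ⟨h3, h4⟩
    · exact hp.1 (h1.symm.trans h3)
    · exact hb (h1.symm.trans h3)
    · exact hb (h2.symm.trans h4)
    · exact hp.1 (h2.symm.trans h4)

/-- A simple path leaves `x` by its first edge and never returns to `x`, so it does not cross that
edge again. -/
theorem exists_first_edge {x y : V} (h : x ≠ y) : ∃ ε u, S.Joins ε x u ∧ ε ∈ S.sep x y := by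
  classical
  obtain ⟨p, hp⟩ := (S.conn x y).exists_isPath
  cases p with
  | nil => exact absurd rfl h
  | cons hab p =>
    obtain ⟨ε, hε⟩ := exists_joins (S := S) hab
    rw [SimpleGraph.Walk.cons_isPath_iff] at hp
    exact ⟨ε, _, hε, fun e => hε.ne (e.trans (sd_eq_of_walk hε p hp.2).symm)⟩

theorem Joins.sep_eq {ε : E} {x u y : V} (h : S.Joins ε x u) (h' : ε ∈ S.sep x y) :
    S.sep u y = S.sep x y \ {ε} := by
  ext ε'
  by_cases e : ε' = ε
  · subst e
    simpa using notMem_sep_of_mem h.symm.ne h'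
  · simp only [Set.mem_sdiff, Set.mem_singleton_iff, e, not_false_eq_true, and_true, mem_sep,
      h.sd_eq e]

/-- Induction along the geodesic towards a vertex `y`. -/
theorem geodesic_induction (y : V) {P : V → Prop} (h0 : P y)
    (hs : ∀ x u ε, S.Joins ε x u → ε ∈ S.sep x y → S.sep u y = S.sep x y \ {ε} → P u → P x)
    (x : V) : P x := by
  induction hn : (S.sep x y).ncard generalizing x with
  | zero =>
    rw [Set.ncard_eq_zero (sep_finite x y)] at hn
    by_cases h : x = y
    · rwa [h]
    · obtain ⟨ε, u, -, hε⟩ := exists_first_edge (S := S) h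
      rw [hn] at hε
      exact hε.elim
  | succ m ih =>
    have h : x ≠ y := by
      rintro rfl
      have : S.sep x x = ∅ := by ext; simp [sep]
      simp [this] at hn
    obtain ⟨ε, u, hj, hε⟩ := exists_first_edge (S := S) h
    have hu := hj.sep_eq hε
    refine hs x u ε hj hε hu (ih u ?_)
    rw [hu, Set.ncard_sdiff_singleton_of_mem hε, hn]
    rfl

theorem sd_injective {x y : V} (h : ∀ ε, S.sd ε x = S.sd ε y) : x = y := by
  by_contra hne
  obtain ⟨ε, u, -, hε⟩ := exists_first_edge (S := S) hne
  exact hε (h ε)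

theorem exists_geodesic_walk (x y : V) :
    ∃ p : G.Walk x y, ∀ v ∈ p.support, S.sep x v ⊆ S.sep x y := by
  refine geodesic_induction (S := S) y (P := fun x => ∃ p : G.Walk x y, ∀ v ∈ p.support,
    S.sep x v ⊆ S.sep x y) ⟨.nil, by simp⟩ ?_ x
  rintro x u ε hj hε hu ⟨p, hp⟩
  refine ⟨.cons hj.adj p, fun v hv ε' hε' => ?_⟩
  rw [SimpleGraph.Walk.support_cons, List.mem_cons] at hv
  rcases hv with rfl | hv
  · exact absurd rfl hε'
  rcases mem_sep_trans (y := u) hε' with h | h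
  · rw [hj.mem_sep_iff.1 h]
    exact hε
  · have := hp v hv h
    rw [hu] at this
    exact this.1

/-- A geodesic from inside `C` to outside `C` crosses the coboundary of `C`. -/
theorem exists_crossing {C : Set V} {x y : V} (hx : x ∈ C) (hy : y ∉ C) :
    ∃ ε ∈ S.sep x y, ε ∈ S.coboundary C ∧
      ∀ e ∉ S.sep x y, S.sd e (S.src ε) = S.sd e x ∧ S.sd e (S.tgt ε) = S.sd e x := by
  revert hx
  refine geodesic_induction (S := S) y (P := fun x => x ∈ C → ∃ ε ∈ S.sep x y, ε ∈ S.coboundary C ∧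
      ∀ e ∉ S.sep x y, S.sd e (S.src ε) = S.sd e x ∧ S.sd e (S.tgt ε) = S.sd e x)
      (fun h => absurd h hy) ?_ x
  intro x u ε hj hε hu ih hx
  by_cases huC : u ∈ C
  · obtain ⟨ε', h1, h2, h3⟩ := ih huC
    rw [hu] at h1
    refine ⟨ε', h1.1, h2, fun e he => ?_⟩
    have he' : e ∉ S.sep u y := by rw [hu]; exact fun h => he h.1
    have : S.sd e x = S.sd e u := hj.sd_eq fun h => he (h ▸ hε)
    rw [this]
    exact h3 e he'
  · refine ⟨ε, hε, ?_, fun e he => ?_⟩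
    · rcases hj with ⟨rfl, rfl⟩ | ⟨rfl, rfl⟩ <;> simp [coboundary, hx, huC]
    · have : S.sd e x = S.sd e u := hj.sd_eq fun h => he (h ▸ hε)
      rcases hj with ⟨rfl, rfl⟩ | ⟨rfl, rfl⟩ <;> simp [this]

theorem mem_iff_of_sep {C : Set V} {x y : V} (h : ∀ ε ∈ S.coboundary C, ε ∉ S.sep x y) :
    x ∈ C ↔ y ∈ C := by
  constructor <;> intro hx <;> by_contra hy
  · obtain ⟨ε, h1, h2, -⟩ := exists_crossing (S := S) hx hy
    exact h ε h2 h1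
  · obtain ⟨ε, h1, h2, -⟩ := exists_crossing (S := S) hx hy
    exact h ε h2 (by rwa [sep_comm])

theorem coboundary_side (ε : E) (b : Bool) : S.coboundary {x | S.sd ε x = b} = {ε} := by
  ext ε'
  simp only [coboundary, Set.mem_ofPred_eq, Set.mem_singleton_iff]
  by_cases h : ε = ε'
  · subst h
    cases b <;> simp [S.sd_src, S.sd_tgt]
  · simp [S.sd_eq _ _ h, Ne.symm h]

/-- Geodesics are convex. -/
theorem sd_of_mem_sep {ε e : E} {x y : V} (hε : ε ∈ S.sep x y) (he : e ∉ S.sep x y) :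
    S.sd e (S.src ε) = S.sd e x ∧ S.sd e (S.tgt ε) = S.sd e x := by
  -- The set to be left is the side of `ε` containing `x`. Its coboundary is `{ε}`, so the crossing
  -- edge is `ε` itself.
  obtain ⟨ε', -, h2, h3⟩ :=
    exists_crossing (S := S) (C := {z | S.sd ε z = S.sd ε x}) (x := x) (y := y) rfl
      (Ne.symm hε)
  rw [coboundary_side, Set.mem_singleton_iff] at h2
  exact h2 ▸ h3 e he

theorem sd_of_joins_of_mem_sep {ε e : E} {x y a b : V} (hj : S.Joins ε a b) (hε : ε ∈ S.sep x y)
    (he : e ∉ S.sep x y) : S.sd e a = S.sd e x := by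
  rcases hj with ⟨rfl, rfl⟩ | ⟨rfl, rfl⟩
  · exact (sd_of_mem_sep hε he).1
  · exact (sd_of_mem_sep hε he).2

/-- A geodesic between two vertices on the same side of `ε` cannot pass through `x` if `x` lies on
the other side. This turns half-trees based at vertices into sides of edges. -/
theorem component_eq {ε : E} {x u y : V} (hj : S.Joins ε x u) (hε : ε ∈ S.sep x y) :
    component G x y = {z | S.sd ε z = S.sd ε y} := by
  ext z
  constructor
  · rintro ⟨p, hp⟩
    exact (sd_eq_of_walk hj p hp).symm
  · intro hz
    obtain ⟨p, hp⟩ := exists_geodesic_walk (S := S) y z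
    refine ⟨p, fun hx => ?_⟩
    exact hp x hx (by rwa [sep_comm]) (Eq.symm hz)

/-! ### Tight rays -/

variable (S) in
/-- The edges of a tight ray. -/
noncomputable def rayEdge (ρ : TightRay G) (m : ℕ) : E := (exists_joins (S := S) (ρ.adj m)).choose

theorem joins_rayEdge (ρ : TightRay G) (m : ℕ) :
    S.Joins (S.rayEdge ρ m) (ρ.vert m) (ρ.vert (m + 1)) :=
  (exists_joins (S := S) (ρ.adj m)).choose_spec

theorem sd_vert_eq {ρ : TightRay G} {ε : E} {a d : ℕ}
    (h : ∀ j < d, S.rayEdge ρ (a + j) ≠ ε) : S.sd ε (ρ.vert a) = S.sd ε (ρ.vert (a + d)) := by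
  induction d with
  | zero => rfl
  | succ d ih =>
    rw [ih fun j hj => h j (hj.trans (Nat.lt_succ_self d))]
    exact (joins_rayEdge ρ (a + d)).sd_eq (h d (Nat.lt_succ_self d)).symm

/-- Induction on the gap `d`. If no edge in between repeats the `m`-th one, a second crossing starts
on the side where the first ended, so the ray is back at `ρ.vert (m + 1)`. For `d = 0` this
contradicts tightness; otherwise the closed path just found crosses the edge `m + 1` only once,
which is impossible. -/
theorem rayEdge_ne (ρ : TightRay G) (d m : ℕ) : S.rayEdge ρ (m + d + 1) ≠ S.rayEdge ρ m := by
  induction d using Nat.strong_induction_on generalizing m with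
  | _ d ih =>
    intro he
    have h1 : S.sd (S.rayEdge ρ m) (ρ.vert (m + 1)) = S.sd (S.rayEdge ρ m) (ρ.vert (m + 1 + d)) :=
      sd_vert_eq fun j hj => by
        have := ih j hj m
        rwa [show m + 1 + j = m + j + 1 by ring]
    have h2 := joins_rayEdge (S := S) ρ (m + d + 1)
    rw [he, show m + d + 1 = m + 1 + d by ring] at h2
    obtain ⟨h3, h4⟩ := (joins_rayEdge (S := S) ρ m).symm.eq_of_sd_eq h2 h1
    rcases d with _ | d
    · exact ρ.tight m h4.symm
    · have h5 : S.sd (S.rayEdge ρ (m + 1)) (ρ.vert (m + 2)) =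
          S.sd (S.rayEdge ρ (m + 1)) (ρ.vert (m + 2 + d)) :=
        sd_vert_eq fun j hj => by
          have := ih j (by omega) (m + 1)
          rwa [show m + 2 + j = m + 1 + j + 1 by ring]
      rw [show m + 2 + d = m + 1 + (d + 1) by ring, ← h3] at h5
      exact (joins_rayEdge (S := S) ρ (m + 1)).ne h5.symm

theorem rayEdge_injective (ρ : TightRay G) : Function.Injective (S.rayEdge ρ) := by
  intro a b h
  by_contra hne
  rcases Nat.lt_or_gt_of_ne hne with hlt | hlt
  · obtain ⟨d, rfl⟩ := Nat.exists_eq_add_of_lt hlt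
    exact rayEdge_ne ρ d a h.symm
  · obtain ⟨d, rfl⟩ := Nat.exists_eq_add_of_lt hlt
    exact rayEdge_ne ρ d b h

theorem sd_rayEdge_of_lt (ρ : TightRay G) {m j : ℕ} (h : m < j) :
    S.sd (S.rayEdge ρ m) (ρ.vert j) = S.sd (S.rayEdge ρ m) (ρ.vert (m + 1)) := by
  obtain ⟨d, rfl⟩ := Nat.exists_eq_add_of_le (Nat.succ_le_of_lt h)
  refine (sd_vert_eq fun i _ he => ?_).symm
  have := rayEdge_injective (S := S) ρ he
  omega

theorem sd_rayEdge_of_le (ρ : TightRay G) {m j : ℕ} (h : j ≤ m) :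
    S.sd (S.rayEdge ρ m) (ρ.vert j) = S.sd (S.rayEdge ρ m) (ρ.vert m) := by
  obtain ⟨d, rfl⟩ := Nat.exists_eq_add_of_le h
  refine sd_vert_eq fun i _ he => ?_
  have := rayEdge_injective (S := S) ρ he
  omega

theorem vert_injective (ρ : TightRay G) (S : SidedTree G E) : Function.Injective ρ.vert := by
  intro a b h
  by_contra hne
  wlog hlt : a < b generalizing a b
  · exact this h.symm (Ne.symm hne) (by omega)
  have := sd_rayEdge_of_lt (S := S) ρ hlt
  rw [← h] at this
  exact (joins_rayEdge ρ a).ne this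

end SidedTree
end FreeProductBoundary

namespace FreeProductBoundary

universe v w

/-! ### Vertices near a point of the completion -/

/-- The filter of vertex sets that contain the vertex `z`, or into which the end `z` runs. -/
def Completion.near {V : Type v} {G : SimpleGraph V} (z : Completion G) : Filter V where
  sets := {C | match z with
    | .vertex w => w ∈ C
    | .atInfinity e => e.EventuallyIn C}
  univ_sets := by
    rcases z with w | e
    · exact Set.mem_univ w
    · induction e using Quotient.inductionOn with
      | _ ρ => exact Eventually.of_forall fun _ => Set.mem_univ _
  sets_of_superset := by
    intro C D h hCD
    rcases z with w | e
    · exact hCD h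
    · induction e using Quotient.inductionOn with
      | _ ρ => exact Eventually.mono h fun _ hx => hCD hx
  inter_sets := by
    intro C D h h'
    rcases z with w | e
    · exact ⟨h, h'⟩
    · induction e using Quotient.inductionOn with
      | _ ρ => exact Eventually.and h h'

namespace SidedTree

variable {V : Type v} {G : SimpleGraph V} {E : Type w} {S : SidedTree G E}

theorem near_vertex (x : V) : (Completion.vertex x : Completion G).near = pure x :=
  Filter.ext fun _ => Iff.rfl

theorem near_mk (ρ : TightRay G) :
    (Completion.atInfinity (Quotient.mk (tailSetoid G) ρ)).near = map ρ.vert atTop :=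
  Filter.ext fun _ => Iff.rfl

theorem mem_halfTree_iff {x y : V} {z : Completion G} :
    z ∈ halfTree G x y ↔ component G x y ∈ z.near := by
  rcases z with w | e <;> exact Iff.rfl

instance near_neBot (z : Completion G) : z.near.NeBot := by
  rcases z with w | e
  · rw [near_vertex]; infer_instance
  · induction e using Quotient.inductionOn with
    | _ ρ => rw [near_mk]; infer_instance

/-- A ray crosses each edge at most once, hence a finite coboundary only finitely often, and is
eventually inside or eventually outside `C`. This is what lets `f` be extended to ends later on. -/
theorem mem_near_or_compl_mem {C : Set V} (hC : (S.coboundary C).Finite) (z : Completion G) :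
    C ∈ z.near ∨ Cᶜ ∈ z.near := by
  rcases z with w | e
  · rw [near_vertex, mem_pure, mem_pure]
    exact em _
  · induction e using Quotient.inductionOn with
    | _ ρ =>
      rw [near_mk]
      have hf : {m | S.rayEdge ρ m ∈ S.coboundary C}.Finite :=
        hC.preimage (rayEdge_injective ρ).injOn
      obtain ⟨N, hN⟩ := hf.bddAbove
      have key : ∀ j, ρ.vert (N + 1) ∈ C ↔ ρ.vert (N + 1 + j) ∈ C := by
        intro j
        induction j with
        | zero => rfl
        | succ j ih =>
          rw [ih]
          have h1 : S.rayEdge ρ (N + 1 + j) ∉ S.coboundary C := fun h => by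
            have := hN h
            omega
          have h2 : S.src (S.rayEdge ρ (N + 1 + j)) ∈ C ↔ S.tgt (S.rayEdge ρ (N + 1 + j)) ∈ C :=
            not_not.1 h1
          rcases joins_rayEdge (S := S) ρ (N + 1 + j) with ⟨h3, h4⟩ | ⟨h3, h4⟩
          · rwa [h3, h4] at h2
          · rw [h3, h4] at h2
            exact h2.symm
      by_cases hx : ρ.vert (N + 1) ∈ C
      · refine Or.inl (mem_map.2 (mem_atTop_sets.2 ⟨N + 1, fun b hb => ?_⟩))
        obtain ⟨j, rfl⟩ := Nat.exists_eq_add_of_le hb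
        exact (key j).1 hx
      · refine Or.inr (mem_map.2 (mem_atTop_sets.2 ⟨N + 1, fun b hb => ?_⟩))
        obtain ⟨j, rfl⟩ := Nat.exists_eq_add_of_le hb
        exact fun h => hx ((key j).2 h)

open Classical in
variable (S) in
/-- The side of an edge on which a point of the completion lies. -/
noncomputable def sdBar (ε : E) (z : Completion G) : Bool :=
  decide ({x | S.sd ε x = true} ∈ z.near)

theorem eventually_sd (ε : E) (z : Completion G) : ∀ᶠ x in z.near, S.sd ε x = S.sdBar ε z := by
  have h := mem_near_or_compl_mem (S := S) (C := {x | S.sd ε x = true})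
    (by rw [coboundary_side]; exact Set.finite_singleton ε) z
  by_cases hz : {x | S.sd ε x = true} ∈ z.near
  · simp only [sdBar, hz, decide_true]
    exact hz
  · simp only [sdBar, hz, decide_false]
    filter_upwards [h.resolve_left hz] with x hx
    simpa using hx

theorem sdBar_eq {ε : E} {z : Completion G} {b : Bool}
    (h : ∃ᶠ x in z.near, S.sd ε x = b) : S.sdBar ε z = b := by
  obtain ⟨x, h1, h2⟩ := (h.and_eventually (eventually_sd ε z)).exists
  rw [← h2, h1]

theorem sdBar_eq_iff {ε : E} {z : Completion G} {b : Bool} :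
    S.sdBar ε z = b ↔ ∀ᶠ x in z.near, S.sd ε x = b :=
  ⟨fun h => h ▸ eventually_sd ε z, fun h => sdBar_eq h.frequently⟩

@[simp] theorem sdBar_vertex (ε : E) (x : V) : S.sdBar ε (.vertex x) = S.sd ε x :=
  sdBar_eq_iff.2 (by rw [near_vertex]; simp)

theorem sdBar_mk_eq {ε : E} {ρ : TightRay G} {b : Bool} :
    S.sdBar ε (.atInfinity (Quotient.mk (tailSetoid G) ρ)) = b ↔
      ∀ᶠ m in atTop, S.sd ε (ρ.vert m) = b := by
  rw [sdBar_eq_iff, near_mk, eventually_map]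

theorem sdBar_rayEdge (ρ : TightRay G) (m : ℕ) :
    S.sdBar (S.rayEdge ρ m) (.atInfinity (Quotient.mk (tailSetoid G) ρ)) =
      S.sd (S.rayEdge ρ m) (ρ.vert (m + 1)) :=
  sdBar_mk_eq.2 (eventually_atTop.2 ⟨m + 1, fun _ hj => sd_rayEdge_of_lt ρ hj⟩)

/-- Finitely many edges cannot tell a point of the completion from a suitable vertex, so statements
about finitely many sides pass from vertices to ends. -/
theorem exists_vertex_sd_eq (z : Completion G) {Q : Set E} (hQ : Q.Finite) :
    ∃ p, ∀ e ∈ Q, S.sd e p = S.sdBar e z :=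
  ((eventually_all_finite hQ).2 fun e _ => eventually_sd e z).exists

/-- Geodesics between points of the completion are convex. -/
theorem sd_of_sdBar_ne {ε e : E} {z z' : Completion G} (hε : S.sdBar ε z ≠ S.sdBar ε z')
    (he : S.sdBar e z = S.sdBar e z') {a b : V} (hj : S.Joins ε a b) :
    S.sd e a = S.sdBar e z := by
  obtain ⟨p, hp⟩ := exists_vertex_sd_eq (S := S) z (Q := {ε, e}) (Set.toFinite _)
  obtain ⟨p', hp'⟩ := exists_vertex_sd_eq (S := S) z' (Q := {ε, e}) (Set.toFinite _)
  rw [← hp e (by simp)]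
  refine sd_of_joins_of_mem_sep (y := p') hj ?_ ?_
  · rw [mem_sep, hp ε (by simp), hp' ε (by simp)]
    exact hε
  · rw [notMem_sep, hp e (by simp), hp' e (by simp)]
    exact he

theorem mem_near_iff_of_sdBar {C : Set V} (hC : (S.coboundary C).Finite) {z z' : Completion G}
    (h : ∀ ε ∈ S.coboundary C, S.sdBar ε z = S.sdBar ε z') : C ∈ z.near ↔ C ∈ z'.near := by
  have key : ∀ z z' : Completion G, (∀ ε ∈ S.coboundary C, S.sdBar ε z = S.sdBar ε z') →
      C ∈ z.near → C ∈ z'.near := by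
    intro z z' h hz
    by_contra hz'
    obtain ⟨p, hp, hpC⟩ := (((eventually_all_finite hC).2 fun e _ => eventually_sd e z).and
      (show ∀ᶠ x in z.near, x ∈ C from hz)).exists
    obtain ⟨q, hq, hqC⟩ := (((eventually_all_finite hC).2 fun e _ => eventually_sd e z').and
      (show ∀ᶠ x in z'.near, x ∈ Cᶜ from (mem_near_or_compl_mem hC z').resolve_left hz')).exists
    refine hqC ((mem_iff_of_sep (S := S) (C := C) fun ε hε => ?_).1 hpC)
    rw [notMem_sep, hp ε hε, hq ε hε, h ε hε]
  exact ⟨key z z' h, key z' z fun ε hε => (h ε hε).symm⟩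

/-! ### The observer's topology in terms of sides -/

theorem halfTree_eq {ε : E} {x u y : V} (hj : S.Joins ε x u) (hε : ε ∈ S.sep x y) :
    halfTree G x y = {z | S.sdBar ε z = S.sd ε y} := by
  ext z
  rw [mem_halfTree_iff, component_eq hj hε]
  exact sdBar_eq_iff.symm

/-- Every half-tree is a side of the first edge in its direction, and every side of an edge is the
half-tree based at the opposite endpoint. So the two sub-bases coincide. -/
theorem isInducing_sdBar (S : SidedTree G E) :
    IsInducing (fun (z : Completion G) (ε : E) => S.sdBar ε z) := by
  refine ⟨le_antisymm ?_ ?_⟩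
  · rw [← continuous_iff_le_induced]
    refine continuous_pi fun ε => continuous_discrete_rng.2 fun b => ?_
    have key : ∀ x y, S.Joins ε x y → S.sd ε y = b →
        IsOpen ((fun z : Completion G => S.sdBar ε z) ⁻¹' {b}) := by
      intro x y hj hb
      refine TopologicalSpace.isOpen_generateFrom_of_mem ⟨x, y, hj.adj.ne', ?_⟩
      rw [halfTree_eq hj hj.ne, hb]
      rfl
    cases b
    · exact key _ _ (joins_src_tgt ε).symm (S.sd_src ε)
    · exact key _ _ (joins_src_tgt ε) (S.sd_tgt ε)
  · refine le_generateFrom ?_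
    rintro U ⟨x, y, hne, rfl⟩
    obtain ⟨ε, u, hj, hε⟩ := exists_first_edge (S := S) hne.symm
    rw [halfTree_eq hj hε]
    have hc : Continuous fun g : E → Bool => g ε := continuous_apply ε
    exact isOpen_induced_iff.2 ⟨{g | g ε = S.sd ε y},
      (isOpen_discrete {S.sd ε y}).preimage hc, rfl⟩

theorem tendsto_nhds_iff {α : Type*} {l : Filter α} {g : α → Completion G} {z : Completion G} :
    Tendsto g l (𝓝 z) ↔ ∀ ε, ∀ᶠ a in l, S.sdBar ε (g a) = S.sdBar ε z := by
  rw [S.isInducing_sdBar.tendsto_nhds_iff, tendsto_pi_nhds]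
  simp [nhds_discrete, tendsto_pure]

theorem hasBasis_nhds (S : SidedTree G E) (z : Completion G) :
    (𝓝 z).HasBasis (fun Q : Set E => Q.Finite)
      (fun Q => {z' | ∀ ε ∈ Q, S.sdBar ε z' = S.sdBar ε z}) := by
  rw [S.isInducing_sdBar.nhds_eq_comap]
  constructor
  intro U
  rw [nhds_pi, mem_comap]
  constructor
  · rintro ⟨W, hW, hWU⟩
    obtain ⟨I, hI, t, ht, hsub⟩ := Filter.mem_pi.1 hW
    refine ⟨I, hI, fun z' hz' => hWU (hsub fun ε hε => ?_)⟩
    have := ht ε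
    rw [nhds_discrete, mem_pure] at this
    change S.sdBar ε z' ∈ t ε
    rwa [hz' ε hε]
  · rintro ⟨Q, hQ, hsub⟩
    refine ⟨Q.pi fun ε => {S.sdBar ε z}, Filter.pi_mem_pi hQ fun ε _ => by simp,
      fun z' hz' => hsub fun ε hε => hz' ε hε⟩

theorem eventually_nhds_sdBar (ε : E) (z : Completion G) :
    ∀ᶠ z' in 𝓝 z, S.sdBar ε z' = S.sdBar ε z :=
  tendsto_nhds_iff.1 tendsto_id ε

theorem isOpen_side (S : SidedTree G E) (ε : E) (b : Bool) :
    IsOpen {z : Completion G | S.sdBar ε z = b} := by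
  refine isOpen_iff_mem_nhds.2 fun z hz => ?_
  filter_upwards [eventually_nhds_sdBar (S := S) ε z] with z' hz'
  exact hz'.trans hz

/-! ### Points of the completion as orientations -/

theorem exists_rayEdge_notMem {ρ : TightRay G} {Q : Set E} (hQ : Q.Finite) :
    ∃ T, ∀ t ≥ T, S.rayEdge ρ t ∉ Q := by
  obtain ⟨N, hN⟩ := (hQ.preimage (rayEdge_injective (S := S) ρ).injOn).bddAbove
  exact ⟨N + 1, fun t ht h => by have := hN h; omega⟩

theorem vertex_sdBar_ne_end (x : V) (ρ : TightRay G) :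
    ∃ ε, S.sd ε x ≠ S.sdBar ε (.atInfinity (Quotient.mk (tailSetoid G) ρ)) := by
  obtain ⟨T, hT⟩ := exists_rayEdge_notMem (S := S) (ρ := ρ) (sep_finite (ρ.vert 0) x)
  refine ⟨S.rayEdge ρ T, ?_⟩
  rw [← notMem_sep.1 (hT T le_rfl), sdBar_rayEdge, sd_rayEdge_of_le ρ (Nat.zero_le T)]
  exact (joins_rayEdge ρ T).ne

theorem eq_rayEdge_of_sdBar_ne {σ : TightRay G} {ε : E}
    (h : S.sd ε (σ.vert 0) ≠ S.sdBar ε (.atInfinity (Quotient.mk (tailSetoid G) σ))) :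
    ∃ m, S.rayEdge σ m = ε := by
  by_contra! hc
  exact h (Eq.symm (sdBar_mk_eq.2 (Eventually.of_forall fun m => by
    have := (sd_vert_eq (S := S) (ρ := σ) (ε := ε) (a := 0) (d := m) fun j _ => hc _).symm
    rwa [zero_add] at this)))

/-- Edges far out on `ρ` do not separate the two starting points, so `σ` has to cross them as well,
in the same direction. As `σ` visits no vertex twice, the two rays stay in step from then on. -/
theorem end_eq_of_sdBar (ρ σ : TightRay G)
    (h : ∀ ε, S.sdBar ε (.atInfinity (Quotient.mk (tailSetoid G) ρ)) =
      S.sdBar ε (.atInfinity (Quotient.mk (tailSetoid G) σ))) :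
    Quotient.mk (tailSetoid G) ρ = Quotient.mk (tailSetoid G) σ := by
  obtain ⟨T, hT⟩ := exists_rayEdge_notMem (S := S) (ρ := ρ) (sep_finite (ρ.vert 0) (σ.vert 0))
  have key : ∀ t ≥ T, ∃ m, ρ.vert t = σ.vert m ∧ ρ.vert (t + 1) = σ.vert (m + 1) := by
    intro t ht
    have h1 : S.sd (S.rayEdge ρ t) (σ.vert 0) = S.sd (S.rayEdge ρ t) (ρ.vert t) := by
      rw [← notMem_sep.1 (hT t ht), sd_rayEdge_of_le ρ (Nat.zero_le t)]
    obtain ⟨m, hm⟩ := eq_rayEdge_of_sdBar_ne (S := S) (σ := σ) (ε := S.rayEdge ρ t) (by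
      rw [h1, ← h, sdBar_rayEdge]
      exact (joins_rayEdge ρ t).ne)
    refine ⟨m, (joins_rayEdge (S := S) ρ t).eq_of_sd_eq (hm ▸ joins_rayEdge (S := S) σ m) ?_⟩
    rw [← h1, ← hm, sd_rayEdge_of_le σ (Nat.zero_le m)]
  obtain ⟨m, hm, -⟩ := key T le_rfl
  refine Quotient.sound ⟨T, m, fun j => ?_⟩
  induction j with
  | zero => exact hm
  | succ j ih =>
    obtain ⟨m', h1, h2⟩ := key (T + j) (by omega)
    rw [← add_assoc, h2, vert_injective σ S (h1.symm.trans ih), add_assoc]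

theorem sdBar_injective (S : SidedTree G E) :
    Function.Injective (fun (z : Completion G) (ε : E) => S.sdBar ε z) := by
  intro z z' h
  have h' : ∀ ε, S.sdBar ε z = S.sdBar ε z' := fun ε => congrFun h ε
  rcases z with x | e <;> rcases z' with y | e'
  · exact congrArg _ (sd_injective (S := S) (by simpa using h'))
  · induction e' using Quotient.inductionOn with
    | _ ρ =>
      obtain ⟨ε, hε⟩ := vertex_sdBar_ne_end (S := S) x ρ
      exact absurd (by simpa using h' ε) hε
  · induction e using Quotient.inductionOn with
    | _ ρ =>
      obtain ⟨ε, hε⟩ := vertex_sdBar_ne_end (S := S) y ρ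
      exact absurd (by simpa using (h' ε).symm) hε
  · induction e using Quotient.inductionOn with
    | _ ρ =>
      induction e' using Quotient.inductionOn with
      | _ σ => exact congrArg _ (end_eq_of_sdBar (S := S) ρ σ h')

theorem ext_sdBar {z z' : Completion G} (h : ∀ ε, S.sdBar ε z = S.sdBar ε z') : z = z' :=
  S.sdBar_injective (funext h)

theorem t2Space_completion (S : SidedTree G E) : T2Space (Completion G) :=
  Topology.IsEmbedding.t2Space ⟨S.isInducing_sdBar, S.sdBar_injective⟩

/-- The first edge of the geodesic from `x` that points in the direction of a consistent
orientation. -/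
theorem exists_edge_of_orientation {o : E → Bool}
    (ho : ∀ e e', ∃ p, S.sd e p = o e ∧ S.sd e' p = o e') {x : V} {ε : E}
    (hε : S.sd ε x ≠ o ε) {b : V} (hb : S.sd ε b = o ε) :
    ∃ ε' u, S.Joins ε' x u ∧ S.sd ε' x ≠ o ε' ∧ ε' ∈ S.sep x b := by
  obtain ⟨ε', u, hu, hs⟩ := exists_first_edge (S := S) (x := x) (y := b)
    (fun e => hε (by rw [e, hb]))
  refine ⟨ε', u, hu, ?_, hs⟩
  by_cases he : ε' = ε
  · rwa [he]
  intro hx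
  obtain ⟨p, h1, h2⟩ := ho ε ε'
  have h3 : ε' ∈ S.sep b p := by
    rw [mem_sep, h2, ← hx]
    exact Ne.symm hs
  have h4 := sd_of_joins_of_mem_sep (S := S) hu h3 (e := ε) (by rw [notMem_sep, h1, hb])
  exact hε (h4.trans hb)

/-- Every consistent choice of sides is given by a point of the completion. -/
theorem exists_of_orientation [Nonempty V] {o : E → Bool}
    (ho : ∀ e e', ∃ p, S.sd e p = o e ∧ S.sd e' p = o e') :
    ∃ z : Completion G, ∀ ε, S.sdBar ε z = o ε := by
  by_cases hx : ∃ x, ∀ ε, S.sd ε x = o ε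
  · obtain ⟨x, hx⟩ := hx
    exact ⟨.vertex x, by simpa using hx⟩
  push Not at hx
  have hend : ∀ ε, ∃ b, S.sd ε b = o ε := fun ε => (ho ε ε).imp fun _ h => h.1
  have hstep : ∀ x, ∃ u ε', S.Joins ε' x u ∧ S.sd ε' x ≠ o ε' := by
    intro x
    obtain ⟨ε, hε⟩ := hx x
    obtain ⟨b, hb⟩ := hend ε
    obtain ⟨ε', u, h1, h2, -⟩ := exists_edge_of_orientation ho hε hb
    exact ⟨u, ε', h1, h2⟩
  choose next edge hnext hedge using hstep
  have hedge' : ∀ x, S.sd (edge x) (next x) = o (edge x) := by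
    intro x
    have h1 := (hnext x).ne
    have h2 := hedge x
    revert h1 h2
    cases S.sd (edge x) x <;> cases S.sd (edge x) (next x) <;> cases o (edge x) <;> simp
  -- Two different edges pointing away from `x` would lead to disjoint half-trees, against pairwise
  -- consistency of `o`.
  have huniq : ∀ x u ε, S.Joins ε x u → S.sd ε x ≠ o ε → ε = edge x := by
    intro x u ε hj hε
    by_contra hne
    obtain ⟨p, h1, h2⟩ := ho ε (edge x)
    have h3 : ε ∈ S.sep (next x) p := by
      rw [mem_sep, h1, ← (hnext x).sd_eq hne]
      exact hε
    have h4 := sd_of_joins_of_mem_sep (S := S) hj h3 (e := edge x) (by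
      rw [notMem_sep, h2, hedge'])
    exact (hnext x).ne h4
  obtain ⟨x₀⟩ := ‹Nonempty V›
  let ρ : TightRay G :=
    { vert := fun m => next^[m] x₀
      adj := fun m => by
        rw [Function.iterate_succ_apply']
        exact (hnext _).adj
      tight := fun m h => by
        rw [Function.iterate_succ_apply', Function.iterate_succ_apply'] at h
        set y := next^[m] x₀
        have h1 := (hnext (next y)).symm
        rw [h] at h1
        have h2 : edge (next y) ∈ S.sep y (next y) := h1.ne
        rw [(hnext y).mem_sep_iff] at h2
        have h3 := hedge (next y)
        rw [h2, hedge'] at h3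
        exact h3 rfl }
  have hρ : ∀ m, S.rayEdge ρ m = edge (ρ.vert m) := by
    intro m
    have h1 := joins_rayEdge (S := S) ρ m
    have h2 : ρ.vert (m + 1) = next (ρ.vert m) := Function.iterate_succ_apply' _ _ _
    have h3 : S.rayEdge ρ m ∈ S.sep (ρ.vert m) (next (ρ.vert m)) := h2 ▸ h1.ne
    exact (hnext _).mem_sep_iff.1 h3
  refine ⟨.atInfinity (Quotient.mk (tailSetoid G) ρ), fun ε => ?_⟩
  by_cases hm : ∃ m, S.rayEdge ρ m = ε
  · obtain ⟨m, rfl⟩ := hm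
    rw [sdBar_rayEdge, show ρ.vert (m + 1) = next (ρ.vert m) from Function.iterate_succ_apply' _ _ _,
      hρ, hedge']
  · push Not at hm
    -- An edge never crossed by the ray but oriented away from it would put every edge of the ray on
    -- the geodesic from `ρ.vert 0` to an endpoint `b` of the chosen side, which is finite.
    by_contra hne
    have hsd : ∀ m, S.sd ε (ρ.vert m) =
        S.sdBar ε (.atInfinity (Quotient.mk (tailSetoid G) ρ)) := by
      have h0 : ∀ m, S.sd ε (ρ.vert 0) = S.sd ε (ρ.vert m) := fun m => by
        simpa using sd_vert_eq (S := S) (ρ := ρ) (ε := ε) (a := 0) (d := m) fun j _ => hm _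
      intro m
      rw [← h0 m]
      exact (sdBar_mk_eq.2 (Eventually.of_forall fun m => (h0 m).symm)).symm
    obtain ⟨b, hb⟩ := hend ε
    have hmem : ∀ m, S.rayEdge ρ m ∈ S.sep (ρ.vert 0) b := by
      intro m
      obtain ⟨ε', u, h1, h2, h3⟩ := exists_edge_of_orientation ho (x := ρ.vert m)
        (by rw [hsd]; exact hne) hb
      rw [huniq _ _ _ h1 h2, ← hρ] at h3
      rw [mem_sep, sd_rayEdge_of_le ρ (Nat.zero_le m)]
      exact h3
    obtain ⟨T, hT⟩ := exists_rayEdge_notMem (S := S) (ρ := ρ) (sep_finite (ρ.vert 0) b)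
    exact hT T le_rfl (hmem T)

/-! ### Half-trees at an end -/

variable (S) in
/-- The side of the `t`-th edge of a tight ray that contains its end. -/
def shadow (ρ : TightRay G) (t : ℕ) : Set V :=
  {x | S.sd (S.rayEdge ρ t) x = S.sd (S.rayEdge ρ t) (ρ.vert (t + 1))}

theorem vert_mem_shadow (ρ : TightRay G) {t m : ℕ} : ρ.vert m ∈ S.shadow ρ t ↔ t < m := by
  constructor
  · intro h
    by_contra hm
    refine (joins_rayEdge (S := S) ρ t).ne ?_
    rw [← sd_rayEdge_of_le ρ (not_lt.1 hm)]
    exact h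
  · exact fun h => sd_rayEdge_of_lt ρ h

theorem coboundary_shadow (ρ : TightRay G) (t : ℕ) : S.coboundary (S.shadow ρ t) = {S.rayEdge ρ t} :=
  coboundary_side _ _

theorem eventually_notMem_shadow (ρ : TightRay G) (x : V) : ∃ T, ∀ t ≥ T, x ∉ S.shadow ρ t := by
  obtain ⟨T, hT⟩ := exists_rayEdge_notMem (S := S) (ρ := ρ) (sep_finite (ρ.vert 0) x)
  refine ⟨T, fun t ht h => ?_⟩
  have h1 := notMem_sep.1 (hT t ht)
  have h2 : ρ.vert 0 ∈ S.shadow ρ t := h1.trans h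
  exact absurd (vert_mem_shadow ρ |>.1 h2) (Nat.not_lt_zero t)

/-- If a point were beyond the edge `t + 1` but not beyond the edge `t`, convexity would place
`ρ.vert t` beyond the edge `t + 1`. -/
theorem shadow_succ_subset (ρ : TightRay G) (t : ℕ) : S.shadow ρ (t + 1) ⊆ S.shadow ρ t := by
  intro x hx
  by_contra hxt
  have h1 : S.rayEdge ρ t ∈ S.sep x (ρ.vert (t + 2)) := by
    rw [mem_sep, sd_rayEdge_of_lt ρ (show t < t + 2 by omega)]
    exact hxt
  have h2 := sd_of_joins_of_mem_sep (S := S) (joins_rayEdge ρ t) h1 (e := S.rayEdge ρ (t + 1))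
    (by rw [notMem_sep]; exact hx)
  have h3 : ρ.vert t ∈ S.shadow ρ (t + 1) := h2.trans hx
  have := (vert_mem_shadow ρ).1 h3
  omega

theorem shadow_antitone (ρ : TightRay G) : Antitone (S.shadow ρ) :=
  antitone_nat_of_succ_le (shadow_succ_subset ρ)

theorem shadow_mem_near_iff {ρ : TightRay G} {t : ℕ} {z : Completion G} :
    S.shadow ρ t ∈ z.near ↔ S.sdBar (S.rayEdge ρ t) z =
      S.sdBar (S.rayEdge ρ t) (.atInfinity (Quotient.mk (tailSetoid G) ρ)) := by
  rw [sdBar_rayEdge, sdBar_eq_iff]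
  rfl

/-- The half-trees cut off by the edges of a ray form a neighbourhood basis of its end. -/
theorem exists_shadow_sdBar (ρ : TightRay G) (ε : E) :
    ∃ T, ∀ t ≥ T, ∀ z : Completion G, S.shadow ρ t ∈ z.near →
      S.sdBar ε z = S.sdBar ε (.atInfinity (Quotient.mk (tailSetoid G) ρ)) := by
  obtain ⟨T, hT⟩ := eventually_notMem_shadow (S := S) ρ (S.src ε)
  refine ⟨T, fun t ht z hz => ?_⟩
  by_contra hne
  have h := sd_of_sdBar_ne hne (e := S.rayEdge ρ t) (shadow_mem_near_iff.1 hz) (joins_src_tgt ε)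
  refine hT t ht ?_
  rw [shadow_mem_near_iff.1 hz, sdBar_rayEdge] at h
  exact h

theorem isOpen_shadow (ρ : TightRay G) (t : ℕ) :
    IsOpen {z : Completion G | S.shadow ρ t ∈ z.near} := by
  simp only [shadow_mem_near_iff]
  exact S.isOpen_side _ _

theorem tendsto_end_iff {α : Type*} {l : Filter α} {g : α → Completion G} {ρ : TightRay G}
    (h : ∀ t, ∀ᶠ a in l, S.shadow ρ t ∈ (g a).near) :
    Tendsto g l (𝓝 (.atInfinity (Quotient.mk (tailSetoid G) ρ))) := by
  refine tendsto_nhds_iff (S := S).2 fun ε => ?_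
  obtain ⟨T, hT⟩ := exists_shadow_sdBar (S := S) ρ ε
  filter_upwards [h T] with a ha
  exact hT T le_rfl _ ha

end SidedTree
end FreeProductBoundary

namespace FreeProductBoundary

universe u

/-! ### The Bass–Serre tree as a sided tree -/

section BassSerre

variable {F : Type u} [Group F] {n k : ℕ} {A : Fin n → Subgroup F} {s : Fin k → F}

theorem IsFreeProductDecomposition.exists_hom (hF : IsFreeProductDecomposition A s)
    {K : Type*} [Group K] (φ : ∀ i, A i →* K) (t : Fin k → K) :
    ∃ ψ : F →* K, (∀ i (a : A i), ψ a = φ i a) ∧ ∀ j, ψ (s j) = t j := by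
  let π := Monoid.Coprod.lift (Monoid.CoprodI.lift fun i => (A i).subtype) (FreeGroup.lift s)
  let e := MulEquiv.ofBijective π hF
  let L : Monoid.Coprod (Monoid.CoprodI fun i => A i) (FreeGroup (Fin k)) →* K :=
    Monoid.Coprod.lift (Monoid.CoprodI.lift φ) (FreeGroup.lift t)
  refine ⟨L.comp e.symm.toMonoidHom, fun i a => ?_, fun j => ?_⟩
  · have h' : e.symm (a : F) = Monoid.Coprod.inl (Monoid.CoprodI.of (M := fun i => A i) a) :=
      hF.1 ((MulEquiv.ofBijective_apply_symm_apply π hF).trans (by simp))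
    simp [L, h']
  · have h' : e.symm (s j) = Monoid.Coprod.inr (FreeGroup.of j) :=
      hF.1 ((MulEquiv.ofBijective_apply_symm_apply π hF).trans (by simp))
    simp [L, h']

theorem IsFreeProductDecomposition.eq_top (hF : IsFreeProductDecomposition A s)
    {K : Subgroup F} (hA : ∀ i, A i ≤ K) (hs : ∀ j, s j ∈ K) : K = ⊤ := by
  rw [eq_top_iff]
  intro x _
  obtain ⟨y, rfl⟩ := hF.2 x
  have h : (Monoid.Coprod.lift (Monoid.CoprodI.lift fun i => (A i).subtype)
      (FreeGroup.lift s)).range ≤ K := by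
    rw [Monoid.Coprod.range_lift, sup_le_iff]
    constructor
    · exact Monoid.CoprodI.lift_range_le _ (fun i => (A i).subtype) fun i => by simpa using hA i
    · exact FreeGroup.range_lift_le (by rintro _ ⟨j, rfl⟩; exact hs j)
  exact h ⟨y, rfl⟩

variable (F n k) in
/-- The edges of the Bass–Serre tree: `(g, i)` joins `g.⋆` to `g A i`, and `(g, j)` joins `g.⋆` to
`g s_j.⋆`. -/
abbrev TreeEdge : Type u := F × (Fin n ⊕ Fin k)

/-- The terminal vertex of an edge of the Bass–Serre tree. -/
def edgeTgt (A : Fin n → Subgroup F) (s : Fin k → F) : TreeEdge F n k → TreeVertex A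
  | (g, .inl i) => .inr ⟨i, (g : F ⧸ A i)⟩
  | (g, .inr j) => .inl (g * s j)

/-- Functions on the edges modulo two, written multiplicatively. -/
abbrev EdgeChain (F : Type u) (n k : ℕ) : Type u := Multiplicative (TreeEdge F n k → ZMod 2)

/-- The action of `F` on functions on the edges. -/
def edgeChainAction (F : Type u) [Group F] (n k : ℕ) : F →* MulAut (EdgeChain F n k) where
  toFun c :=
    { toFun := fun m => .ofAdd fun ε => m.toAdd (c⁻¹ * ε.1, ε.2)
      invFun := fun m => .ofAdd fun ε => m.toAdd (c * ε.1, ε.2)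
      left_inv := fun m => by simp
      right_inv := fun m => by simp
      map_mul' := fun _ _ => rfl }
  map_one' := by ext; simp
  map_mul' a b := by ext; simp [mul_assoc]

/-- The function supported on one edge. -/
noncomputable def singleChain (ε : TreeEdge F n k) : EdgeChain F n k :=
  open Classical in .ofAdd (Pi.single ε 1)

theorem edgeChainAction_single (c g : F) (ι : Fin n ⊕ Fin k) :
    edgeChainAction F n k c (singleChain (g, ι)) = singleChain (c * g, ι) := by
  classical
  apply Multiplicative.toAdd.injective
  funext ε
  change (Pi.single (g, ι) (1 : ZMod 2) : TreeEdge F n k → ZMod 2) (c⁻¹ * ε.1, ε.2) =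
    (Pi.single (c * g, ι) (1 : ZMod 2) : TreeEdge F n k → ZMod 2) ε
  rw [Pi.single_apply, Pi.single_apply]
  congr 1
  rw [Prod.ext_iff, Prod.ext_iff]
  simp [inv_mul_eq_iff_eq_mul]

/-- The group of affine transformations of the functions on the edges with linear part in `F`. -/
abbrev EdgeAffine (F : Type u) [Group F] (n k : ℕ) : Type u :=
  SemidirectProduct (EdgeChain F n k) F (edgeChainAction F n k)

/-- The universal property yields a homomorphism `ψ` to affine maps of edge functions: `A i` acts
linearly after conjugation by the translation along the edge `(1, i)`, and `s j` acts with
translation part the edge `(1, j)`. Then `θ` is the orbit of the origin at the vertices `g.⋆`, and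
at `g A i` the image under `g` of the point fixed by `A i`. Thus `θ` jumps by exactly one edge
across each edge, which replaces the normal form theorem: every edge separates the tree. -/
theorem exists_edgeCocycle (hF : IsFreeProductDecomposition A s) :
    ∃ θ : TreeVertex A → TreeEdge F n k → ZMod 2,
      (∀ ε : TreeEdge F n k, θ (edgeTgt A s ε) = θ (.inl ε.1) + (singleChain ε).toAdd) ∧
      ∀ (c : F) (x y : TreeVertex A) (ε : TreeEdge F n k),
        θ (c • x) (c * ε.1, ε.2) - θ (c • y) (c * ε.1, ε.2) = θ x ε - θ y ε := by
  classical
  let e : Fin n → EdgeAffine F n k := fun i => SemidirectProduct.inl (singleChain (1, .inl i))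
  obtain ⟨ψ, hψA, hψs⟩ := hF.exists_hom (K := EdgeAffine F n k)
    (fun i => (MulAut.conj (e i)).toMonoidHom.comp (SemidirectProduct.inr.comp (A i).subtype))
    (fun j => SemidirectProduct.inl (singleChain (1, .inr j)) * SemidirectProduct.inr (s j))
  have hright : ∀ g, (ψ g).right = g := by
    let L : Subgroup F := MonoidHom.eqLocus (SemidirectProduct.rightHom.comp ψ) (MonoidHom.id F)
    have hL : L = ⊤ := hF.eq_top
      (fun i a ha => by
        have := hψA i ⟨a, ha⟩
        change (ψ a).right = a
        rw [show ψ a = _ from this]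
        simp [e])
      (fun j => by
        change (ψ (s j)).right = s j
        simp [hψs])
    intro g
    have : g ∈ L := by rw [hL]; trivial
    exact this
  let θ : TreeVertex A → EdgeChain F n k := fun x => match x with
    | .inl g => (ψ g).left
    | .inr ⟨i, q⟩ => Quotient.liftOn' q (fun g => (ψ g * e i).left) (by
        intro g h hgh
        rw [QuotientGroup.leftRel_apply] at hgh
        obtain ⟨a, ha, rfl⟩ : ∃ a ∈ A i, h = g * a := ⟨_, hgh, by group⟩
        have := hψA i ⟨a, ha⟩
        have h2 : ψ a * e i = e i * SemidirectProduct.inr a := by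
          rw [show ψ a = _ from this]
          simp
        change (ψ g * e i).left = (ψ (g * a) * e i).left
        rw [map_mul, mul_assoc, h2, ← mul_assoc]
        simp)
  have htgt : ∀ ε : TreeEdge F n k, θ (edgeTgt A s ε) = θ (.inl ε.1) * singleChain ε := by
    rintro ⟨g, i | j⟩
    · change (ψ g * e i).left = (ψ g).left * _
      rw [SemidirectProduct.mul_left, hright]
      simp [e, edgeChainAction_single]
    · change (ψ (g * s j)).left = (ψ g).left * _
      rw [map_mul, SemidirectProduct.mul_left, hright, hψs]
      simp [edgeChainAction_single]
  have hsmul : ∀ (c : F) (x : TreeVertex A),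
      θ (c • x) = (ψ c).left * edgeChainAction F n k c (θ x) := by
    rintro c (g | ⟨i, q⟩)
    · change (ψ (c * g)).left = _
      rw [map_mul, SemidirectProduct.mul_left, hright]
    · induction q using QuotientGroup.induction_on with
      | _ g =>
        change (ψ (c * g) * e i).left = (ψ c).left * edgeChainAction F n k c ((ψ g * e i).left)
        rw [map_mul, mul_assoc, SemidirectProduct.mul_left, hright]
  refine ⟨fun x => (θ x).toAdd, fun ε => ?_, fun c x y ε => ?_⟩
  · exact congrArg Multiplicative.toAdd (htgt ε)
  · have key : ∀ x, (θ (c • x)).toAdd (c * ε.1, ε.2) =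
        (ψ c).left.toAdd (c * ε.1, ε.2) + (θ x).toAdd ε := by
      intro x
      rw [hsmul]
      change _ + (θ x).toAdd (c⁻¹ * (c * ε.1), ε.2) = _
      rw [inv_mul_cancel_left]
      rfl
    change (θ (c • x)).toAdd _ - (θ (c • y)).toAdd _ = _
    rw [key, key]
    ring

theorem bassSerreTree_adj_iff (A : Fin n → Subgroup F) (s : Fin k → F)
    (hs : ∀ j, s j ≠ 1) (x y : TreeVertex A) :
    (bassSerreTree A s).Adj x y ↔ ∃ ε : TreeEdge F n k,
      (.inl ε.1 = x ∧ edgeTgt A s ε = y) ∨ (.inl ε.1 = y ∧ edgeTgt A s ε = x) := by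
  have key : ∀ x y : TreeVertex A,
      ((∃ (g : F) (i : Fin n), x = Sum.inl g ∧ y = Sum.inr ⟨i, (g : F ⧸ A i)⟩) ∨
        (∃ (g : F) (j : Fin k), x = Sum.inl g ∧ y = Sum.inl (g * s j))) ↔
      ∃ ε : TreeEdge F n k, .inl ε.1 = x ∧ edgeTgt A s ε = y := by
    intro x y
    constructor
    · rintro (⟨g, i, rfl, rfl⟩ | ⟨g, j, rfl, rfl⟩)
      · exact ⟨(g, .inl i), rfl, rfl⟩
      · exact ⟨(g, .inr j), rfl, rfl⟩
    · rintro ⟨⟨g, i | j⟩, rfl, rfl⟩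
      · exact Or.inl ⟨g, i, rfl, rfl⟩
      · exact Or.inr ⟨g, j, rfl, rfl⟩
  rw [bassSerreTree, SimpleGraph.fromRel_adj, key, key, exists_or, and_iff_right_iff_imp]
  rintro (⟨⟨g, i | j⟩, rfl, rfl⟩ | ⟨⟨g, i | j⟩, rfl, rfl⟩) h
  · cases h
  · exact hs j (by simpa [edgeTgt] using h)
  · cases h
  · exact hs j (by simpa [edgeTgt] using h)

theorem bassSerreTree_preconnected (hF : IsFreeProductDecomposition A s) (hs : ∀ j, s j ≠ 1) :
    (bassSerreTree A s).Preconnected := by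
  have hsmul : ∀ (c : F) (x y : TreeVertex A), (bassSerreTree A s).Reachable x y →
      (bassSerreTree A s).Reachable (c • x) (c • y) := fun c x y h =>
    h.map (⟨(c • ·), bassSerreTree_adj_smul A s c⟩ : bassSerreTree A s →g bassSerreTree A s)
  have hedge : ∀ ε : TreeEdge F n k, (bassSerreTree A s).Reachable (.inl ε.1) (edgeTgt A s ε) :=
    fun ε => ((bassSerreTree_adj_iff A s hs _ _).2 ⟨ε, Or.inl ⟨rfl, rfl⟩⟩).reachable
  let L : Subgroup F :=
    { carrier := {g | (bassSerreTree A s).Reachable (.inl 1) (.inl g)}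
      one_mem' := SimpleGraph.Reachable.refl _
      mul_mem' := fun {a b} ha hb => ha.trans (by simpa using hsmul a _ _ hb)
      inv_mem' := fun {a} ha => by simpa using (hsmul a⁻¹ _ _ ha).symm }
  have hL : L = ⊤ := hF.eq_top
    (fun i a ha => by
      have h1 := hedge (1, .inl i)
      have h2 := hedge (a, .inl i)
      have h3 : edgeTgt A s (a, .inl i) = edgeTgt A s (1, .inl i) := by
        simp only [edgeTgt]
        congr 2
        exact QuotientGroup.eq.2 (by simpa using ha)
      exact h1.trans (h3 ▸ h2.symm))
    (fun j => by
      change (bassSerreTree A s).Reachable (.inl 1) (.inl (s j))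
      simpa [edgeTgt] using hedge (1, .inr j))
  have hall : ∀ x, (bassSerreTree A s).Reachable (.inl 1) x := by
    have hinl : ∀ g : F, (bassSerreTree A s).Reachable (.inl 1) (.inl g) := fun g => by
      have : g ∈ L := by rw [hL]; trivial
      exact this
    rintro (g | ⟨i, q⟩)
    · exact hinl g
    · induction q using QuotientGroup.induction_on with
      | _ g => exact (hinl g).trans (hedge (g, .inl i))
  exact fun x y => (hall x).symm.trans (hall y)

/-- The translate of an edge. -/
def edgeSmul (c : F) (ε : TreeEdge F n k) : TreeEdge F n k := (c * ε.1, ε.2)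

theorem inl_smul (c : F) (g : F) : c • (Sum.inl g : TreeVertex A) = .inl (c * g) := rfl

theorem edgeTgt_smul (c : F) (ε : TreeEdge F n k) :
    edgeTgt A s (edgeSmul c ε) = c • edgeTgt A s ε := by
  rcases ε with ⟨g, i | j⟩
  · rfl
  · simp [edgeTgt, edgeSmul, mul_assoc]

theorem exists_sidedTree (hF : IsFreeProductDecomposition A s) :
    ∃ S : SidedTree (bassSerreTree A s) (TreeEdge F n k),
      (∀ ε, S.src ε = .inl ε.1) ∧ (∀ ε, S.tgt ε = edgeTgt A s ε) ∧
      ∀ (c : F) (ε : TreeEdge F n k) (x : TreeVertex A), S.sd (edgeSmul c ε) (c • x) = S.sd ε x := by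
  classical
  obtain ⟨θ, h1, h2⟩ := exists_edgeCocycle hF
  have h1' : ∀ ε ε' : TreeEdge F n k, θ (edgeTgt A s ε') ε - θ (.inl ε'.1) ε =
      if ε = ε' then 1 else 0 := by
    intro ε ε'
    have := congrFun (h1 ε') ε
    rw [this, Pi.add_apply, add_sub_cancel_left]
    exact Pi.single_apply _ _ _
  -- If `s j = 1`, the edge `(1, j)` would be a loop, and `θ` could not jump across it.
  have hs : ∀ j, s j ≠ 1 := by
    intro j hj
    have := h1' (1, .inr j) (1, .inr j)
    simp [edgeTgt, hj] at this
  -- The side is measured relative to the source of `ε`, because only differences of `θ` are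
  -- equivariant.
  refine ⟨⟨fun ε => .inl ε.1, edgeTgt A s, fun ε x => decide (θ x ε - θ (.inl ε.1) ε ≠ 0),
    bassSerreTree_adj_iff A s hs, fun ε => by simp, fun ε => ?_, fun ε ε' hne => ?_,
    bassSerreTree_preconnected hF hs⟩, fun _ => rfl, fun _ => rfl, fun c ε x => ?_⟩
  · rw [h1']
    simp
  · have := h1' ε ε'
    rw [if_neg hne, sub_eq_zero] at this
    simp only [this]
  · have := h2 c x (.inl ε.1) ε
    rw [inl_smul] at this
    simp only [edgeSmul, this]

end BassSerre
end FreeProductBoundary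

namespace FreeProductBoundary

universe u

section BassSerre

variable {F : Type u} [Group F] {n k : ℕ} {A : Fin n → Subgroup F} {s : Fin k → F}

/-- The sides of the edges of the Bass–Serre tree, with the action of `F`. -/
structure BassSerreSides (A : Fin n → Subgroup F) (s : Fin k → F) extends
    SidedTree (bassSerreTree A s) (TreeEdge F n k) where
  src_eq : ∀ ε, src ε = .inl ε.1
  tgt_eq : ∀ ε, tgt ε = edgeTgt A s ε
  sd_smul : ∀ (c : F) (ε : TreeEdge F n k) (x : TreeVertex A), sd (edgeSmul c ε) (c • x) = sd ε x

theorem IsFreeProductDecomposition.nonempty_sides (hF : IsFreeProductDecomposition A s) :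
    Nonempty (BassSerreSides A s) := by
  obtain ⟨S, h1, h2, h3⟩ := exists_sidedTree hF
  exact ⟨⟨S, h1, h2, h3⟩⟩

@[simp] theorem edgeSmul_one (ε : TreeEdge F n k) : edgeSmul 1 ε = ε := by simp [edgeSmul]

@[simp] theorem edgeSmul_inv_smul (c : F) (ε : TreeEdge F n k) :
    edgeSmul c⁻¹ (edgeSmul c ε) = ε := by simp [edgeSmul]

@[simp] theorem edgeSmul_smul_inv (c : F) (ε : TreeEdge F n k) :
    edgeSmul c (edgeSmul c⁻¹ ε) = ε := by simp [edgeSmul]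

theorem edgeSmul_left_injective (ε : TreeEdge F n k) :
    Function.Injective fun c : F => edgeSmul c ε := by
  intro c d h
  simpa [edgeSmul] using h

theorem near_translate (c : F) (z : Completion (bassSerreTree A s)) :
    (translate c z).near = map (c • ·) z.near := by
  rcases z with x | e
  · rfl
  · induction e using Quotient.inductionOn with
    | _ ρ => rfl

namespace BassSerreSides

open SidedTree

variable {B : BassSerreSides A s}

theorem mem_sep_smul {c : F} {ε : TreeEdge F n k} {x y : TreeVertex A} :
    edgeSmul c ε ∈ B.sep (c • x) (c • y) ↔ ε ∈ B.sep x y := by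
  rw [mem_sep, mem_sep, B.sd_smul, B.sd_smul]

theorem sd_smul_left (c : F) (ε : TreeEdge F n k) (x : TreeVertex A) :
    B.sd ε (c • x) = B.sd (edgeSmul c⁻¹ ε) x := by
  rw [← B.sd_smul c (edgeSmul c⁻¹ ε), edgeSmul_smul_inv]

theorem mem_sep_smul_left {c : F} {ε : TreeEdge F n k} {x y : TreeVertex A} :
    ε ∈ B.sep (c • x) (c • y) ↔ edgeSmul c⁻¹ ε ∈ B.sep x y := by
  rw [mem_sep, mem_sep, sd_smul_left, sd_smul_left]

theorem src_smul (c : F) (ε : TreeEdge F n k) : B.src (edgeSmul c ε) = c • B.src ε := by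
  rw [B.src_eq, B.src_eq]; rfl

theorem tgt_smul (c : F) (ε : TreeEdge F n k) : B.tgt (edgeSmul c ε) = c • B.tgt ε := by
  rw [B.tgt_eq, B.tgt_eq, edgeTgt_smul]

theorem joins_smul {c : F} {ε : TreeEdge F n k} {x y : TreeVertex A} (h : B.Joins ε x y) :
    B.Joins (edgeSmul c ε) (c • x) (c • y) := by
  rcases h with ⟨rfl, rfl⟩ | ⟨rfl, rfl⟩
  · exact Or.inl ⟨src_smul c ε, tgt_smul c ε⟩
  · exact Or.inr ⟨src_smul c ε, tgt_smul c ε⟩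

theorem sdBar_translate (c : F) (ε : TreeEdge F n k) (z : Completion (bassSerreTree A s)) :
    B.sdBar ε (translate c z) = B.sdBar (edgeSmul c⁻¹ ε) z := by
  rw [sdBar_eq_iff, near_translate, eventually_map]
  simp only [sd_smul_left]
  exact eventually_sd _ z

end BassSerreSides

/-! ### The twisted equivariant permutation of the vertices induced by an automorphism -/

/-- A permutation of the vertices of the Bass–Serre tree that is equivariant up to `Φ` and extends
`Φ`. -/
structure TwistedPerm (A : Fin n → Subgroup F) (Φ : F ≃* F) where
  /-- the permutation of the vertices -/
  toEquiv : TreeVertex A ≃ TreeVertex A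
  map_smul : ∀ (c : F) (x : TreeVertex A), toEquiv (c • x) = Φ c • toEquiv x
  map_one : toEquiv (.inl 1) = .inl 1

instance {Φ : F ≃* F} : CoeFun (TwistedPerm A Φ) fun _ => TreeVertex A → TreeVertex A :=
  ⟨fun f => f.toEquiv⟩

/-- With `γ i` conjugating `Φ (A i)` to `A (σ i)`, the coset `g A i` is sent to `Φ g * γ i` modulo
`A (σ i)`, and `g.⋆` to `Φ g.⋆`. -/
theorem PermutesFactors.nonempty_twistedPerm {Φ : F ≃* F} (hΦ : PermutesFactors A Φ) :
    Nonempty (TwistedPerm A Φ) := by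
  obtain ⟨σ, h⟩ := hΦ
  choose γ hγ using h
  have hγ' : ∀ i a, a ∈ A i ↔ (γ i)⁻¹ * Φ a * γ i ∈ A (σ i) := by
    intro i a
    rw [← hγ i (Φ a)]
    constructor
    · exact fun ha => ⟨a, ha, rfl⟩
    · rintro ⟨b, hb, h⟩
      rwa [← Φ.injective h]
  have hrel : ∀ i (g h : F), ((Φ g * γ i : F) : F ⧸ A (σ i)) = ((Φ h * γ i : F) : F ⧸ A (σ i)) ↔
      (g : F ⧸ A i) = (h : F ⧸ A i) := by
    intro i g h
    rw [QuotientGroup.eq, QuotientGroup.eq, hγ' i (g⁻¹ * h)]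
    simp [mul_assoc]
  let f : TreeVertex A → TreeVertex A := fun x => match x with
    | .inl g => .inl (Φ g)
    | .inr ⟨i, q⟩ => .inr ⟨σ i, Quotient.liftOn' q (fun g => ((Φ g * γ i : F) : F ⧸ A (σ i))) (by
        intro g h hgh
        exact (hrel i g h).2 (Quotient.sound' hgh))⟩
  have hf : ∀ i (g : F), f (.inr ⟨i, (g : F ⧸ A i)⟩) =
      .inr ⟨σ i, ((Φ g * γ i : F) : F ⧸ A (σ i))⟩ := fun _ _ => rfl
  have hinj : Function.Injective f := by
    rintro (g | ⟨i, q⟩) (h | ⟨j, r⟩) hgh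
    · exact congrArg _ (Φ.injective (Sum.inl_injective hgh))
    · cases hgh
    · cases hgh
    · induction q using QuotientGroup.induction_on with
      | _ g =>
        induction r using QuotientGroup.induction_on with
        | _ h =>
          rw [hf, hf] at hgh
          obtain ⟨h1, h2⟩ := Sigma.mk.inj_iff.1 (Sum.inr_injective hgh)
          obtain rfl := σ.injective h1
          rw [(hrel i g h).1 (eq_of_heq h2)]
  have hsurj : Function.Surjective f := by
    rintro (g | ⟨i, q⟩)
    · exact ⟨.inl (Φ.symm g), congrArg _ (Φ.apply_symm_apply g)⟩
    · obtain ⟨j, rfl⟩ := σ.surjective i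
      induction q using QuotientGroup.induction_on with
      | _ g =>
        refine ⟨.inr ⟨j, ((Φ.symm (g * (γ j)⁻¹) : F) : F ⧸ A j)⟩, ?_⟩
        rw [hf]
        simp
  refine ⟨⟨Equiv.ofBijective f ⟨hinj, hsurj⟩, ?_, ?_⟩⟩
  · rintro c (g | ⟨i, q⟩)
    · exact congrArg Sum.inl (map_mul Φ c g)
    · induction q using QuotientGroup.induction_on with
      | _ g =>
        change f (.inr ⟨i, ((c * g : F) : F ⧸ A i)⟩) = Φ c • f (.inr ⟨i, (g : F ⧸ A i)⟩)
        rw [hf, hf, map_mul, mul_assoc]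
        rfl
  · exact congrArg Sum.inl (map_one Φ)

namespace TwistedPerm

open SidedTree BassSerreSides

variable {Φ : F ≃* F} (f : TwistedPerm A Φ)

/-- The inverse permutation, which is equivariant up to the inverse automorphism. -/
def symm : TwistedPerm A Φ.symm where
  toEquiv := f.toEquiv.symm
  map_smul c x := by
    rw [Equiv.symm_apply_eq, f.map_smul]
    simp
  map_one := by rw [Equiv.symm_apply_eq, f.map_one]

theorem map_inl (g : F) : f (.inl g) = .inl (Φ g) := by
  have := f.map_smul g (.inl 1)
  rw [f.map_one, inl_smul, inl_smul, mul_one, mul_one] at this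
  exact this

@[simp] theorem symm_apply_apply (x : TreeVertex A) : f.symm (f x) = x :=
  f.toEquiv.symm_apply_apply x

/-! ### Finiteness of pullbacks and extension to the completed tree -/

variable (B : BassSerreSides A s)

/-- The edges whose image under `f` runs over `ε`. -/
def pullback (ε : TreeEdge F n k) : Set (TreeEdge F n k) :=
  {ε' | ε ∈ B.sep (f (B.src ε')) (f (B.tgt ε'))}

variable {B f}

theorem pullback_eq_coboundary (ε : TreeEdge F n k) (b : Bool) :
    f.pullback B ε = B.coboundary (f ⁻¹' {x | B.sd ε x = b}) := by
  ext ε'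
  simp only [pullback, coboundary, mem_sep, Set.mem_ofPred_eq, Set.mem_preimage]
  cases B.sd ε (f (B.src ε')) <;> cases B.sd ε (f (B.tgt ε')) <;> cases b <;> simp

variable (B f) in
-- By equivariance it suffices to look at the images of the finitely many edges `(1, ι)`, each of
-- which spans a finite geodesic. The bound is uniform in `ε`.
theorem pullback_finite_type : ∃ R : Set F, R.Finite ∧ ∀ ε ε', ε' ∈ f.pullback B ε →
    (Φ ε'.1)⁻¹ * ε.1 ∈ R := by
  refine ⟨⋃ ι : Fin n ⊕ Fin k, Prod.fst '' B.sep (f (B.src (1, ι))) (f (B.tgt (1, ι))),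
    Set.finite_iUnion fun ι => (sep_finite _ _).image _, ?_⟩
  rintro ε ⟨g, ι⟩ h
  refine Set.mem_iUnion.2 ⟨ι, ⟨edgeSmul (Φ g)⁻¹ ε, ?_, rfl⟩⟩
  have hg : ((g, ι) : TreeEdge F n k) = edgeSmul g (1, ι) := by simp [edgeSmul]
  rw [pullback, Set.mem_ofPred_eq, hg, src_smul, tgt_smul, f.map_smul, f.map_smul,
    mem_sep_smul_left] at h
  exact h

theorem pullback_finite (ε : TreeEdge F n k) : (f.pullback B ε).Finite := by
  obtain ⟨R, hR, h⟩ := f.pullback_finite_type B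
  refine Set.Finite.of_finite_image (f := fun ε' : TreeEdge F n k => ((Φ ε'.1)⁻¹ * ε.1, ε'.2))
    ((hR.prod (Set.finite_univ (α := Fin n ⊕ Fin k))).subset ?_) ?_
  · rintro _ ⟨ε', hε', rfl⟩
    exact ⟨h ε ε' hε', trivial⟩
  · intro ε₁ _ ε₂ _ he
    simp only [Prod.mk.injEq, mul_left_inj, inv_inj] at he
    exact Prod.ext (Φ.injective he.1) he.2

/-- An edge whose image joins `C` to its complement has an image geodesic running over some
coboundary edge of `C`, hence lies in one of finitely many finite pullbacks. -/
theorem coboundary_preimage_finite {C : Set (TreeVertex A)} (hC : (B.coboundary C).Finite) :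
    (B.coboundary (f ⁻¹' C)).Finite := by
  refine (hC.biUnion fun ε _ => pullback_finite (f := f) (B := B) ε).subset fun ε' hε' => ?_
  by_contra hc
  refine hε' ?_
  refine mem_iff_of_sep (S := B.toSidedTree) (C := C) fun ε hε hs => hc ?_
  exact Set.mem_biUnion hε hs

theorem coboundary_side_finite (B : BassSerreSides A s) (ε : TreeEdge F n k) (b : Bool) :
    (B.coboundary {x | B.sd ε x = b}).Finite := by
  rw [coboundary_side]; exact Set.finite_singleton ε

variable (B f) in
theorem exists_extend (z : Completion (bassSerreTree A s)) :
    ∃ z' : Completion (bassSerreTree A s), ∀ ε, ∀ᶠ x in z.near, B.sd ε (f x) = B.sdBar ε z' := by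
  have h : ∀ ε, ∃ b, ∀ᶠ x in z.near, B.sd ε (f x) = b := by
    intro ε
    rcases mem_near_or_compl_mem (S := B.toSidedTree)
      (coboundary_preimage_finite (f := f) (coboundary_side_finite B ε true)) z with h | h
    · exact ⟨true, h⟩
    · refine ⟨false, ?_⟩
      filter_upwards [h] with x hx
      simpa using hx
  choose o ho using h
  obtain ⟨z', hz'⟩ := exists_of_orientation (S := B.toSidedTree) (o := o) fun e e' => by
    obtain ⟨x, h1, h2⟩ := ((ho e).and (ho e')).exists
    exact ⟨f x, h1, h2⟩
  exact ⟨z', fun ε => by rw [hz']; exact ho ε⟩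

variable (B f) in
/-- The extension of the permutation of the vertices to the completed tree. -/
noncomputable def extend (z : Completion (bassSerreTree A s)) : Completion (bassSerreTree A s) :=
  (f.exists_extend B z).choose

theorem eventually_sd_extend (ε : TreeEdge F n k) (z : Completion (bassSerreTree A s)) :
    ∀ᶠ x in z.near, B.sd ε (f x) = B.sdBar ε (f.extend B z) :=
  (f.exists_extend B z).choose_spec ε

/-- Near `z` the vertices `f x` are on the same side of every coboundary edge of `C` as the extended
point, so membership in `C` is decided alike for both. -/
theorem mem_near_extend {C : Set (TreeVertex A)} (hC : (B.coboundary C).Finite)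
    {z : Completion (bassSerreTree A s)} : C ∈ (f.extend B z).near ↔ f ⁻¹' C ∈ z.near := by
  have h : ∀ᶠ x in z.near, (C ∈ (f.extend B z).near ↔ f x ∈ C) := by
    filter_upwards [(eventually_all_finite hC).2
      fun e _ => eventually_sd_extend (f := f) (B := B) e z] with x hx
    have := mem_near_iff_of_sdBar (S := B.toSidedTree) hC (z := f.extend B z)
      (z' := .vertex (f x)) fun ε hε => by rw [sdBar_vertex, hx ε hε]
    rwa [near_vertex, mem_pure] at this
  constructor
  · intro hz
    filter_upwards [h] with x hx
    exact hx.1 hz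
  · intro hz
    obtain ⟨x, h1, h2⟩ := (h.and hz).exists
    exact h1.2 h2

theorem sdBar_extend_iff {ε : TreeEdge F n k} {b : Bool} {z : Completion (bassSerreTree A s)} :
    B.sdBar ε (f.extend B z) = b ↔ f ⁻¹' {x | B.sd ε x = b} ∈ z.near := by
  rw [sdBar_eq_iff, ← mem_near_extend (coboundary_side_finite B ε b)]
  rfl

theorem extend_vertex (x : TreeVertex A) :
    f.extend B (.vertex x) = (.vertex (f x) : Completion (bassSerreTree A s)) := by
  refine ext_sdBar (S := B.toSidedTree) fun ε => ?_
  rw [sdBar_extend_iff, near_vertex, mem_pure, sdBar_vertex]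
  rfl

theorem continuous_extend : Continuous (f.extend B) := by
  refine continuous_iff_continuousAt.2 fun z => ?_
  refine (tendsto_nhds_iff (S := B.toSidedTree)).2 fun ε => ?_
  set b := B.sdBar ε (f.extend B z) with hb
  have hC := coboundary_preimage_finite (f := f) (coboundary_side_finite B ε b)
  filter_upwards [(eventually_all_finite hC).2
    fun e _ => eventually_nhds_sdBar (S := B.toSidedTree) e z] with z' hz'
  rw [sdBar_extend_iff, mem_near_iff_of_sdBar (S := B.toSidedTree) hC hz', ← sdBar_extend_iff]

theorem symm_extend_extend (z : Completion (bassSerreTree A s)) :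
    f.symm.extend B (f.extend B z) = z := by
  refine ext_sdBar (S := B.toSidedTree) fun ε => ?_
  rw [sdBar_extend_iff, mem_near_extend (coboundary_preimage_finite (coboundary_side_finite B ε _)),
    ← Set.preimage_comp]
  filter_upwards [eventually_sd (S := B.toSidedTree) ε z] with x hx
  simpa using hx

theorem extend_symm_extend (z : Completion (bassSerreTree A s)) :
    f.extend B (f.symm.extend B z) = z :=
  symm_extend_extend (f := f.symm) z

theorem extend_translate (c : F) (z : Completion (bassSerreTree A s)) :
    f.extend B (translate c z) = translate (Φ c) (f.extend B z) := by
  refine ext_sdBar (S := B.toSidedTree) fun ε => ?_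
  rw [sdBar_extend_iff, near_translate, mem_map]
  filter_upwards [eventually_sd_extend (f := f) (B := B) (edgeSmul (Φ c)⁻¹ ε) z] with x hx
  simp only [Set.mem_preimage, Set.mem_ofPred_eq]
  rw [f.map_smul, sd_smul_left, hx, sdBar_translate]

theorem isBoundaryPoint_extend {z : Completion (bassSerreTree A s)} (hz : IsBoundaryPoint z) :
    IsBoundaryPoint (f.extend B z) := by
  rcases z with x | e
  · rw [extend_vertex]
    have hx : Infinite (MulAction.stabilizer F x) := hz
    change Infinite (MulAction.stabilizer F (f x))
    refine Infinite.of_injective (fun c : MulAction.stabilizer F x =>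
      (⟨Φ c, ?_⟩ : MulAction.stabilizer F (f x))) ?_
    · rw [MulAction.mem_stabilizer_iff, ← f.map_smul, MulAction.mem_stabilizer_iff.1 c.2]
    · intro c d h
      exact Subtype.ext (Φ.injective (congrArg Subtype.val h))
  · rcases h : f.extend B (.atInfinity e) with y | e'
    · have h2 := symm_extend_extend (f := f) (B := B) (.atInfinity e)
      rw [h, extend_vertex] at h2
      cases h2
    · trivial

variable (B f) in
/-- The homeomorphism of the boundary induced by the automorphism. -/
noncomputable def boundaryHomeo : Boundary A s ≃ₜ Boundary A s where
  toFun ξ := ⟨f.extend B ξ.1, isBoundaryPoint_extend ξ.2⟩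
  invFun ξ := ⟨f.symm.extend B ξ.1, isBoundaryPoint_extend ξ.2⟩
  left_inv ξ := Subtype.ext (symm_extend_extend ξ.1)
  right_inv ξ := Subtype.ext (extend_symm_extend ξ.1)
  continuous_toFun := (continuous_extend.comp continuous_subtype_val).subtype_mk _
  continuous_invFun := (continuous_extend.comp continuous_subtype_val).subtype_mk _

theorem boundaryHomeo_symm : (f.boundaryHomeo B).symm = f.symm.boundaryHomeo B := rfl

theorem boundaryHomeo_apply (ξ : Boundary A s) : (f.boundaryHomeo B ξ).1 = f.extend B ξ.1 := rfl

theorem isBoundaryExtension_boundaryHomeo : IsBoundaryExtension A s Φ (f.boundaryHomeo B) := by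
  intro ξ
  have h : (fun g => orbitPoint A s (Φ g)) = f.extend B ∘ orbitPoint A s := by
    funext g
    simp only [Function.comp_apply, orbitPoint, extend_vertex, map_inl]
  rw [h]
  exact (continuous_extend.tendsto ξ.1).comp tendsto_comap

end TwistedPerm

/-! ### Uniqueness of the extension to the boundary -/

-- Orbit points accumulate at every boundary point. At a coset vertex with infinite stabilizer there
-- are infinitely many incident edges, so one of them avoids `Q`, and its other endpoint is an orbit
-- point. Along a ray the sources of its edges serve.
open SidedTree BassSerreSides in
theorem exists_inl_sd_eq (B : BassSerreSides A s) (ξ : Boundary A s) {Q : Set (TreeEdge F n k)}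
    (hQ : Q.Finite) : ∃ g : F, ∀ ε ∈ Q, B.sd ε (.inl g) = B.sdBar ε ξ.1 := by
  obtain ⟨(x | e), hξ⟩ := ξ
  · have hx : Infinite (MulAction.stabilizer F x) := hξ
    rcases x with g | ⟨i, q⟩
    · exact ⟨g, fun ε _ => (sdBar_vertex ε _).symm⟩
    · induction q using QuotientGroup.induction_on with
      | _ y =>
        have hinj : Function.Injective fun c : MulAction.stabilizer F
            (Sum.inr ⟨i, (y : F ⧸ A i)⟩ : TreeVertex A) =>
            ((c.1 * y, .inl i) : TreeEdge F n k) := by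
          intro c d h
          simpa using h
        have hfin := hQ.preimage hinj.injOn
        obtain ⟨c, hc⟩ := hfin.infinite_compl.nonempty
        refine ⟨c.1 * y, fun ε hε => ?_⟩
        rw [sdBar_vertex]
        have hj : B.Joins (c.1 * y, .inl i) (.inl (c.1 * y)) (.inr ⟨i, (y : F ⧸ A i)⟩) := by
          refine Or.inl ⟨B.src_eq _, ?_⟩
          rw [B.tgt_eq]
          exact MulAction.mem_stabilizer_iff.1 c.2
        refine hj.sd_eq fun h => hc ?_
        rw [h] at hε
        exact hε
  · induction e using Quotient.inductionOn with
    | _ ρ =>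
      have h := (eventually_all_finite hQ).2 fun ε _ =>
        eventually_sd (S := B.toSidedTree) ε (.atInfinity (Quotient.mk _ ρ))
      rw [near_mk, eventually_map] at h
      obtain ⟨N, hN⟩ := eventually_atTop.1 h
      rcases joins_rayEdge (S := B.toSidedTree) ρ N with ⟨h1, -⟩ | ⟨h1, -⟩
      · refine ⟨(B.rayEdge ρ N).1, fun ε hε => ?_⟩
        rw [← hN N le_rfl ε hε, ← h1, B.src_eq]
      · refine ⟨(B.rayEdge ρ N).1, fun ε hε => ?_⟩
        rw [← hN (N + 1) (by omega) ε hε, ← h1, B.src_eq]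

open SidedTree in
theorem comap_orbitPoint_neBot (B : BassSerreSides A s) (ξ : Boundary A s) :
    (comap (orbitPoint A s) (𝓝 ξ.1)).NeBot := by
  refine comap_neBot fun U hU => ?_
  obtain ⟨Q, hQ, hsub⟩ := (B.hasBasis_nhds ξ.1).mem_iff.1 hU
  obtain ⟨g, hg⟩ := exists_inl_sd_eq B ξ hQ
  exact ⟨g, hsub fun ε hε => by rw [orbitPoint, sdBar_vertex, hg ε hε]⟩

theorem IsBoundaryExtension.unique (B : BassSerreSides A s) {Φ : F ≃* F}
    {h h' : Boundary A s → Boundary A s} (hh : IsBoundaryExtension A s Φ h)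
    (hh' : IsBoundaryExtension A s Φ h') : h = h' := by
  have := B.t2Space_completion
  funext ξ
  have := comap_orbitPoint_neBot B ξ
  exact Subtype.ext (tendsto_nhds_unique (hh ξ) (hh' ξ))

end BassSerre
end FreeProductBoundary

namespace FreeProductBoundary

universe u

/-! ### Elements without fixed vertices -/

section Hyperbolic

open SidedTree BassSerreSides

variable {F : Type u} [Group F] {n k : ℕ} {A : Fin n → Subgroup F} {s : Fin k → F}

theorem smul_inr_eq_iff {c g : F} {i : Fin n} :
    c • (.inr ⟨i, (g : F ⧸ A i)⟩ : TreeVertex A) = .inr ⟨i, (g : F ⧸ A i)⟩ ↔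
      g⁻¹ * c * g ∈ A i := by
  have h : c • (.inr ⟨i, (g : F ⧸ A i)⟩ : TreeVertex A) = .inr ⟨i, ((c * g : F) : F ⧸ A i)⟩ := rfl
  rw [h]
  constructor
  · intro h
    have h2 := eq_of_heq (Sigma.mk.inj_iff.1 (Sum.inr_injective h)).2
    simpa [mul_assoc] using QuotientGroup.eq.1 h2.symm
  · intro h
    rw [show ((c * g : F) : F ⧸ A i) = (g : F ⧸ A i) from
      (QuotientGroup.eq.2 (by simpa [mul_assoc] using h)).symm]

theorem no_fixed_vertex_iff {c : F} :
    (∀ x : TreeVertex A, c • x ≠ x) ↔ c ≠ 1 ∧ ¬ IsPeripheral A c := by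
  constructor
  · intro h
    refine ⟨?_, ?_⟩
    · rintro rfl
      exact h (.inl 1) (one_smul _ _)
    · rintro ⟨i, g, hg⟩
      exact h _ (smul_inr_eq_iff.2 hg)
  · rintro ⟨h1, h2⟩ (g | ⟨i, q⟩) hx
    · rw [inl_smul] at hx
      exact h1 (by simpa using hx)
    · induction q using QuotientGroup.induction_on with
      | _ g => exact h2 ⟨i, g, smul_inr_eq_iff.1 hx⟩

variable {B : BassSerreSides A s}

/-- The translates of `ε` by the inverse powers of `c` are pairwise different, and only finitely
many edges separate `p` from `q`. -/
theorem sd_pow_smul_eventually_eq {c : F} (hc : Function.Injective fun m : ℕ => c ^ m)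
    (p q : TreeVertex A) (ε : TreeEdge F n k) :
    ∀ᶠ m : ℕ in atTop, B.sd ε (c ^ m • p) = B.sd ε (c ^ m • q) := by
  have hinj : Function.Injective fun m : ℕ => edgeSmul (c ^ m)⁻¹ ε := by
    intro a b h
    exact hc (inv_injective (edgeSmul_left_injective ε h))
  have hfin := (sep_finite (S := B.toSidedTree) p q).preimage hinj.injOn
  rw [← Nat.cofinite_eq_atTop]
  filter_upwards [hfin.compl_mem_cofinite] with m hm
  by_contra h
  exact hm (mem_sep_smul_left.1 h)

/-- Comparing the orbits of a vertex and of its image under `c` shows that each side is eventually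
constant. The limiting sides form a consistent orientation, which does not depend on the starting
vertex. -/
theorem exists_limit_pow {c : F} (hc : Function.Injective fun m : ℕ => c ^ m) :
    ∃ z : Completion (bassSerreTree A s), translate c z = z ∧
      ∀ p ε, ∀ᶠ m : ℕ in atTop, B.sd ε (c ^ m • p) = B.sdBar ε z := by
  have h : ∀ ε, ∃ b, ∀ᶠ m : ℕ in atTop, B.sd ε (c ^ m • (.inl 1 : TreeVertex A)) = b := by
    intro ε
    obtain ⟨N, hN⟩ := eventually_atTop.1
      (sd_pow_smul_eventually_eq (B := B) hc (.inl 1) (c • .inl 1) ε)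
    refine ⟨B.sd ε (c ^ N • (.inl 1 : TreeVertex A)), eventually_atTop.2 ⟨N, fun m hm => ?_⟩⟩
    induction m, hm using Nat.le_induction with
    | base => rfl
    | succ m hm ih => rw [← ih, hN m hm, smul_smul, pow_succ]
  choose o ho using h
  obtain ⟨z, hz⟩ := exists_of_orientation (S := B.toSidedTree) (o := o) fun e e' => by
    obtain ⟨m, h1, h2⟩ := ((ho e).and (ho e')).exists
    exact ⟨_, h1, h2⟩
  have hlim : ∀ p ε, ∀ᶠ m : ℕ in atTop, B.sd ε (c ^ m • p) = B.sdBar ε z := by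
    intro p ε
    filter_upwards [ho ε, sd_pow_smul_eventually_eq (B := B) hc p (.inl 1) ε] with m h1 h2
    rw [h2, h1, hz]
  refine ⟨z, ext_sdBar (S := B.toSidedTree) fun ε => ?_, hlim⟩
  rw [sdBar_translate]
  obtain ⟨m, h1, h2⟩ := ((hlim (.inl 1) (edgeSmul c⁻¹ ε)).and (hlim (c • .inl 1) ε)).exists
  rw [← h1, ← h2, ← sd_smul_left, smul_smul, smul_smul, pow_mul_comm']

/-- The element `c` maps the half-tree on the side `b` of the edge `ε` properly into itself. -/
def Nests (B : BassSerreSides A s) (c : F) (ε : TreeEdge F n k) (b : Bool) : Prop :=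
  c ≠ 1 ∧ ∀ x, B.sd ε x = b → B.sd ε (c • x) = b

namespace Nests

variable {c : F} {ε : TreeEdge F n k} {b : Bool}

theorem edgeSmul_ne (h : c ≠ 1) (ε : TreeEdge F n k) : edgeSmul c ε ≠ ε := fun he =>
  h (edgeSmul_left_injective ε (he.trans (edgeSmul_one ε).symm))

theorem pow (h : Nests B c ε b) (m : ℕ) {x : TreeVertex A} (hx : B.sd ε x = b) :
    B.sd ε (c ^ m • x) = b := by
  induction m with
  | zero => simpa using hx
  | succ m ih =>
    rw [pow_succ', mul_smul]
    exact h.2 _ ih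

theorem inv (h : Nests B c ε b) : Nests B c⁻¹ ε (!b) := by
  refine ⟨inv_ne_one.2 h.1, fun x hx => ?_⟩
  by_contra hne
  have h1 := h.2 (c⁻¹ • x) (by simpa using hne)
  rw [smul_inv_smul, hx] at h1
  simp at h1

/-- If some power were trivial, `c` would preserve the half-tree exactly; then `ε` and its translate
would have the same sides and coincide, while nontrivial elements fix no edge. -/
theorem pow_ne_one (h : Nests B c ε b) {m : ℕ} (hm : m ≠ 0) : c ^ m ≠ 1 := by
  intro h1
  obtain ⟨m, rfl⟩ := Nat.exists_eq_succ_of_ne_zero hm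
  have hiff : ∀ x, B.sd ε (c • x) = b ↔ B.sd ε x = b := by
    refine fun x => ⟨fun hx => ?_, h.2 x⟩
    have := h.pow m hx
    rwa [smul_smul, ← pow_succ, h1, one_smul] at this
  have heq : ∀ x, B.sd (edgeSmul c⁻¹ ε) x = B.sd ε x := by
    intro x
    rw [← sd_smul_left]
    have := hiff x
    revert this
    cases B.sd ε (c • x) <;> cases B.sd ε x <;> cases b <;> simp
  refine edgeSmul_ne (inv_ne_one.2 h.1) ε ?_
  refine (joins_src_tgt (S := B.toSidedTree) ε).mem_sep_iff.1 ?_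
  rw [mem_sep, heq, heq]
  exact (joins_src_tgt ε).ne

theorem injective_pow (h : Nests B c ε b) : Function.Injective fun m : ℕ => c ^ m := by
  refine injective_pow_iff_not_isOfFinOrder.2 fun hfin => ?_
  obtain ⟨m, hm, h1⟩ := isOfFinOrder_iff_pow_eq_one.1 hfin
  exact h.pow_ne_one hm.ne' h1

/-- Powers of `c` and of its inverse attract every vertex to opposite sides of `ε`, so a fixed
vertex would lie on both. -/
theorem no_fixed_vertex (h : Nests B c ε b) (x : TreeVertex A) : c • x ≠ x := by
  intro hx
  have hpow : ∀ m : ℕ, c ^ m • x = x := by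
    intro m
    induction m with
    | zero => simp
    | succ m ih => rw [pow_succ', mul_smul, ih, hx]
  have key : ∀ {c : F} {b : Bool}, Nests B c ε b → (∀ m : ℕ, c ^ m • x = x) → B.sd ε x = b := by
    intro c b h hpow
    obtain ⟨p, hp⟩ : ∃ p, B.sd ε p = b := by
      cases b
      · exact ⟨_, B.sd_src ε⟩
      · exact ⟨_, B.sd_tgt ε⟩
    obtain ⟨m, hm⟩ := (sd_pow_smul_eventually_eq (B := B) h.injective_pow p x ε).exists
    rw [h.pow m hp, hpow] at hm
    exact hm.symm
  have h1 := key h hpow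
  have h2 := key h.inv fun m => by rw [inv_pow, inv_smul_eq_iff, hpow]
  rw [h1] at h2
  simp at h2

theorem exists_axisEndpoint (h : Nests B c ε b) {H : Subgroup F} (hc : c ∈ H) :
    ∃ ξ ∈ axisEndpoints A s H, B.sdBar ε ξ.1 = b := by
  obtain ⟨z, hz, hlim⟩ := exists_limit_pow (B := B) h.injective_pow
  have hb : IsBoundaryPoint z := by
    rcases z with x | e
    · exact absurd (by simpa [translate] using hz) (h.no_fixed_vertex x)
    · trivial
  have hfix := no_fixed_vertex_iff.1 h.no_fixed_vertex
  refine ⟨⟨z, hb⟩, ⟨c, hc, hfix.1, hfix.2, hz⟩, ?_⟩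
  obtain ⟨p, hp⟩ : ∃ p, B.sd ε p = b := by
    cases b
    · exact ⟨_, B.sd_src ε⟩
    · exact ⟨_, B.sd_tgt ε⟩
  obtain ⟨m, hm⟩ := (hlim p ε).exists
  rw [← hm, h.pow m hp]

end Nests

/-- Take `p` of minimal displacement and `ε` the first edge from `p` to `c • p`. If the translate of
`ε` also lay on this geodesic, stepping across `ε` would shorten the displacement. Hence it lies
beyond `c • p`, and the half-tree beyond `ε` is mapped into itself. -/
theorem exists_nests {c : F} (hc : ∀ x : TreeVertex A, c • x ≠ x) : ∃ ε b, Nests B c ε b := by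
  have hc1 := (no_fixed_vertex_iff.1 hc).1
  obtain ⟨p, hp⟩ : ∃ p, ∀ q, (B.sep p (c • p)).ncard ≤ (B.sep q (c • q)).ncard := by
    obtain ⟨p, hp⟩ := Nat.sInf_mem (Set.range_nonempty fun p => (B.sep p (c • p)).ncard)
    exact ⟨p, fun q => hp.trans_le (Nat.sInf_le ⟨q, rfl⟩)⟩
  obtain ⟨ε, u, hj, hε⟩ := exists_first_edge (S := B.toSidedTree) (hc p).symm
  have hj' : B.Joins (edgeSmul c ε) (c • p) (c • u) := joins_smul hj
  have hcε : edgeSmul c ε ∉ B.sep p (c • p) := by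
    intro h
    have h1 := hj.sep_eq hε
    have h2 : edgeSmul c ε ∈ B.sep (c • p) u := by
      rw [sep_comm, h1]
      exact ⟨h, Nests.edgeSmul_ne hc1 ε⟩
    have h3 := hj'.sep_eq h2
    rw [sep_comm, sep_comm (c • p), h1] at h3
    have h4 : (B.sep u (c • u)).ncard < (B.sep p (c • p)).ncard := by
      refine Set.ncard_lt_ncard ?_ (sep_finite _ _)
      rw [h3]
      refine ⟨fun e he => he.1.1, fun hsub => ?_⟩
      exact (hsub hε).1.2 rfl
    exact absurd (hp u) (not_le.2 h4)
  refine ⟨ε, B.sd ε u, hc1, fun x hx => ?_⟩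
  by_contra hne
  have h1 : edgeSmul c ε ∈ B.sep (c • p) (c • x) := by
    rw [mem_sep_smul, mem_sep, hx]
    exact hj.ne
  have h2 : edgeSmul c ε ∈ B.sep p (c • x) := by
    rw [mem_sep, notMem_sep.1 hcε]
    exact h1
  have h3 : ε ∉ B.sep p (c • x) := by
    have := hj.ne
    rw [notMem_sep]
    revert this hne
    cases B.sd ε (c • x) <;> cases B.sd ε u <;> cases B.sd ε p <;> simp
  exact hε (sd_of_joins_of_mem_sep hj' h2 h3).symm

theorem SidedTree.ncard_sep_lt {V E : Type*} {G : SimpleGraph V} {S : SidedTree G E} {ε : E}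
    {x y p q : V} (hε : ε ∈ S.sep x y) (hj : S.Joins ε p q) (hp : S.sd ε p = S.sd ε x) :
    (S.sep x p).ncard < (S.sep x y).ncard := by
  refine Set.ncard_lt_ncard ⟨fun e he => ?_, fun hsub => ?_⟩ (sep_finite _ _)
  · by_contra hne
    exact he (sd_of_joins_of_mem_sep hj hε hne).symm
  · exact hsub hε hp.symm

/-- A nontrivial element fixing the vertex `v` moves any half-tree not containing `v` off
itself. -/
theorem sd_smul_of_fixed {a : F} (ha : a ≠ 1) {v : TreeVertex A} (hv : a • v = v)
    {ε : TreeEdge F n k} {x : TreeVertex A} (hx : B.sd ε x ≠ B.sd ε v) :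
    B.sd ε (a • x) = B.sd ε v := by
  by_contra hax
  have hv' : a⁻¹ • v = v := by rw [inv_smul_eq_iff, hv]
  set ε' := edgeSmul a⁻¹ ε with hε'
  have hne : ε' ≠ ε := Nests.edgeSmul_ne (inv_ne_one.2 ha) ε
  obtain ⟨p, q, hj, hp⟩ : ∃ p q, B.Joins ε p q ∧ B.sd ε p = B.sd ε v := by
    cases h : B.sd ε v
    · exact ⟨_, _, joins_src_tgt ε, B.sd_src ε⟩
    · exact ⟨_, _, (joins_src_tgt ε).symm, B.sd_tgt ε⟩
  have hj' : B.Joins ε' (a⁻¹ • p) (a⁻¹ • q) := joins_smul hj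
  -- Since `a` fixes `v`, the near endpoints of `ε` and `ε'` are equally far from `v`. Both edges
  -- lie on the geodesic from `v` to `x`, so being different they would be at different distances.
  have hcard : (B.sep v (a⁻¹ • p)).ncard = (B.sep v p).ncard := by
    have h : B.sep v (a⁻¹ • p) = edgeSmul a⁻¹ '' B.sep v p := by
      ext e
      constructor
      · intro he
        refine ⟨edgeSmul a e, ?_, edgeSmul_inv_smul a e⟩
        rw [← mem_sep_smul (c := a⁻¹), edgeSmul_inv_smul, hv']
        exact he
      · rintro ⟨e, he, rfl⟩
        rw [← mem_sep_smul (c := a⁻¹), hv'] at he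
        exact he
    rw [h]
    refine Set.ncard_image_of_injective _ fun e e' he => ?_
    simpa using congrArg (edgeSmul a) he
  have h1 : ε ∈ B.sep v x := Ne.symm hx
  have h2 : ε' ∈ B.sep v x := by
    rw [mem_sep, hε', ← sd_smul_left, ← sd_smul_left, hv]
    exact Ne.symm hax
  have hp' : B.sd ε' (a⁻¹ • p) = B.sd ε' v := by
    rw [hε', B.sd_smul, hp, ← sd_smul_left, hv]
  by_cases h3 : ε' ∈ B.sep v p
  · exact (ncard_sep_lt h3 hj' hp').ne hcard
  · have h4 : ε' ∈ B.sep q x := by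
      rw [mem_sep, ← hj.sd_eq hne, ← notMem_sep.1 h3]
      exact h2
    have h5 : ε ∉ B.sep q x := by
      refine notMem_sep_of_mem (y := v) ?_ h1
      rw [mem_sep, ← hp]
      exact hj.ne.symm
    have h6 : ε ∈ B.sep v (a⁻¹ • p) := by
      rw [mem_sep, sd_of_joins_of_mem_sep hj' h4 h5, ← hp]
      exact hj.ne
    exact (ncard_sep_lt h6 hj hp).ne hcard.symm

/-- Ping-pong across the first edge from `v` to `w`: `b` throws the side of `v` to the side of `w`,
and `a` throws it back. -/
theorem exists_nests_mul {a b : F} (ha : a ≠ 1) (hb : b ≠ 1) {v w : TreeVertex A} (hvw : v ≠ w)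
    (hv : a • v = v) (hw : b • w = w) : ∃ ε β, Nests B (a * b) ε β := by
  obtain ⟨ε, u, hj, hε⟩ := exists_first_edge (S := B.toSidedTree) hvw
  refine ⟨ε, B.sd ε v, ?_, fun x hx => ?_⟩
  · intro hab
    have hav : a • w ≠ w := by
      intro h
      have := sd_smul_of_fixed (B := B) ha hv (Ne.symm hε)
      rw [h] at this
      exact hε this.symm
    have : a • (b • w) = w := by rw [smul_smul, hab, one_smul]
    rw [hw] at this
    exact hav this
  · have h1 : B.sd ε (b • x) = B.sd ε w := sd_smul_of_fixed hb hw (by rw [hx]; exact hε)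
    rw [mul_smul]
    exact sd_smul_of_fixed ha hv (by rw [h1]; exact Ne.symm hε)

/-! ### Endpoints of axes -/

theorem tendsto_pow_of_shift {c : F} {ρ : TightRay (bassSerreTree A s)} {m d : ℕ} (hd : d ≠ 0)
    (h : ∀ j, c • ρ.vert (m + j) = ρ.vert (m + d + j)) :
    (Function.Injective fun q : ℕ => c ^ q) ∧ ∀ p ε, ∀ᶠ q : ℕ in atTop,
      B.sd ε (c ^ q • p) = B.sdBar ε (.atInfinity (Quotient.mk (tailSetoid _) ρ)) := by
  have hpow : ∀ q : ℕ, c ^ q • ρ.vert m = ρ.vert (m + q * d) := by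
    intro q
    induction q with
    | zero => simp
    | succ q ih =>
      rw [pow_succ', mul_smul, ih, h]
      congr 1
      ring
  have hinj : Function.Injective fun q : ℕ => c ^ q := by
    intro a b hab
    have h1 : c ^ a • ρ.vert m = c ^ b • ρ.vert m := congrArg (· • ρ.vert m) hab
    rw [hpow, hpow] at h1
    have h2 := vert_injective ρ B.toSidedTree h1
    exact Nat.eq_of_mul_eq_mul_right (Nat.pos_of_ne_zero hd) (by omega)
  refine ⟨hinj, fun p ε => ?_⟩
  have h1 : ∀ᶠ j in atTop, B.sd ε (ρ.vert j) =
      B.sdBar ε (.atInfinity (Quotient.mk (tailSetoid _) ρ)) := sdBar_mk_eq.1 rfl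
  have h2 : Tendsto (fun q => m + q * d) atTop atTop :=
    tendsto_atTop_mono (fun q => (Nat.le_mul_of_pos_right q (Nat.pos_of_ne_zero hd)).trans
      (Nat.le_add_left _ _)) tendsto_id
  filter_upwards [h2.eventually h1, sd_pow_smul_eventually_eq (B := B) hinj p (ρ.vert m) ε]
    with q h3 h4
  rw [h4, hpow, h3]

variable (B) in
/-- An endpoint of an axis is the limit of the powers of an element of the subgroup. -/
theorem exists_pow_tendsto {H : Subgroup F} {ξ : Boundary A s} (hξ : ξ ∈ axisEndpoints A s H) :
    ∃ c ∈ H, (∀ x : TreeVertex A, c • x ≠ x) ∧ (∃ e, ξ.1 = .atInfinity e) ∧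
      ∀ p ε, ∀ᶠ m : ℕ in atTop, B.sd ε (c ^ m • p) = B.sdBar ε ξ.1 := by
  obtain ⟨c, hcH, h1, h2, hc⟩ := hξ
  have hfix := no_fixed_vertex_iff.2 ⟨h1, h2⟩
  obtain ⟨(x | e), hb⟩ := ξ
  · exact absurd (by simpa [translate] using hc) (hfix x)
  induction e using Quotient.inductionOn with
  | _ ρ =>
    have h3 : Quotient.mk (tailSetoid _) (ρ.translate c) = Quotient.mk (tailSetoid _) ρ :=
      Completion.atInfinity.inj hc
    obtain ⟨m, m', h⟩ := Quotient.exact h3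
    have h' : ∀ j, c • ρ.vert (m + j) = ρ.vert (m' + j) := h
    -- On a tail of the ray, `c` acts as a shift. According to its direction `c` or its inverse
    -- moves towards the end; a zero shift would fix a vertex.
    rcases lt_trichotomy m m' with hlt | rfl | hlt
    · obtain ⟨d, rfl⟩ := Nat.exists_eq_add_of_lt hlt
      exact ⟨c, hcH, hfix, ⟨_, rfl⟩,
        (tendsto_pow_of_shift (d := d + 1) (Nat.succ_ne_zero d) h').2⟩
    · exact absurd (h' 0) (hfix _)
    · obtain ⟨d, rfl⟩ := Nat.exists_eq_add_of_lt hlt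
      refine ⟨c⁻¹, H.inv_mem hcH, fun x hx => hfix x ?_, ⟨_, rfl⟩,
        (tendsto_pow_of_shift (m := m') (d := d + 1) (Nat.succ_ne_zero d) fun j => ?_).2⟩
      · rw [inv_smul_eq_iff] at hx
        exact hx.symm
      · rw [inv_smul_eq_iff]
        exact (h' j).symm

theorem exists_mem_axisEndpoints_translate {H : Subgroup F} {ξ : Boundary A s}
    (hξ : ξ ∈ axisEndpoints A s H) {c : F} (hc : c ∈ H) :
    ∃ ξ' ∈ axisEndpoints A s H, ξ'.1 = translate c ξ.1 := by
  have hmul : ∀ (a b : F) (z : Completion (bassSerreTree A s)),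
      translate a (translate b z) = translate (a * b) z := by
    rintro a b (x | e)
    · simp [translate, mul_smul]
    · induction e using Quotient.inductionOn with
      | _ ρ =>
        change Completion.atInfinity (Quotient.mk _ ((ρ.translate b).translate a)) =
          Completion.atInfinity (Quotient.mk _ (ρ.translate (a * b)))
        congr 2
        simp only [TightRay.translate, TightRay.mk.injEq]
        funext m
        exact smul_smul a b _
  obtain ⟨d, hd, h1, h2, hdξ⟩ := hξ
  have hfix := no_fixed_vertex_iff.2 ⟨h1, h2⟩
  have hb : IsBoundaryPoint (translate c ξ.1) := by
    obtain ⟨(x | e), _⟩ := ξ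
    · exact absurd (by simpa [translate] using hdξ) (hfix x)
    · trivial
  have hfix' : ∀ x : TreeVertex A, (c * d * c⁻¹) • x ≠ x := by
    intro x hx
    refine hfix (c⁻¹ • x) ?_
    rw [mul_smul, mul_smul] at hx
    rw [eq_inv_smul_iff, hx]
  have h3 := no_fixed_vertex_iff.1 hfix'
  refine ⟨⟨_, hb⟩, ⟨c * d * c⁻¹, H.mul_mem (H.mul_mem hc hd) (H.inv_mem hc), h3.1, h3.2, ?_⟩, rfl⟩
  rw [hmul, inv_mul_cancel_right, ← hmul, hdξ]

theorem exists_axisEndpoints_sdBar_ne {H : Subgroup F} {c : F} (hc : c ∈ H)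
    (hfix : ∀ x : TreeVertex A, c • x ≠ x) :
    ∃ ε, ∃ a ∈ axisEndpoints A s H, ∃ b ∈ axisEndpoints A s H, B.sdBar ε a.1 ≠ B.sdBar ε b.1 := by
  obtain ⟨ε, β, h⟩ := exists_nests (B := B) hfix
  obtain ⟨a, ha, h1⟩ := h.exists_axisEndpoint hc
  obtain ⟨b, hb, h2⟩ := h.inv.exists_axisEndpoint (H.inv_mem hc)
  exact ⟨ε, a, ha, b, hb, by rw [h1, h2]; simp⟩

/-! ### The minimal subtree -/

/-- The vertices of the convex hull of a set of boundary points. -/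
def hull (B : BassSerreSides A s) (X : Set (Boundary A s)) : Set (TreeVertex A) :=
  {w | ∃ ε u, B.Joins ε w u ∧ ∃ a ∈ X, ∃ b ∈ X, B.sdBar ε a.1 ≠ B.sdBar ε b.1}

/-- Every edge at a vertex of the hull leaves points of `X` on the side of that vertex. -/
theorem exists_sdBar_eq_of_mem_hull {X : Set (Boundary A s)} {w : TreeVertex A}
    (hw : w ∈ hull B X) (e : TreeEdge F n k) : ∃ a ∈ X, B.sdBar e a.1 = B.sd e w := by
  obtain ⟨ε, u, hj, a, ha, b, hb, hab⟩ := hw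
  by_cases h : B.sdBar e a.1 = B.sdBar e b.1
  · exact ⟨a, ha, (sd_of_sdBar_ne hab h hj).symm⟩
  · by_cases h' : B.sdBar e a.1 = B.sd e w
    · exact ⟨a, ha, h'⟩
    · refine ⟨b, hb, ?_⟩
      revert h h'
      cases B.sdBar e a.1 <;> cases B.sdBar e b.1 <;> cases B.sd e w <;> simp

theorem hull_connected {X : Set (Boundary A s)} (hX : (hull B X).Nonempty) :
    ((bassSerreTree A s).induce (hull B X)).Connected := by
  have hpre : ((bassSerreTree A s).induce (hull B X)).Preconnected := by
    rintro ⟨x, hx⟩ ⟨y, hy⟩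
    revert hx
    refine geodesic_induction (S := B.toSidedTree) y (P := fun x => ∀ hx : x ∈ hull B X,
      ((bassSerreTree A s).induce (hull B X)).Reachable ⟨x, hx⟩ ⟨y, hy⟩)
      (fun _ => SimpleGraph.Reachable.refl _) ?_ x
    intro x u ε hj hε _ ih hx
    obtain ⟨a, ha, h1⟩ := exists_sdBar_eq_of_mem_hull hx ε
    obtain ⟨b, hb, h2⟩ := exists_sdBar_eq_of_mem_hull hy ε
    have hu : u ∈ hull B X := ⟨ε, x, hj.symm, a, ha, b, hb, by rw [h1, h2]; exact hε⟩
    refine SimpleGraph.Reachable.trans ?_ (ih hu)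
    exact SimpleGraph.Adj.reachable (SimpleGraph.comap_adj.2 hj.adj)
  obtain ⟨w, hw⟩ := hX
  exact { preconnected := hpre, nonempty := ⟨⟨w, hw⟩⟩ }

theorem hull_axisEndpoints_smul {H : Subgroup F} {c : F} (hc : c ∈ H) {x : TreeVertex A}
    (hx : x ∈ hull B (axisEndpoints A s H)) : c • x ∈ hull B (axisEndpoints A s H) := by
  obtain ⟨ε, u, hj, a, ha, b, hb, hab⟩ := hx
  obtain ⟨a', ha', ha''⟩ := exists_mem_axisEndpoints_translate ha hc
  obtain ⟨b', hb', hb''⟩ := exists_mem_axisEndpoints_translate hb hc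
  refine ⟨edgeSmul c ε, c • u, joins_smul hj, a', ha', b', hb', ?_⟩
  rw [ha'', hb'', sdBar_translate, sdBar_translate, edgeSmul_inv_smul]
  exact hab

theorem pow_smul_mem {H : Subgroup F} {Y : Set (TreeVertex A)}
    (hY : ∀ c ∈ H, ∀ x ∈ Y, c • x ∈ Y) {c : F} (hc : c ∈ H) {x : TreeVertex A} (hx : x ∈ Y)
    (m : ℕ) : c ^ m • x ∈ Y := hY _ (H.pow_mem hc m) x hx

/-- The hull is itself an invariant subtree. Conversely, powers of the two elements move any vertex
of an invariant subtree to both sides of an edge at `w`, and a walk between the two images that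
avoids `w` cannot cross that edge. -/
theorem minimalSubtree_eq_hull {H : Subgroup F} (hE : (axisEndpoints A s H).Nonempty) :
    minimalSubtree A s H = hull B (axisEndpoints A s H) := by
  apply Set.Subset.antisymm
  · have hne : (hull B (axisEndpoints A s H)).Nonempty := by
      obtain ⟨ξ, hξ⟩ := hE
      obtain ⟨c, hc, hfix, -⟩ := exists_pow_tendsto B hξ
      obtain ⟨ε, hε⟩ := exists_axisEndpoints_sdBar_ne (B := B) hc hfix
      exact ⟨B.src ε, ε, B.tgt ε, joins_src_tgt ε, hε⟩
    exact Set.sInter_subset_of_mem ⟨hull_connected hne, fun c hc x hx =>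
      hull_axisEndpoints_smul hc hx⟩
  · rintro w ⟨ε, u, hj, a, ha, b, hb, hab⟩ Y ⟨hY, hinv⟩
    by_contra hw
    obtain ⟨⟨p, hp⟩⟩ := hY.nonempty
    obtain ⟨c, hc, -, -, h1⟩ := exists_pow_tendsto B ha
    obtain ⟨d, hd, -, -, h2⟩ := exists_pow_tendsto B hb
    obtain ⟨m, hm⟩ := (h1 p ε).exists
    obtain ⟨m', hm'⟩ := (h2 p ε).exists
    obtain ⟨q⟩ := hY.preconnected ⟨_, pow_smul_mem hinv hc hp m⟩ ⟨_, pow_smul_mem hinv hd hp m'⟩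
    have hq : w ∉ (q.map (SimpleGraph.Embedding.induce Y).toHom).support := by
      rw [SimpleGraph.Walk.support_map]
      intro h
      obtain ⟨⟨y, hy⟩, -, rfl⟩ := List.mem_map.1 h
      exact hw hy
    have := sd_eq_of_walk (S := B.toSidedTree) hj _ hq
    exact hab (hm.symm.trans (this.trans hm'))

/-- Without axes every element fixes a vertex, and two nontrivial elements fixing different vertices
would have a product with an axis. -/
theorem exists_fixed_vertex (B : BassSerreSides A s) {H : Subgroup F}
    (hE : axisEndpoints A s H = ∅) : ∃ v : TreeVertex A, ∀ c ∈ H, c • v = v := by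
  have hfix : ∀ c ∈ H, ∃ x : TreeVertex A, c • x = x := by
    intro c hc
    by_contra! h
    obtain ⟨ε, a, ha, -⟩ := exists_axisEndpoints_sdBar_ne (B := B) hc h
    rw [hE] at ha
    exact ha
  by_cases hH : ∀ c ∈ H, c = 1
  · exact ⟨.inl 1, fun c hc => by rw [hH c hc, one_smul]⟩
  push Not at hH
  obtain ⟨a, ha, ha1⟩ := hH
  obtain ⟨v, hv⟩ := hfix a ha
  refine ⟨v, fun b hb => ?_⟩
  by_cases hb1 : b = 1
  · rw [hb1, one_smul]
  obtain ⟨w, hw⟩ := hfix b hb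
  by_cases hvw : v = w
  · rw [hvw, hw]
  obtain ⟨ε, β, h⟩ := exists_nests_mul (B := B) ha1 hb1 hvw hv hw
  obtain ⟨ξ, hξ, -⟩ := h.exists_axisEndpoint (H.mul_mem ha hb)
  rw [hE] at hξ
  exact hξ.elim

theorem minimalSubtree_subsingleton (B : BassSerreSides A s) {H : Subgroup F}
    (hE : axisEndpoints A s H = ∅) : (minimalSubtree A s H).Subsingleton := by
  obtain ⟨v, hv⟩ := exists_fixed_vertex B hE
  have hsub : minimalSubtree A s H ⊆ {v} := by
    refine Set.sInter_subset_of_mem ⟨?_, ?_⟩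
    · have : Nonempty ({v} : Set (TreeVertex A)) := ⟨⟨v, rfl⟩⟩
      exact { preconnected := SimpleGraph.Preconnected.of_subsingleton, nonempty := this }
    · rintro c hc x rfl
      exact hv c hc
  exact Set.subsingleton_singleton.anti hsub

end Hyperbolic
end FreeProductBoundary

namespace FreeProductBoundary

universe u

theorem exists_infinite_fiber_of_mapsTo {α β : Type*} {Z : Set α} (hZ : Z.Infinite) {g : α → β}
    {R : Set β} (hg : ∀ a ∈ Z, g a ∈ R) (hR : R.Finite) : ∃ r, {a | a ∈ Z ∧ g a = r}.Infinite := by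
  by_contra! h
  refine hZ ((hR.biUnion fun r _ => h r).subset fun a ha => ?_)
  exact Set.mem_biUnion (hg a ha) ⟨ha, rfl⟩

/-! ### Further facts on crossings and directions -/

namespace SidedTree

variable {V E : Type*} {G : SimpleGraph V} {S : SidedTree G E}

theorem exists_first_edge_towards {x : V} {z : Completion G} (hz : z ≠ .vertex x) :
    ∃ ε u, S.Joins ε x u ∧ S.sdBar ε z ≠ S.sd ε x := by
  obtain ⟨ε, hε⟩ : ∃ ε, S.sd ε x ≠ S.sdBar ε z := by
    by_contra! h
    exact hz (ext_sdBar (S := S) fun ε => by rw [sdBar_vertex, h])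
  obtain ⟨b, hb⟩ := exists_vertex_sd_eq (S := S) z (Set.finite_singleton ε)
  obtain ⟨ε', u, h1, h2, -⟩ := exists_edge_of_orientation (S := S) (o := fun ε => S.sdBar ε z)
    (fun e e' => by
      obtain ⟨p, hp⟩ := exists_vertex_sd_eq (S := S) z (Q := {e, e'}) (Set.toFinite _)
      exact ⟨p, hp e (by simp), hp e' (by simp)⟩) hε (hb ε rfl)
  exact ⟨ε', u, h1, h2.symm⟩

/-- A geodesic starting with the edge `e` and leaving `C` crosses the coboundary of `C` in `e` or
beyond `e`. -/
theorem exists_crossing_beyond {C : Set V} {e : E} {w u y : V} (hj : S.Joins e w u)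
    (hw : w ∈ C) (hy : y ∉ C) (he : S.sd e u = S.sd e y) :
    ∃ ε ∈ S.coboundary C, ∃ a b, S.Joins ε a b ∧ S.sd e a = S.sd e u := by
  by_cases hu : u ∈ C
  · obtain ⟨ε, -, h2, h3⟩ := exists_crossing (S := S) hu hy
    exact ⟨ε, h2, _, _, joins_src_tgt ε, (h3 e (notMem_sep.2 he)).1⟩
  · refine ⟨e, ?_, u, w, hj.symm, rfl⟩
    rcases hj with ⟨rfl, rfl⟩ | ⟨rfl, rfl⟩ <;> simp [coboundary, hw, hu]

/-- Two different edges at `w` lead to disjoint half-trees. -/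
theorem Joins.notMem_sep {e e' : E} {w u u' y : V} (hj : S.Joins e w u) (hj' : S.Joins e' w u')
    (hne : e ≠ e') (h : e ∈ S.sep w y) : e' ∉ S.sep w y := by
  intro h'
  have h1 : e' ∈ S.sep u y := by
    rw [mem_sep, ← hj.sd_eq hne.symm]
    exact h'
  have h2 : e ∉ S.sep u y := notMem_sep_of_mem hj.symm.ne h
  exact hj.ne (sd_of_joins_of_mem_sep hj' h1 h2)

theorem exists_shadow_notMem {ρ : TightRay G} {z : Completion G}
    (hz : z ≠ .atInfinity (Quotient.mk (tailSetoid G) ρ)) (S : SidedTree G E) :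
    ∃ T, ∀ t ≥ T, S.shadow ρ t ∉ z.near := by
  obtain ⟨ε, hε⟩ : ∃ ε, S.sdBar ε z ≠ S.sdBar ε (.atInfinity (Quotient.mk (tailSetoid G) ρ)) := by
    by_contra! h
    exact hz (ext_sdBar (S := S) h)
  obtain ⟨T, hT⟩ := exists_shadow_sdBar (S := S) ρ ε
  exact ⟨T, fun t ht h => hε (hT t ht z h)⟩

end SidedTree

/-! ### Boundary of a subgroup and closure of its axis endpoints -/

section SubgroupBoundary

open SidedTree BassSerreSides

variable {F : Type u} [Group F] {n k : ℕ} {A : Fin n → Subgroup F} {s : Fin k → F}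
  {B : BassSerreSides A s}

theorem mem_closure_iff_sdBar (B : BassSerreSides A s) {X : Set (Boundary A s)}
    {ξ : Boundary A s} :
    ξ ∈ closure X ↔ ∀ Q : Set (TreeEdge F n k), Q.Finite →
      ∃ ζ ∈ X, ∀ ε ∈ Q, B.sdBar ε ζ.1 = B.sdBar ε ξ.1 := by
  have h : (𝓝 ξ).HasBasis (fun Q : Set (TreeEdge F n k) => Q.Finite)
      (fun Q => Subtype.val ⁻¹' {z | ∀ ε ∈ Q, B.sdBar ε z = B.sdBar ε ξ.1}) := by
    rw [nhds_induced]
    exact (B.hasBasis_nhds ξ.1).comap _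
  rw [mem_closure_iff_nhds_basis h]
  rfl

theorem end_mem_closure {X : Set (Boundary A s)} {ρ : TightRay (bassSerreTree A s)}
    {ξ : Boundary A s} (hξ : ξ.1 = .atInfinity (Quotient.mk (tailSetoid _) ρ))
    (h : ∀ t, ∃ ζ ∈ X, B.shadow ρ t ∈ ζ.1.near) : ξ ∈ closure X := by
  choose ζ hζ hs using h
  refine mem_closure_of_tendsto (f := ζ) (b := atTop) ?_ (Eventually.of_forall hζ)
  rw [tendsto_subtype_rng, hξ]
  refine tendsto_end_iff (S := B.toSidedTree) fun t => ?_
  filter_upwards [eventually_ge_atTop t] with m hm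
  exact mem_of_superset (hs m) (shadow_antitone ρ hm)

theorem exists_shadow_of_mem_closure {X : Set (Boundary A s)} {ρ : TightRay (bassSerreTree A s)}
    {ξ : Boundary A s} (hξ : ξ.1 = .atInfinity (Quotient.mk (tailSetoid _) ρ))
    (h : ξ ∈ closure X) (t : ℕ) : ∃ ζ ∈ X, B.shadow ρ t ∈ ζ.1.near := by
  obtain ⟨ζ, hζ, h1⟩ := (mem_closure_iff_sdBar B).1 h {B.rayEdge ρ t} (Set.finite_singleton _)
  refine ⟨ζ, hζ, ?_⟩
  rw [shadow_mem_near_iff, h1 _ rfl, hξ]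

theorem exists_axisEndpoint_ne (B : BassSerreSides A s) {H : Subgroup F}
    (hE : (axisEndpoints A s H).Nonempty) (z : Completion (bassSerreTree A s)) :
    ∃ a ∈ axisEndpoints A s H, a.1 ≠ z := by
  obtain ⟨ξ, hξ⟩ := hE
  obtain ⟨c, hc, hfix, -⟩ := exists_pow_tendsto B hξ
  obtain ⟨ε, a, ha, b, hb, hab⟩ := exists_axisEndpoints_sdBar_ne (B := B) hc hfix
  by_cases h : a.1 = z
  · exact ⟨b, hb, fun h' => hab (by rw [h, h'])⟩
  · exact ⟨a, ha, h⟩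

/-- A subgroup whose minimal subtree contains a ray contains an element with an axis. -/
theorem axisEndpoints_nonempty_of_ray (B : BassSerreSides A s) {H : Subgroup F}
    {ρ : TightRay (bassSerreTree A s)} (hρ : ∀ m, ρ.vert m ∈ minimalSubtree A s H) :
    (axisEndpoints A s H).Nonempty := by
  rw [Set.nonempty_iff_ne_empty]
  intro hE
  have := minimalSubtree_subsingleton B hE (hρ 0) (hρ 1)
  exact absurd (vert_injective ρ B.toSidedTree this) (by decide)

/-- Every edge at a hull vertex has an axis endpoint on the side of that vertex, so a ray in the
hull has axis endpoints in all its half-trees. Conversely, an axis endpoint different from the end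
lies outside all sufficiently far half-trees; paired with endpoints inside them, it puts a tail of
the ray into the hull. -/
theorem subgroupBoundary_inter_boundaryInfty (B : BassSerreSides A s) (H : Subgroup F) :
    subgroupBoundary A s H ∩ boundaryInfty A s =
      closure (axisEndpoints A s H) ∩ boundaryInfty A s := by
  ext ξ
  refine and_congr_left ?_
  rintro ⟨e, he⟩
  obtain ⟨z, hb⟩ := ξ
  obtain rfl : z = .atInfinity e := he
  constructor
  · rintro ⟨ρ, rfl, hρ⟩
    have hE := axisEndpoints_nonempty_of_ray B hρ
    rw [minimalSubtree_eq_hull (B := B) hE] at hρ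
    refine end_mem_closure (B := B) rfl fun t => ?_
    obtain ⟨a, ha, h⟩ := exists_sdBar_eq_of_mem_hull (hρ (t + 1)) (B.rayEdge ρ t)
    refine ⟨a, ha, ?_⟩
    rw [shadow_mem_near_iff, h, sdBar_rayEdge]
  · intro hcl
    have hE : (axisEndpoints A s H).Nonempty := closure_nonempty_iff.1 ⟨_, hcl⟩
    induction e using Quotient.inductionOn with
    | _ ρ =>
      obtain ⟨a, ha, hane⟩ := exists_axisEndpoint_ne B hE (.atInfinity (Quotient.mk _ ρ))
      obtain ⟨T, hT⟩ := exists_shadow_notMem hane B.toSidedTree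
      refine ⟨⟨fun m => ρ.vert (T + m), fun m => ρ.adj (T + m), fun m => ρ.tight (T + m)⟩,
        Quotient.sound ⟨0, T, fun j => by simp⟩, fun m => ?_⟩
      rw [minimalSubtree_eq_hull (B := B) hE]
      obtain ⟨b, hb, h⟩ := exists_shadow_of_mem_closure (B := B) rfl hcl (T + m)
      refine ⟨B.rayEdge ρ (T + m), _, joins_rayEdge ρ (T + m), a, ha, b, hb, fun hab => ?_⟩
      refine hT (T + m) (by omega) ?_
      rw [shadow_mem_near_iff, hab, shadow_mem_near_iff.1 h]

/-- Let `η` be the first edge from `v` to an axis endpoint. Infinitely many elements of `H` rotate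
it to different edges at `v`; all but finitely many of these avoid the geodesics from `v` to the
edges of `Q`, and the correspondingly translated endpoint is then on the side of `v`. -/
theorem vertex_mem_closure_axisEndpoints {H : Subgroup F} {v : TreeVertex A}
    (hv : v ∈ hull B (axisEndpoints A s H))
    (hinf : (H ⊓ MulAction.stabilizer F v : Subgroup F).carrier.Infinite)
    {ξ : Boundary A s} (hξ : ξ.1 = .vertex v) : ξ ∈ closure (axisEndpoints A s H) := by
  rw [mem_closure_iff_sdBar B]
  intro Q hQ
  obtain ⟨-, -, -, a, ha, -⟩ := hv
  obtain ⟨-, -, -, ⟨e, he⟩, -⟩ := exists_pow_tendsto B ha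
  obtain ⟨η, u, hj, hη⟩ := exists_first_edge_towards (S := B.toSidedTree) (x := v) (z := a.1)
    (by rw [he]; exact fun h => by cases h)
  have hfin : ((fun c : F => edgeSmul c η) ⁻¹'
      ⋃ ε ∈ Q, (B.sep v (B.src ε) ∪ B.sep v (B.tgt ε))).Finite :=
    (hQ.biUnion fun ε _ => (sep_finite _ _).union (sep_finite _ _)).preimage
      (edgeSmul_left_injective η).injOn
  obtain ⟨c, hc, hcbad⟩ := (hinf.sdiff hfin).nonempty
  have hcH : c ∈ H := hc.1
  have hcv : c • v = v := MulAction.mem_stabilizer_iff.1 hc.2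
  obtain ⟨a', ha', haa'⟩ := exists_mem_axisEndpoints_translate ha hcH
  refine ⟨a', ha', fun ε hε => ?_⟩
  by_contra hne
  rw [hξ, sdBar_vertex] at hne
  refine hcbad (Set.mem_biUnion hε ?_)
  have hj' : B.Joins (edgeSmul c η) v (c • u) := by
    have := joins_smul (c := c) hj
    rwa [hcv] at this
  have hη' : B.sdBar (edgeSmul c η) a'.1 ≠ B.sd (edgeSmul c η) v := by
    rw [haa', sdBar_translate, edgeSmul_inv_smul, ← hcv, B.sd_smul]
    exact hη
  have key : ∀ q, B.sd ε q ≠ B.sd ε v → edgeSmul c η ∈ B.sep v q := by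
    intro q hq
    by_contra hs
    have h1 := sd_of_sdBar_ne (S := B.toSidedTree) (ε := edgeSmul c η) (e := ε) (z := .vertex q)
      (z' := a'.1) (by rw [sdBar_vertex, ← notMem_sep.1 hs]; exact hη'.symm)
      (by
        rw [sdBar_vertex]
        revert hq hne
        cases B.sd ε q <;> cases B.sd ε v <;> cases B.sdBar ε a'.1 <;> simp) hj'
    rw [sdBar_vertex] at h1
    exact hq h1.symm
  by_cases h : B.sd ε (B.src ε) = B.sd ε v
  · exact Or.inr (key _ fun h' => (joins_src_tgt ε).ne (h.trans h'.symm))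
  · exact Or.inl (key _ h)

theorem mem_hull_of_mem_closure {H : Subgroup F} {v : TreeVertex A}
    {ξ : Boundary A s} (hξ : ξ.1 = .vertex v) (hcl : ξ ∈ closure (axisEndpoints A s H)) :
    v ∈ hull B (axisEndpoints A s H) := by
  obtain ⟨a, ha⟩ := closure_nonempty_iff.1 ⟨ξ, hcl⟩
  obtain ⟨-, -, -, ⟨e, he⟩, -⟩ := exists_pow_tendsto B ha
  obtain ⟨η, u, hj, hη⟩ := exists_first_edge_towards (S := B.toSidedTree) (x := v) (z := a.1)
    (by rw [he]; exact fun h => by cases h)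
  obtain ⟨b, hb, h⟩ := (mem_closure_iff_sdBar B).1 hcl {η} (Set.finite_singleton η)
  refine ⟨η, u, hj, a, ha, b, hb, ?_⟩
  rw [h η rfl, hξ, sdBar_vertex]
  exact hη

end SubgroupBoundary

/-! ### Axis endpoints of the fixed subgroup -/

section FixedSubgroup

open SidedTree BassSerreSides TwistedPerm

variable {F : Type u} [Group F] {n k : ℕ} {A : Fin n → Subgroup F} {s : Fin k → F}
  {B : BassSerreSides A s} {Φ : F ≃* F} {f : TwistedPerm A Φ}

/-- The point is the limit of `c ^ m • p` for every `p`, and `f` sends `c ^ m • p` to `c ^ m • f p`,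
which has the same limit. -/
theorem extend_eq_of_mem_axisEndpoints {ξ : Boundary A s}
    (hξ : ξ ∈ axisEndpoints A s (fixedSubgroup Φ)) : f.extend B ξ.1 = ξ.1 := by
  have := B.t2Space_completion
  obtain ⟨c, hc, -, -, h⟩ := exists_pow_tendsto B hξ
  have hlim : ∀ p, Tendsto (fun m : ℕ => (.vertex (c ^ m • p) : Completion (bassSerreTree A s)))
      atTop (𝓝 ξ.1) := fun p => (tendsto_nhds_iff (S := B.toSidedTree)).2 fun ε => by
    simpa using h p ε
  have h1 := (continuous_extend (f := f) (B := B)).tendsto ξ.1 |>.comp (hlim (.inl 1))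
  refine tendsto_nhds_unique h1 ?_
  convert hlim (f (.inl 1)) using 2 with m
  simp only [Function.comp_apply, extend_vertex, f.map_smul]
  rw [show Φ (c ^ m) = c ^ m from (fixedSubgroup Φ).pow_mem hc m]

theorem closure_axisEndpoints_subset :
    closure (axisEndpoints A s (fixedSubgroup Φ)) ⊆ Function.fixedPoints (f.boundaryHomeo B) := by
  have := B.t2Space_completion
  refine closure_minimal (fun ξ hξ => Subtype.ext (extend_eq_of_mem_axisEndpoints hξ)) ?_
  exact isClosed_fixedPoints (f.boundaryHomeo B).continuous

theorem pullback_smul {c : F} {ε ε' : TreeEdge F n k} :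
    edgeSmul c ε' ∈ f.pullback B (edgeSmul (Φ c) ε) ↔ ε' ∈ f.pullback B ε := by
  rw [pullback, Set.mem_ofPred_eq, src_smul, tgt_smul, f.map_smul, f.map_smul, mem_sep_smul]
  rfl

theorem joins_inr {ε : TreeEdge F n k} {i : Fin n} {q : F ⧸ A i} {u : TreeVertex A}
    (hj : B.Joins ε (.inr ⟨i, q⟩) u) :
    ε = (ε.1, .inl i) ∧ q = (ε.1 : F ⧸ A i) ∧ u = .inl ε.1 := by
  rcases hj with ⟨h, -⟩ | ⟨h1, h2⟩
  · rw [B.src_eq] at h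
    cases h
  · rw [B.src_eq] at h1
    rw [B.tgt_eq] at h2
    obtain ⟨g, i' | j⟩ := ε
    · obtain ⟨h3, h4⟩ := Sigma.mk.inj_iff.1 (Sum.inr_injective h2)
      subst h3
      exact ⟨rfl, (eq_of_heq h4).symm, h1.symm⟩
    · cases h2

theorem joins_edge_inr (h : F) (i : Fin n) :
    B.Joins (h, .inl i) (.inr ⟨i, (h : F ⧸ A i)⟩) (.inl h) :=
  Or.inr ⟨B.src_eq _, B.tgt_eq _⟩

/-- The endpoints of edges over a given edge form a finite set. -/
theorem exists_finite_endpoints (B : BassSerreSides A s) (f : TwistedPerm A Φ)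
    (κ : Fin n ⊕ Fin k) :
    ∃ U : Set (TreeVertex A), U.Finite ∧ ∀ (h : F) (ε : TreeEdge F n k) (u u' : TreeVertex A),
      ε ∈ f.pullback B (h, κ) → B.Joins ε u u' → (Φ.symm h)⁻¹ • u ∈ U := by
  have hfin := pullback_finite (f := f) (B := B) (1, κ)
  refine ⟨B.src '' f.pullback B (1, κ) ∪ B.tgt '' f.pullback B (1, κ),
    (hfin.image _).union (hfin.image _), fun h ε u u' hε hj => ?_⟩
  have hmem : edgeSmul (Φ.symm h)⁻¹ ε ∈ f.pullback B (1, κ) := by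
    rw [← pullback_smul (c := Φ.symm h), edgeSmul_smul_inv]
    simpa [edgeSmul] using hε
  rcases joins_smul (c := (Φ.symm h)⁻¹) hj with ⟨h1, -⟩ | ⟨-, h1⟩
  · exact Or.inl ⟨_, hmem, h1⟩
  · exact Or.inr ⟨_, hmem, h1⟩

/-- If the ends fixed by `f` accumulate at a vertex, then the fixed subgroup has infinite
stabilizer there. -/
theorem infinite_stabilizer_of_mem_closure {ξ : Boundary A s} {v : TreeVertex A}
    (hξ : ξ.1 = .vertex v) (f : TwistedPerm A Φ) (B : BassSerreSides A s)
    (hcl : ξ ∈ closure (axisEndpoints A s (fixedSubgroup Φ))) :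
    (fixedSubgroup Φ ⊓ MulAction.stabilizer F v : Subgroup F).carrier.Infinite := by
  have hfv : f v = v := by
    have h := closure_axisEndpoints_subset (B := B) (f := f) hcl
    have h2 : f.extend B ξ.1 = ξ.1 := congrArg Subtype.val h
    rw [hξ, extend_vertex] at h2
    exact Completion.vertex.inj h2
  rcases v with g | ⟨i, q⟩
  · have hinf : Infinite (MulAction.stabilizer F (.inl g : TreeVertex A)) := by
      have := ξ.2
      rwa [hξ] at this
    have : Subsingleton (MulAction.stabilizer F (.inl g : TreeVertex A)) := by
      refine ⟨fun c d => Subtype.ext ?_⟩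
      have h1 := MulAction.mem_stabilizer_iff.1 c.2
      have h2 := MulAction.mem_stabilizer_iff.1 d.2
      rw [inl_smul] at h1 h2
      simp at h1 h2
      rw [h1, h2]
    exact absurd hinf (not_infinite_iff_finite.2 inferInstance)
  set v : TreeVertex A := .inr ⟨i, q⟩ with hv
  -- `Z` indexes the edges at `v` that point towards some axis endpoint. Accumulation at `v` forces
  -- infinitely many of them.
  let Z : Set F := {h | (h : F ⧸ A i) = q ∧ ∃ a ∈ axisEndpoints A s (fixedSubgroup Φ),
    B.sdBar (h, .inl i) a.1 ≠ B.sd (h, .inl i) v}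
  have hZ : Z.Infinite := by
    intro hfin
    obtain ⟨b, hb, h⟩ := (mem_closure_iff_sdBar B).1 hcl ((fun h => (h, .inl i)) '' Z)
      (hfin.image _)
    obtain ⟨-, -, -, ⟨e, he⟩, -⟩ := exists_pow_tendsto B hb
    obtain ⟨η, u, hj, hη⟩ := exists_first_edge_towards (S := B.toSidedTree) (x := v) (z := b.1)
      (by rw [he]; exact fun h => by cases h)
    obtain ⟨h1, h2, -⟩ := joins_inr hj
    rw [h1] at hη
    have := h (η.1, .inl i) ⟨η.1, ⟨h2.symm, b, hb, hη⟩, rfl⟩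
    rw [hξ, sdBar_vertex] at this
    exact hη this
  obtain ⟨U, hU, hU'⟩ := exists_finite_endpoints B f (.inl i)
  let v' : TreeVertex A := f.symm (.inr ⟨i, ((1 : F) : F ⧸ A i)⟩)
  -- Since `f` fixes both `v` and the endpoint `a`, some edge over `e` touches the half-tree beyond
  -- `e`. Translation by the inverse of `Φ.symm h` moves `v` to the fixed vertex `v'` and an
  -- endpoint of that edge into `U`, with `e` separating the two.
  have hmem : ∀ h ∈ Z, (Φ.symm h)⁻¹ * h ∈ ⋃ u ∈ U, Prod.fst '' B.sep v' u := by
    rintro h ⟨hq, a, ha, hne⟩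
    set e : TreeEdge F n k := (h, .inl i) with he
    have hje : B.Joins e v (.inl h) := by
      rw [hv, ← hq]
      exact joins_edge_inr h i
    obtain ⟨ε, u, u', hε, hj, heu⟩ : ∃ ε u u', ε ∈ f.pullback B e ∧ B.Joins ε u u' ∧
        e ∈ B.sep v u := by
      have h2 := eventually_sd_extend (f := f) (B := B) e a.1
      rw [extend_eq_of_mem_axisEndpoints ha] at h2
      obtain ⟨x, h3, h4⟩ := (h2.and (eventually_sd (S := B.toSidedTree) e a.1)).exists
      have h5 : e ∈ B.sep v x := by
        rw [mem_sep, h4]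
        exact hne.symm
      obtain ⟨ε, hε, u, u', hj, hu⟩ := exists_crossing_beyond (S := B.toSidedTree) hje
        (C := f ⁻¹' {y | B.sd e y = B.sd e v}) (y := x) (congrArg (B.sd e) hfv)
        (fun h8 => hne (by rw [← h3]; exact h8))
        (notMem_sep.1 (notMem_sep_of_mem hje.symm.ne h5))
      rw [← pullback_eq_coboundary] at hε
      refine ⟨ε, u, u', hε, hj, ?_⟩
      rw [mem_sep, hu]
      exact hje.ne
    have hvv' : (Φ.symm h)⁻¹ • v = v' := by
      change _ = f.symm _
      have h1 : (.inr ⟨i, ((1 : F) : F ⧸ A i)⟩ : TreeVertex A) = h⁻¹ • v := by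
        rw [eq_inv_smul_iff, hv, ← hq]
        change (.inr ⟨i, ((h * 1 : F) : F ⧸ A i)⟩ : TreeVertex A) = _
        rw [mul_one]
      rw [h1, f.symm.map_smul, map_inv]
      congr 1
      conv_lhs => rw [← f.symm_apply_apply v, hfv]
    refine Set.mem_biUnion (hU' h ε u u' hε hj) ⟨edgeSmul (Φ.symm h)⁻¹ e, ?_, rfl⟩
    rw [← hvv', mem_sep_smul]
    exact heu
  have hfin : (⋃ u ∈ U, Prod.fst '' B.sep v' u).Finite :=
    hU.biUnion fun u _ => (sep_finite _ _).image _
  -- Equality of `(Φ.symm h)⁻¹ * h` for `h` and `h₀` means that `h * h₀⁻¹` is fixed by `Φ`; it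
  -- stabilizes `v` because both edges are at `v`.
  obtain ⟨r, hr⟩ := exists_infinite_fiber_of_mapsTo hZ (g := fun h => (Φ.symm h)⁻¹ * h) hmem hfin
  obtain ⟨h₀, h₀Z, hh₀⟩ := hr.nonempty
  refine (hr.image (f := fun h => h * h₀⁻¹) (fun a _ b _ hab => by simpa using hab)).mono ?_
  rintro _ ⟨h, ⟨hZ', hh⟩, rfl⟩
  have hq : (h : F ⧸ A i) = (h₀ : F ⧸ A i) := hZ'.1.trans h₀Z.1.symm
  refine ⟨?_, ?_⟩
  · have h1 : (Φ.symm h)⁻¹ * h = (Φ.symm h₀)⁻¹ * h₀ := hh.trans hh₀.symm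
    have h2 : h * h₀⁻¹ = Φ.symm (h * h₀⁻¹) := by
      rw [map_mul, map_inv, mul_inv_eq_iff_eq_mul, mul_assoc]
      exact inv_mul_eq_iff_eq_mul.1 h1
    change Φ (h * h₀⁻¹) = h * h₀⁻¹
    exact Φ.symm.injective (by rw [Φ.symm_apply_apply]; exact h2)
  · refine MulAction.mem_stabilizer_iff.2 ?_
    rw [hv, ← h₀Z.1, smul_inr_eq_iff]
    simpa [mul_assoc] using QuotientGroup.eq.1 hq.symm

theorem subgroupBoundary_eq_closure (B : BassSerreSides A s) (f : TwistedPerm A Φ)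
    (hE : (axisEndpoints A s (fixedSubgroup Φ)).Nonempty) :
    subgroupBoundary A s (fixedSubgroup Φ) = closure (axisEndpoints A s (fixedSubgroup Φ)) := by
  ext ξ
  rcases h : ξ.1 with v | e
  · have hsub : ξ ∈ subgroupBoundary A s (fixedSubgroup Φ) ↔
        v ∈ minimalSubtree A s (fixedSubgroup Φ) ∧
        (fixedSubgroup Φ ⊓ MulAction.stabilizer F v : Subgroup F).carrier.Infinite := by
      obtain ⟨z, hb⟩ := ξ
      obtain rfl : z = .vertex v := h
      rfl
    rw [hsub, minimalSubtree_eq_hull (B := B) hE]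
    exact ⟨fun h' => vertex_mem_closure_axisEndpoints h'.1 h'.2 h, fun h' =>
      ⟨mem_hull_of_mem_closure h h', infinite_stabilizer_of_mem_closure h f B h'⟩⟩
  · have := Set.ext_iff.1 (subgroupBoundary_inter_boundaryInfty B (fixedSubgroup Φ)) ξ
    have he : ξ ∈ boundaryInfty A s := ⟨e, h⟩
    simpa [he] using this

/-- Endpoints of axes of fixed elements are not isolated among the fixed points. -/
theorem not_isIsolatedIn_of_mem_axisEndpoints
    (h3 : 3 ≤ (Function.fixedPoints (f.boundaryHomeo B) ∩ boundaryInfty A s).encard)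
    {ξ : Boundary A s} (hξ : ξ ∈ axisEndpoints A s (fixedSubgroup Φ)) :
    ¬ IsIsolatedIn (Function.fixedPoints (f.boundaryHomeo B)) ξ := by
  obtain ⟨ζ₁, ζ₂, hne, ⟨hf₁, e₁, he₁⟩, ⟨hf₂, e₂, he₂⟩, hξ₁, hξ₂⟩ : ∃ ζ₁ ζ₂ : Boundary A s, ζ₁ ≠ ζ₂ ∧
      ζ₁ ∈ Function.fixedPoints (f.boundaryHomeo B) ∩ boundaryInfty A s ∧
      ζ₂ ∈ Function.fixedPoints (f.boundaryHomeo B) ∩ boundaryInfty A s ∧ ζ₁ ≠ ξ ∧ ζ₂ ≠ ξ := by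
    have h2 : 1 < ((Function.fixedPoints (f.boundaryHomeo B) ∩ boundaryInfty A s) \ {ξ}).encard := by
      have := Set.encard_le_encard_sdiff_add_encard
        (Function.fixedPoints (f.boundaryHomeo B) ∩ boundaryInfty A s) {ξ}
      rw [Set.encard_singleton] at this
      have h4 := h3.trans this
      by_contra h5
      have h6 : (3 : ℕ∞) ≤ 1 + 1 := h4.trans (by gcongr; exact not_lt.1 h5)
      exact absurd h6 (by decide)
    obtain ⟨ζ₁, ζ₂, h1, h2, hne⟩ := Set.one_lt_encard_iff.1 h2
    exact ⟨ζ₁, ζ₂, hne, h1.1, h2.1, h1.2, h2.2⟩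
  rintro ⟨U, hU, hUξ⟩
  have hξU : ξ ∈ U := by
    have : ξ ∈ ({ξ} : Set (Boundary A s)) := rfl
    rw [← hUξ] at this
    exact this.1
  obtain ⟨c, hc, -, ⟨e, he⟩, hlim⟩ := exists_pow_tendsto B hξ
  obtain ⟨ε, hε⟩ : ∃ ε, B.sdBar ε ζ₁.1 ≠ B.sdBar ε ζ₂.1 := by
    by_contra! h
    exact hne (Subtype.ext (ext_sdBar (S := B.toSidedTree) h))
  induction e using Quotient.inductionOn with
  | _ ρ =>
    obtain ⟨W, hW, hWU⟩ := isOpen_induced_iff.1 hU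
    have hWξ : W ∈ 𝓝 ξ.1 := hW.mem_nhds (by rw [← hWU] at hξU; exact hξU)
    obtain ⟨Q, hQ, hsub⟩ := (B.hasBasis_nhds ξ.1).mem_iff.1 hWξ
    obtain ⟨T, hT⟩ : ∃ T, ∀ ε ∈ Q, ∀ z : Completion (bassSerreTree A s), B.shadow ρ T ∈ z.near →
        B.sdBar ε z = B.sdBar ε ξ.1 := by
      choose T hT using fun ε => exists_shadow_sdBar (S := B.toSidedTree) ρ ε
      obtain ⟨N, hN⟩ := (hQ.image T).bddAbove
      refine ⟨N, fun ε hε z hz => ?_⟩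
      rw [he]
      exact hT ε N (hN ⟨ε, hε, rfl⟩) z hz
    -- This power brings an endpoint of the edge separating `ζ₁` from `ζ₂` into the half-tree around
    -- `ξ`.
    obtain ⟨m, hm⟩ := (hlim (B.src ε) (B.rayEdge ρ T)).exists
    have hcm : Φ (c ^ m) = c ^ m := (fixedSubgroup Φ).pow_mem hc m
    -- The translates are again fixed by `f`, and differ from `ξ` because `c` fixes `ξ`; isolation
    -- therefore keeps both out of the half-tree.
    have key : ∀ ζ : Boundary A s, ζ ∈ Function.fixedPoints (f.boundaryHomeo B) →
        (∃ e, ζ.1 = .atInfinity e) → ζ ≠ ξ → ¬ B.shadow ρ T ∈ (translate (c ^ m) ζ.1).near := by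
      rintro ζ hζ ⟨e', he'⟩ hζξ hs
      have hb : IsBoundaryPoint (translate (c ^ m) ζ.1) := by rw [he']; trivial
      have h1 : (⟨_, hb⟩ : Boundary A s) ∈ U ∩ Function.fixedPoints (f.boundaryHomeo B) := by
        constructor
        · rw [← hWU]
          exact hsub fun ε hε => hT ε hε _ hs
        · refine Subtype.ext ?_
          change f.extend B (translate (c ^ m) ζ.1) = _
          rw [extend_translate, hcm]
          congr 1
          exact congrArg Subtype.val hζ
      rw [hUξ] at h1
      have h2 : translate (c ^ m) ζ.1 = ξ.1 := congrArg Subtype.val h1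
      refine hζξ (Subtype.ext (ext_sdBar (S := B.toSidedTree) fun e => ?_))
      have h3 : B.sdBar (edgeSmul (c ^ m) e) ξ.1 = B.sdBar e ζ.1 := by
        rw [← h2, sdBar_translate, edgeSmul_inv_smul]
      obtain ⟨q, h4, h5⟩ := ((hlim (.inl 1) e).and ((tendsto_add_atTop_nat m).eventually
        (hlim (.inl 1) (edgeSmul (c ^ m) e)))).exists
      rw [← h3, ← h5, ← h4, add_comm, pow_add, mul_smul, B.sd_smul]
    have h1 := key ζ₁ hf₁ ⟨_, he₁⟩ hξ₁
    have h2 := key ζ₂ hf₂ ⟨_, he₂⟩ hξ₂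
    rw [shadow_mem_near_iff, ← he] at h1 h2
    -- With both translates outside the half-tree, convexity keeps the edge separating them outside
    -- too, against the choice of `m`.
    have h4 := sd_of_sdBar_ne (S := B.toSidedTree) (ε := edgeSmul (c ^ m) ε) (e := B.rayEdge ρ T)
      (z := translate (c ^ m) ζ₁.1) (z' := translate (c ^ m) ζ₂.1)
      (by rw [sdBar_translate, sdBar_translate, edgeSmul_inv_smul]; exact hε)
      (by
        revert h1 h2
        cases B.sdBar (B.rayEdge ρ T) (translate (c ^ m) ζ₁.1) <;>
          cases B.sdBar (B.rayEdge ρ T) (translate (c ^ m) ζ₂.1) <;>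
          cases B.sdBar (B.rayEdge ρ T) ξ.1 <;> simp)
      (joins_smul (joins_src_tgt ε))
    rw [hm] at h4
    exact h1 h4.symm

theorem not_isIsolatedIn_of_mem_closure
    (h3 : 3 ≤ (Function.fixedPoints (f.boundaryHomeo B) ∩ boundaryInfty A s).encard)
    {ξ : Boundary A s} (hξ : ξ ∈ closure (axisEndpoints A s (fixedSubgroup Φ))) :
    ¬ IsIsolatedIn (Function.fixedPoints (f.boundaryHomeo B)) ξ := by
  rintro ⟨U, hU, hUξ⟩
  have hξU : ξ ∈ U := by
    have : ξ ∈ ({ξ} : Set (Boundary A s)) := rfl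
    rw [← hUξ] at this
    exact this.1
  obtain ⟨ζ, hζU, hζ⟩ := mem_closure_iff.1 hξ U hU hξU
  have h1 : ζ ∈ U ∩ Function.fixedPoints (f.boundaryHomeo B) :=
    ⟨hζU, closure_axisEndpoints_subset (subset_closure hζ)⟩
  rw [hUξ, Set.mem_singleton_iff] at h1
  exact not_isIsolatedIn_of_mem_axisEndpoints h3 (h1 ▸ hζ) ⟨U, hU, hUξ⟩

end FixedSubgroup
end FreeProductBoundary

namespace FreeProductBoundary

universe u

/-! ### Dynamics at a fixed end -/

section Dynamics

open SidedTree BassSerreSides TwistedPerm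

variable {F : Type u} [Group F] {n k : ℕ} {A : Fin n → Subgroup F} {s : Fin k → F}
  {B : BassSerreSides A s} {Φ : F ≃* F} {f : TwistedPerm A Φ}

/-- If `Φ` displaces infinitely many edges of a ray by one of finitely many elements, then the end
of the ray is a limit of endpoints of axes of fixed elements. -/
theorem exists_forall_displacement_notMem {ρ : TightRay (bassSerreTree A s)} {ξ : Boundary A s}
    (hξ : ξ.1 = .atInfinity (Quotient.mk (tailSetoid _) ρ))
    (hcl : ξ ∉ closure (axisEndpoints A s (fixedSubgroup Φ))) {R : Set F} (hR : R.Finite) :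
    ∃ T, ∀ t ≥ T, (B.rayEdge ρ t).1⁻¹ * Φ (B.rayEdge ρ t).1 ∉ R := by
  by_contra! hcon
  refine hcl (end_mem_closure (B := B) hξ fun t₀ => ?_)
  have hZ : {t | (B.rayEdge ρ t).1⁻¹ * Φ (B.rayEdge ρ t).1 ∈ R}.Infinite := by
    refine Set.infinite_of_not_bddAbove ?_
    rintro ⟨N, hN⟩
    obtain ⟨t, ht, h⟩ := hcon (N + 1)
    have := hN h
    omega
  -- The pigeonhole also fixes the type of the edge and the direction in which the ray crosses it,
  -- so that `c` below carries one edge to the other and the half-tree of the first into itself.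
  obtain ⟨r, hr⟩ := exists_infinite_fiber_of_mapsTo hZ
    (g := fun t => ((B.rayEdge ρ t).1⁻¹ * Φ (B.rayEdge ρ t).1, (B.rayEdge ρ t).2,
      B.sd (B.rayEdge ρ t) (ρ.vert (t + 1))))
    (R := R ×ˢ Set.univ) (fun t ht => ⟨ht, trivial⟩) (hR.prod Set.finite_univ)
  obtain ⟨t', ⟨-, ht'⟩, htt₀⟩ := hr.exists_gt t₀
  obtain ⟨t, ⟨-, ht⟩, htt'⟩ := hr.exists_gt t'
  obtain ⟨h1, h2, h3⟩ : (B.rayEdge ρ t).1⁻¹ * Φ (B.rayEdge ρ t).1 =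
      (B.rayEdge ρ t').1⁻¹ * Φ (B.rayEdge ρ t').1 ∧ (B.rayEdge ρ t).2 = (B.rayEdge ρ t').2 ∧
      B.sd (B.rayEdge ρ t) (ρ.vert (t + 1)) = B.sd (B.rayEdge ρ t') (ρ.vert (t' + 1)) := by
    simpa using ht.trans ht'.symm
  set c := (B.rayEdge ρ t).1 * (B.rayEdge ρ t').1⁻¹ with hc
  have hcΦ : c ∈ fixedSubgroup Φ := by
    change Φ c = c
    rw [inv_mul_eq_iff_eq_mul] at h1
    rw [hc, map_mul, map_inv, h1]
    group
  have hce : edgeSmul c (B.rayEdge ρ t') = B.rayEdge ρ t :=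
    Prod.ext (by simp [edgeSmul, hc]) h2.symm
  have hnest : Nests B c (B.rayEdge ρ t') (B.sd (B.rayEdge ρ t') (ρ.vert (t' + 1))) := by
    refine ⟨fun h => ?_, fun x hx => ?_⟩
    · rw [h, edgeSmul_one] at hce
      exact htt'.ne (rayEdge_injective ρ hce)
    · have h4 : c • x ∈ B.shadow ρ t := by
        change B.sd _ _ = B.sd _ _
        rw [h3, ← hce, B.sd_smul, hx]
      exact shadow_antitone ρ htt'.le h4
  obtain ⟨ζ, hζ, h4⟩ := hnest.exists_axisEndpoint hcΦ
  refine ⟨ζ, hζ, mem_of_superset ?_ (shadow_antitone ρ htt₀.le)⟩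
  rw [shadow_mem_near_iff, h4, sdBar_rayEdge]

/-! ### Hulls of pulled-back edges and invariant half-trees -/

/-- The edge `e` lies in the convex hull of the edges whose image runs over `ε`. -/
def InPullbackHull (f : TwistedPerm A Φ) (B : BassSerreSides A s) (ε e : TreeEdge F n k) : Prop :=
  ∃ ε₁ ∈ f.pullback B ε, ∃ ε₂ ∈ f.pullback B ε, ∃ u₁ v₁ u₂ v₂,
    B.Joins ε₁ u₁ v₁ ∧ B.Joins ε₂ u₂ v₂ ∧ e ∈ B.sep u₁ u₂

theorem InPullbackHull.of_mem {ε e : TreeEdge F n k} (h : e ∈ f.pullback B ε) :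
    InPullbackHull f B ε e :=
  ⟨e, h, e, h, _, _, _, _, joins_src_tgt e, (joins_src_tgt e).symm, (joins_src_tgt e).ne⟩

/-- Translating by the inverse of `Φ.symm h` moves all endpoints over `(h, κ)` into one finite set,
whose hull has finitely many edges. -/
theorem exists_finite_pullbackHull (f : TwistedPerm A Φ) (B : BassSerreSides A s) :
    ∃ R : Set F, R.Finite ∧ ∀ ε e, InPullbackHull f B ε e → (Φ e.1)⁻¹ * ε.1 ∈ R := by
  choose U hU hU' using fun κ => exists_finite_endpoints B f κ
  refine ⟨(fun r => (Φ r)⁻¹) '' ⋃ κ, ⋃ u ∈ U κ, ⋃ u' ∈ U κ, Prod.fst '' B.sep u u',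
    (Set.finite_iUnion fun κ => (hU κ).biUnion fun u _ => (hU κ).biUnion fun u' _ =>
      (sep_finite _ _).image _).image _, ?_⟩
  rintro ⟨h, κ⟩ e ⟨ε₁, h₁, ε₂, h₂, u₁, v₁, u₂, v₂, hj₁, hj₂, he⟩
  refine ⟨(Φ.symm h)⁻¹ * e.1, Set.mem_iUnion.2 ⟨κ, Set.mem_biUnion (hU' κ h _ _ _ h₁ hj₁)
    (Set.mem_biUnion (hU' κ h _ _ _ h₂ hj₂) ⟨edgeSmul (Φ.symm h)⁻¹ e, mem_sep_smul.2 he, rfl⟩)⟩, ?_⟩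
  simp

/-- Far out on a ray to a fixed end that is not a limit of axis endpoints, no edge lies in the hull
of the edges mapped over it. -/
theorem exists_forall_not_inPullbackHull {ρ : TightRay (bassSerreTree A s)} {ξ : Boundary A s}
    (hξ : ξ.1 = .atInfinity (Quotient.mk (tailSetoid _) ρ))
    (hcl : ξ ∉ closure (axisEndpoints A s (fixedSubgroup Φ))) :
    ∃ T, ∀ t ≥ T, ¬ InPullbackHull f B (B.rayEdge ρ t) (B.rayEdge ρ t) := by
  obtain ⟨R, hR, h⟩ := exists_finite_pullbackHull f B
  obtain ⟨T, hT⟩ := exists_forall_displacement_notMem (B := B) hξ hcl (hR.image (·⁻¹))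
  refine ⟨T, fun t ht hh => hT t ht ⟨_, h _ _ hh, ?_⟩⟩
  simp

theorem pullback_eq_coboundary_shadow (ρ : TightRay (bassSerreTree A s)) (t : ℕ) :
    f.pullback B (B.rayEdge ρ t) = B.coboundary (f ⁻¹' B.shadow ρ t) :=
  pullback_eq_coboundary _ _

/-- If neither inclusion holds, the coboundary of the preimage is met inside the half-tree (between
a point near the end and `x`) and outside it (between `x'` and the vertex `.inl 1`, which `f`
fixes). The edge of the ray then separates two edges mapped over it. -/
theorem shadow_invariant_or {ρ : TightRay (bassSerreTree A s)} {t : ℕ}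
    (hfix : f.extend B (.atInfinity (Quotient.mk (tailSetoid _) ρ)) =
      .atInfinity (Quotient.mk (tailSetoid _) ρ))
    (h1 : .inl 1 ∉ B.shadow ρ t)
    (ht : ¬ InPullbackHull f B (B.rayEdge ρ t) (B.rayEdge ρ t)) :
    B.shadow ρ t ⊆ f ⁻¹' B.shadow ρ t ∨ f ⁻¹' B.shadow ρ t ⊆ B.shadow ρ t := by
  by_contra! hcon
  obtain ⟨hc1, hc2⟩ := hcon
  obtain ⟨x, hx, hfx⟩ := Set.not_subset.1 hc1
  obtain ⟨x', hfx', hx'⟩ := Set.not_subset.1 hc2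
  have hmem : B.shadow ρ t ∈ (Completion.atInfinity (Quotient.mk (tailSetoid _) ρ)).near :=
    shadow_mem_near_iff.2 rfl
  have hmem' : f ⁻¹' B.shadow ρ t ∈ (Completion.atInfinity (Quotient.mk (tailSetoid _) ρ)).near := by
    rw [← mem_near_extend (by rw [coboundary_shadow]; exact Set.finite_singleton _), hfix]
    exact hmem
  obtain ⟨y, hy, hfy⟩ := nonempty_of_mem (inter_mem hmem hmem')
  obtain ⟨ε₁, -, h2, h3⟩ := exists_crossing (S := B.toSidedTree) hfy hfx
  obtain ⟨ε₂, -, h4, h5⟩ := exists_crossing (S := B.toSidedTree) (C := f ⁻¹' B.shadow ρ t) hfx'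
    (y := .inl 1) (by rw [Set.mem_preimage, f.map_one]; exact h1)
  rw [← pullback_eq_coboundary_shadow] at h2 h4
  refine ht ⟨ε₁, h2, ε₂, h4, _, _, _, _, joins_src_tgt ε₁, joins_src_tgt ε₂, ?_⟩
  have hside : ∀ {a b}, a ∉ B.shadow ρ t → b ∉ B.shadow ρ t →
      B.sd (B.rayEdge ρ t) a = B.sd (B.rayEdge ρ t) b := by
    intro a b ha hb
    change ¬ _ = _ at ha hb
    revert ha hb
    cases B.sd (B.rayEdge ρ t) a <;> cases B.sd (B.rayEdge ρ t) b <;>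
      cases B.sd (B.rayEdge ρ t) (ρ.vert (t + 1)) <;> simp
  have h6 : B.sd (B.rayEdge ρ t) y = B.sd (B.rayEdge ρ t) x := Eq.trans hy (Eq.symm hx)
  rw [mem_sep, (h3 _ (notMem_sep.2 h6)).1, (h5 _ (notMem_sep.2 (hside hx' h1))).1]
  exact fun h => hx' (h.symm.trans hy)

theorem apply_vert_mem_shadow {ρ : TightRay (bassSerreTree A s)} {t : ℕ}
    (ht : ¬ InPullbackHull f B (B.rayEdge ρ t) (B.rayEdge ρ t))
    (hf : f (ρ.vert (t + 1)) ∈ B.shadow ρ t) : f (ρ.vert t) ∈ B.shadow ρ t := by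
  by_contra hcon
  refine ht (InPullbackHull.of_mem ?_)
  rw [pullback_eq_coboundary_shadow]
  rcases joins_rayEdge (S := B.toSidedTree) ρ t with ⟨h1, h2⟩ | ⟨h1, h2⟩ <;>
    simp [coboundary, h1, h2, hf, hcon]

/-- Either `f` or its inverse eventually maps the half-trees at a fixed end into themselves. -/
theorem exists_shadow_invariant {ρ : TightRay (bassSerreTree A s)} {ξ : Boundary A s}
    (hξ : ξ.1 = .atInfinity (Quotient.mk (tailSetoid _) ρ)) (hfix : f.extend B ξ.1 = ξ.1)
    (hcl : ξ ∉ closure (axisEndpoints A s (fixedSubgroup Φ))) :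
    ∃ T, (∀ t ≥ T, B.shadow ρ t ⊆ f ⁻¹' B.shadow ρ t) ∨
      ∀ t ≥ T, B.shadow ρ t ⊆ f.symm ⁻¹' B.shadow ρ t := by
  obtain ⟨T₁, hT₁⟩ := exists_forall_not_inPullbackHull (f := f) (B := B) hξ hcl
  obtain ⟨T₂, hT₂⟩ := eventually_notMem_shadow (S := B.toSidedTree) ρ (.inl 1)
  rw [hξ] at hfix
  have hor : ∀ t ≥ max T₁ T₂, _ := fun t ht => shadow_invariant_or (f := f) hfix
    (hT₂ t (le_of_max_le_right ht)) (hT₁ t (le_of_max_le_left ht))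
  by_cases hall : ∀ t ≥ max T₁ T₂, B.shadow ρ t ⊆ f ⁻¹' B.shadow ρ t
  · exact ⟨_, Or.inl hall⟩
  push Not at hall
  obtain ⟨T, hT, hTn⟩ := hall
  -- Failure persists: inclusion at `t + 1` would push `f (ρ.vert t)` into the half-tree at `t`, and
  -- the reverse inclusion at `t` would put `ρ.vert t` there.
  have hnot : ∀ t ≥ T, ¬ B.shadow ρ t ⊆ f ⁻¹' B.shadow ρ t := by
    intro t ht
    induction t, ht using Nat.le_induction with
    | base => exact hTn
    | succ t ht ih =>
      intro hsub
      have h1 : f (ρ.vert (t + 1)) ∈ B.shadow ρ (t + 1) :=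
        apply_vert_mem_shadow (hT₁ _ (by have := le_of_max_le_left hT; omega))
          (hsub ((vert_mem_shadow ρ).2 (Nat.lt_succ_self _)))
      have h2 := apply_vert_mem_shadow (hT₁ t (by have := le_of_max_le_left hT; omega))
        (shadow_succ_subset ρ t h1)
      have h3 := (hor t (hT.trans ht)).resolve_left ih h2
      exact absurd ((vert_mem_shadow ρ).1 h3) (lt_irrefl t)
  refine ⟨T, Or.inr fun t ht x hx => ?_⟩
  refine (hor t (hT.trans ht)).resolve_left (hnot t ht) ?_
  change f.toEquiv (f.toEquiv.symm x) ∈ B.shadow ρ t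
  rwa [Equiv.apply_symm_apply]

/-! ### Points cannot stall along the ray -/

/-- Edges over two different edges at a coset vertex are separated by the preimage of that
vertex, unless the two edges differ by one of finitely many elements. -/
theorem exists_finite_separation (f : TwistedPerm A Φ) (B : BassSerreSides A s) :
    ∃ R : Set F, R.Finite ∧ ∀ (i : Fin n) (q : F ⧸ A i), ∃ v : TreeVertex A, ∀ h h' : F,
      (h : F ⧸ A i) = q → (h' : F ⧸ A i) = q →
      ∀ ε ∈ f.pullback B (h, .inl i), ∀ ε' ∈ f.pullback B (h', .inl i), ∀ u w u' w',
        B.Joins ε u w → B.Joins ε' u' w' → ∀ η, η ∈ B.sep v u → η ∈ B.sep v u' →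
          h⁻¹ * h' ∈ R := by
  choose U hU hU' using fun κ => exists_finite_endpoints B f κ
  let v₀ : Fin n → TreeVertex A := fun i => f.symm (.inr ⟨i, ((1 : F) : F ⧸ A i)⟩)
  let P : Set F := ⋃ i, ⋃ u ∈ U (.inl i), Prod.fst '' B.sep (v₀ i) u
  have hP : P.Finite := Set.finite_iUnion fun i => (hU _).biUnion fun u _ => (sep_finite _ _).image _
  refine ⟨Set.image2 (fun a b => Φ (a * b⁻¹)) P P, hP.image2 _ hP, fun i q =>
    ⟨f.symm (.inr ⟨i, q⟩), fun h h' hq hq' ε hε ε' hε' u w u' w' hj hj' η hη hη' => ?_⟩⟩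
  have key : ∀ (h : F) (ε : TreeEdge F n k) (u w : TreeVertex A), (h : F ⧸ A i) = q →
      ε ∈ f.pullback B (h, .inl i) → B.Joins ε u w → η ∈ B.sep (f.symm (.inr ⟨i, q⟩)) u →
      (Φ.symm h)⁻¹ * η.1 ∈ P := by
    intro h ε u w hq hε hj hη
    have hv : (Φ.symm h)⁻¹ • f.symm (.inr ⟨i, q⟩) = v₀ i := by
      rw [← map_inv, ← f.symm.map_smul]
      congr 1
      rw [inv_smul_eq_iff, ← hq]
      change _ = (.inr ⟨i, ((h * 1 : F) : F ⧸ A i)⟩ : TreeVertex A)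
      rw [mul_one]
    refine Set.mem_iUnion.2 ⟨i, Set.mem_biUnion (hU' _ h _ _ _ hε hj)
      ⟨edgeSmul (Φ.symm h)⁻¹ η, ?_, rfl⟩⟩
    rw [← hv, mem_sep_smul]
    exact hη
  -- The common edge `η` cancels in the quotient of the two elements of `P`, leaving the preimage of
  -- `h⁻¹ * h'` under `Φ`.
  refine ⟨_, key h ε u w hq hε hj hη, _, key h' ε' u' w' hq' hε' hj' hη', ?_⟩
  simp

theorem fst_of_joins_inl {ε : TreeEdge F n k} {g : F} {u : TreeVertex A}
    (hj : B.Joins ε (.inl g) u) : ε.1⁻¹ * g ∈ insert 1 (Set.range s) := by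
  rcases hj with ⟨h, -⟩ | ⟨-, h⟩
  · rw [B.src_eq] at h
    rw [Sum.inl_injective h]
    simp
  · rw [B.tgt_eq] at h
    obtain ⟨h', i | j⟩ := ε
    · cases h
    · rw [← Sum.inl_injective h]
      right
      simp

/-- If a vertex and its first two images under `f` branch off a ray at the same vertex, while the
ray moves forward there, then `Φ` displaces an edge of the ray by one of finitely many
elements. -/
theorem exists_finite_stalling (f : TwistedPerm A Φ) (B : BassSerreSides A s) :
    ∃ R : Set F, R.Finite ∧ ∀ (ρ : TightRay (bassSerreTree A s)) (t : ℕ) (x : TreeVertex A),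
      .inl 1 ∉ B.shadow ρ t → f (ρ.vert t) ∈ B.shadow ρ t →
      f (ρ.vert (t + 1)) ∈ B.shadow ρ (t + 1) →
      x ∈ B.shadow ρ t → f x ∈ B.shadow ρ t → x ∉ B.shadow ρ (t + 1) → f x ∉ B.shadow ρ (t + 1) →
      f (f x) ∉ B.shadow ρ (t + 1) → (B.rayEdge ρ t).1⁻¹ * Φ (B.rayEdge ρ t).1 ∈ R := by
  obtain ⟨R₂, hR₂, hhull⟩ := exists_finite_pullbackHull f B
  obtain ⟨R₅, hR₅, hsep⟩ := exists_finite_separation f B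
  let R₄ : Set F := insert 1 (Set.range s)
  have hR₄ : R₄.Finite := (Set.finite_range s).insert 1
  let W : Set F := Set.image2 (fun a b => a * b⁻¹) R₄ R₄ ∪ (R₅ ∪
    Set.image2 (fun a b => Φ.symm a * b) (Set.image2 (fun a b => a * b⁻¹) R₂ R₂) R₅)
  have hW : W.Finite := (hR₄.image2 _ hR₄).union (hR₅.union ((hR₂.image2 _ hR₂).image2 _ hR₅))
  refine ⟨Set.image2 (fun a b => a * b⁻¹) W R₂, hW.image2 _ hR₂, ?_⟩
  intro ρ t x h1 hft hft1 hx hfx hx' hfx' hffx'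
  set e := B.rayEdge ρ t with he
  set e₁ := B.rayEdge ρ (t + 1) with he₁
  set w := ρ.vert (t + 1) with hw
  have hje : B.Joins e w (ρ.vert t) := (joins_rayEdge ρ t).symm
  have hje₁ : B.Joins e₁ w (ρ.vert (t + 2)) := joins_rayEdge ρ (t + 1)
  have hwt : w ∈ B.shadow ρ t := (vert_mem_shadow ρ).2 (Nat.lt_succ_self t)
  have h1' : f (.inl 1) ∉ B.shadow ρ t := by rwa [f.map_one]
  have hside : ∀ {a b}, a ∉ B.shadow ρ t → b ∉ B.shadow ρ t → B.sd e a = B.sd e b := by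
    intro a b ha hb
    change ¬ _ = _ at ha hb
    revert ha hb
    cases B.sd e a <;> cases B.sd e b <;> cases B.sd e (ρ.vert (t + 1)) <;> simp
  have hrt : ρ.vert t ∉ B.shadow ρ t := fun h => lt_irrefl t ((vert_mem_shadow ρ).1 h)
  obtain ⟨ε₁, -, hε₁, hs₁⟩ := exists_crossing (S := B.toSidedTree)
    (C := f ⁻¹' B.shadow ρ (t + 1)) (x := w) (y := x) hft1 hfx'
  rw [← pullback_eq_coboundary_shadow] at hε₁
  have hε₁t : B.src ε₁ ∈ B.shadow ρ t := by
    change B.sd e _ = B.sd e _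
    rw [(hs₁ e (notMem_sep.2 (Eq.symm hx))).1]
  obtain ⟨ε', hε', u', w', hj', hu'⟩ := exists_crossing_beyond (S := B.toSidedTree) hje
    (C := f ⁻¹' B.shadow ρ (t + 1)) (y := .inl 1) hft1
    (fun h => h1' (shadow_succ_subset ρ t h)) (hside hrt h1)
  rw [← pullback_eq_coboundary_shadow] at hε'
  have hu't : u' ∉ B.shadow ρ t := fun h => hrt (hu'.symm.trans h)
  have heu' : e ∈ B.sep w u' := fun h => hu't h.symm
  -- The edges `ε'` and `ε₁` over `e₁` lie on opposite sides of `e`, so it remains to bound `e.1⁻¹ *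
  -- e₁.1`.
  have hi : (Φ e.1)⁻¹ * e₁.1 ∈ R₂ := hhull _ _ ⟨ε', hε', ε₁, hε₁, u', w', _, _, hj',
    joins_src_tgt ε₁, fun h => hu't (Eq.trans h hε₁t)⟩
  suffices hsuff : e.1⁻¹ * e₁.1 ∈ W from ⟨_, hsuff, _, hi, by group⟩
  have hwfx : w ≠ f x := by
    intro h
    rw [← h] at hffx'
    exact hffx' hft1
  -- `e₂` is the edge by which `f x` branches off the ray at `w`; it differs from the two edges of
  -- the ray.
  obtain ⟨e₂, u₂, hje₂, hse₂⟩ := exists_first_edge (S := B.toSidedTree) hwfx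
  have hne : e ≠ e₂ := by
    rintro rfl
    exact hse₂ (Eq.symm hfx)
  have hwt1 : w ∉ B.shadow ρ (t + 1) := fun h => lt_irrefl _ ((vert_mem_shadow ρ).1 h)
  have hne₁ : e₁ ≠ e₂ := by
    rintro rfl
    have ha := hse₂
    change ¬ _ = _ at hwt1 hfx'
    rw [mem_sep] at ha
    revert ha hwt1 hfx'
    rw [← he₁]
    cases B.sd e₁ w <;> cases B.sd e₁ (f x) <;> cases B.sd e₁ (ρ.vert (t + 1 + 1)) <;> simp
  obtain ⟨ε₂, hε₂, v₂, w₂, hj₂, hv₂⟩ := exists_crossing_beyond (S := B.toSidedTree) hje₂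
    (C := f ⁻¹' B.shadow ρ (t + 1)) (y := f x) hft1 hffx'
    (notMem_sep.1 (notMem_sep_of_mem hje₂.symm.ne hse₂))
  rw [← pullback_eq_coboundary_shadow] at hε₂
  have hii : (Φ e₂.1)⁻¹ * e₁.1 ∈ R₂ := by
    refine hhull _ _ ⟨ε', hε', ε₂, hε₂, u', w', v₂, w₂, hj', hj₂, ?_⟩
    rw [mem_sep, hv₂, ← notMem_sep.1 (hje.notMem_sep hje₂ hne heu')]
    exact hje₂.ne
  -- Vertices `g.⋆` have finitely many incident edges, so the bound is automatic there. At a coset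
  -- vertex the preimage `v` of `w` decides which edges to compare.
  rcases hwc : w with g | ⟨i, q⟩
  · rw [hwc] at hje hje₁
    exact Or.inl ⟨_, fst_of_joins_inl hje, _, fst_of_joins_inl hje₁, by group⟩
  · rw [hwc] at hje hje₁ hje₂
    obtain ⟨hee, hqe, -⟩ := joins_inr hje
    obtain ⟨hee₁, hqe₁, -⟩ := joins_inr hje₁
    obtain ⟨hee₂, hqe₂, -⟩ := joins_inr hje₂
    rw [← hwc] at hje hje₁ hje₂
    obtain ⟨v, hv⟩ := hsep i q
    by_cases hvt : v ∈ B.shadow ρ t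
    -- With `v` in the half-tree beyond `e`, the edges `ε''` over `e` and `ε'` over `e₁` both have
    -- endpoints outside it, so `e` separates `v` from both.
    · obtain ⟨ε'', -, hε'', hs''⟩ := exists_crossing (S := B.toSidedTree)
        (C := f ⁻¹' B.shadow ρ t) (x := ρ.vert t) (y := .inl 1) hft h1'
      rw [← pullback_eq_coboundary_shadow] at hε''
      have hε''t : B.src ε'' ∉ B.shadow ρ t := by
        intro h
        refine hrt ?_
        change B.sd e _ = B.sd e _
        rw [← (hs'' e (notMem_sep.2 (hside hrt h1))).1]
        exact h
      refine Or.inr (Or.inl (hv e.1 e₁.1 hqe.symm hqe₁.symm ε'' (by rw [← hee]; exact hε'') ε'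
        (by rw [← hee₁]; exact hε') _ _ _ _ (joins_src_tgt ε'') hj' e ?_ ?_))
      · exact fun h => hε''t (h.symm.trans hvt)
      · exact fun h => hu't (h.symm.trans hvt)
    -- With `v` outside, the edges `ε₃` over `e₂` and `ε₁` over `e₁` are both beyond `e` as seen
    -- from `v`. This bounds `e₂.1⁻¹ * e₁.1`, while `hi` and `hii` together bound `e.1⁻¹ * e₂.1`.
    · have hfw : B.sd e₂ (f w) = B.sd e₂ w := by
        have h2 : e₁ ∈ B.sep w (f w) := fun h => hwt1 (Eq.trans h hft1)
        exact (notMem_sep.1 (hje₁.notMem_sep hje₂ hne₁ h2)).symm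
      obtain ⟨ε₃, -, hε₃, hs₃⟩ := exists_crossing (S := B.toSidedTree)
        (C := f ⁻¹' {y | B.sd e₂ y = B.sd e₂ w}) (x := w) (y := x) hfw (Ne.symm hse₂)
      rw [← pullback_eq_coboundary] at hε₃
      have hε₃t : B.src ε₃ ∈ B.shadow ρ t := by
        change B.sd e _ = B.sd e _
        rw [(hs₃ e (notMem_sep.2 (Eq.symm hx))).1]
      have h5 : e₂.1⁻¹ * e₁.1 ∈ R₅ := hv e₂.1 e₁.1 hqe₂.symm hqe₁.symm ε₃
        (by rw [← hee₂]; exact hε₃) ε₁ (by rw [← hee₁]; exact hε₁) _ _ _ _ (joins_src_tgt ε₃)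
        (joins_src_tgt ε₁) e (fun h => hvt (Eq.trans h hε₃t)) (fun h => hvt (Eq.trans h hε₁t))
      refine Or.inr (Or.inr ⟨_, ⟨_, hi, _, hii, rfl⟩, _, h5, ?_⟩)
      simp

/-- Invariance keeps iterates in each half-tree once reached, and the stalling bound forces two
applications of `f` to advance to the next one. So every orbit starting in a far half-tree passes
through all of them. -/
theorem isAttractor_of_shadow_invariant {ρ : TightRay (bassSerreTree A s)} {ξ : Boundary A s}
    (hξ : ξ.1 = .atInfinity (Quotient.mk (tailSetoid _) ρ))
    (hcl : ξ ∉ closure (axisEndpoints A s (fixedSubgroup Φ))) {T₀ : ℕ}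
    (hinv : ∀ t ≥ T₀, B.shadow ρ t ⊆ f ⁻¹' B.shadow ρ t) :
    IsAttractor (f.boundaryHomeo B) ξ := by
  obtain ⟨T₁, hT₁⟩ := exists_forall_not_inPullbackHull (f := f) (B := B) hξ hcl
  obtain ⟨T₂, hT₂⟩ := eventually_notMem_shadow (S := B.toSidedTree) ρ (.inl 1)
  obtain ⟨R, hR, hstall⟩ := exists_finite_stalling f B
  obtain ⟨T₃, hT₃⟩ := exists_forall_displacement_notMem (B := B) hξ hcl hR
  let T := max (max T₀ T₁) (max T₂ T₃)
  have hfin : ∀ t, (B.coboundary (B.shadow ρ t)).Finite := fun t => by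
    rw [coboundary_shadow]; exact Set.finite_singleton _
  have hvert : ∀ t ≥ T, f (ρ.vert t) ∈ B.shadow ρ t := fun t ht =>
    apply_vert_mem_shadow (hT₁ t (by omega))
      (hinv t (by omega) ((vert_mem_shadow ρ).2 (Nat.lt_succ_self t)))
  have hstep : ∀ t ≥ T, ∀ z : Completion (bassSerreTree A s), B.shadow ρ t ∈ z.near →
      B.shadow ρ t ∈ (f.extend B z).near := fun t ht z hz =>
    (mem_near_extend (hfin t)).2 (mem_of_superset hz (hinv t (by omega)))
  have hstep' : ∀ t ≥ T, ∀ z : Completion (bassSerreTree A s), B.shadow ρ t ∈ z.near →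
      B.shadow ρ (t + 1) ∈ (f.extend B (f.extend B z)).near := by
    intro t ht z hz
    by_contra h3
    have h2 : B.shadow ρ (t + 1) ∉ (f.extend B z).near := fun h => h3 (hstep _ (by omega) _ h)
    have h1 : B.shadow ρ (t + 1) ∉ z.near := fun h => h2 (hstep _ (by omega) _ h)
    have hfz := (mem_near_extend (hfin t)).1 (hstep t ht z hz)
    rw [mem_near_extend (hfin _)] at h2
    rw [mem_near_extend (hfin _), mem_near_extend (coboundary_preimage_finite (hfin _))] at h3
    have hfin' := coboundary_preimage_finite (f := f) (hfin (t + 1))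
    -- All the sets involved have finite coboundary, so a vertex near `z` has the same itinerary as
    -- `z` for two steps.
    obtain ⟨x, hx⟩ := nonempty_of_mem (inter_mem (inter_mem hz hfz) (inter_mem
      ((mem_near_or_compl_mem (hfin (t + 1)) z).resolve_left h1) (inter_mem
      ((mem_near_or_compl_mem hfin' z).resolve_left h2)
      ((mem_near_or_compl_mem (coboundary_preimage_finite (f := f) hfin') z).resolve_left h3))))
    exact hT₃ t (by omega) (hstall ρ t x (hT₂ t (by omega)) (hvert t ht) (hvert (t + 1) (by omega))
      hx.1.1 hx.1.2 hx.2.1 hx.2.2.1 hx.2.2.2)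
  refine ⟨{ζ | B.shadow ρ T ∈ ζ.1.near}, (isOpen_shadow ρ T).preimage continuous_subtype_val, ?_,
    fun ζ hζ => ?_⟩
  · change B.shadow ρ T ∈ ξ.1.near
    rw [shadow_mem_near_iff, hξ]
  · rw [tendsto_subtype_rng, hξ]
    have hsucc : ∀ m, ((f.boundaryHomeo B)^[m + 1] ζ).1 =
        f.extend B ((f.boundaryHomeo B)^[m] ζ).1 := fun m => by
      rw [Function.iterate_succ_apply', boundaryHomeo_apply]
    have hmono : ∀ t ≥ T, ∀ m, B.shadow ρ t ∈ ((f.boundaryHomeo B)^[m] ζ).1.near →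
        ∀ m' ≥ m, B.shadow ρ t ∈ ((f.boundaryHomeo B)^[m'] ζ).1.near := by
      intro t ht m hm m' hm'
      induction m', hm' using Nat.le_induction with
      | base => exact hm
      | succ m' _ ih =>
        rw [hsucc]
        exact hstep t ht _ ih
    have hreach : ∀ t ≥ T, ∃ m, B.shadow ρ t ∈ ((f.boundaryHomeo B)^[m] ζ).1.near := by
      intro t ht
      induction t, ht using Nat.le_induction with
      | base => exact ⟨0, hζ⟩
      | succ t ht ih =>
        obtain ⟨m, hm⟩ := ih
        refine ⟨m + 2, ?_⟩
        rw [hsucc, hsucc]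
        exact hstep' t ht _ hm
    refine tendsto_end_iff (S := B.toSidedTree) fun t => ?_
    obtain ⟨m, hm⟩ := hreach (max T t) (le_max_left _ _)
    filter_upwards [eventually_ge_atTop m] with m' hm'
    exact mem_of_superset (hmono _ (le_max_left _ _) m hm m' hm')
      (shadow_antitone ρ (le_max_right T t))

/-- A fixed point in the basin has constant orbit, so it equals the limit. -/
theorem IsAttractor.isIsolatedIn {X : Type*} [TopologicalSpace X] [T2Space X] {h : X ≃ₜ X} {ξ : X}
    (hξ : h ξ = ξ) (ha : IsAttractor h ξ) : IsIsolatedIn (Function.fixedPoints h) ξ := by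
  obtain ⟨U, hU, hξU, hlim⟩ := ha
  refine ⟨U, hU, Set.Subset.antisymm ?_ ?_⟩
  · rintro ζ ⟨hζU, hζ⟩
    have h1 := hlim ζ hζU
    have h2 : (fun m : ℕ => h^[m] ζ) = fun _ => ζ := funext fun m => Function.iterate_fixed hζ m
    rw [h2] at h1
    exact tendsto_nhds_unique tendsto_const_nhds h1
  · rintro _ rfl
    exact ⟨hξU, hξ⟩

theorem fixedSubgroup_symm (Φ : F ≃* F) : fixedSubgroup Φ.symm = fixedSubgroup Φ := by
  ext c
  change Φ.symm c = c ↔ Φ c = c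
  rw [MulEquiv.symm_apply_eq, eq_comm]

theorem isAttractor_or_isRepeller {ξ : Boundary A s} (hinf : ξ ∈ boundaryInfty A s)
    (hfix : ξ ∈ Function.fixedPoints (f.boundaryHomeo B))
    (hcl : ξ ∉ closure (axisEndpoints A s (fixedSubgroup Φ))) :
    IsIsolatedIn (Function.fixedPoints (f.boundaryHomeo B)) ξ ∧
      (IsAttractor (f.boundaryHomeo B) ξ ∨ IsRepeller (f.boundaryHomeo B) ξ) := by
  have := B.t2Space_completion
  have hor : IsAttractor (f.boundaryHomeo B) ξ ∨ IsRepeller (f.boundaryHomeo B) ξ := by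
    obtain ⟨e, he⟩ := hinf
    induction e using Quotient.inductionOn with
    | _ ρ =>
      obtain ⟨T, hT | hT⟩ := exists_shadow_invariant (f := f) (B := B) he
        (congrArg Subtype.val hfix) hcl
      · exact Or.inl (isAttractor_of_shadow_invariant he hcl hT)
      · refine Or.inr ?_
        rw [IsRepeller, boundaryHomeo_symm]
        exact isAttractor_of_shadow_invariant he (by rwa [fixedSubgroup_symm]) hT
  refine ⟨?_, hor⟩
  rcases hor with h | h
  · exact h.isIsolatedIn hfix
  · have hfix' : (f.boundaryHomeo B).symm ξ = ξ := by
      rw [Homeomorph.symm_apply_eq]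
      exact hfix.symm
    have h2 := IsAttractor.isIsolatedIn hfix' h
    have h3 : Function.fixedPoints (f.boundaryHomeo B).symm =
        Function.fixedPoints (f.boundaryHomeo B) := by
      ext ζ
      change (f.boundaryHomeo B).symm ζ = ζ ↔ f.boundaryHomeo B ζ = ζ
      rw [Homeomorph.symm_apply_eq, eq_comm]
    rwa [h3] at h2

end Dynamics
end FreeProductBoundary

/-! ### The main theorem -/

theorem mainTheorem5 {F : Type*} [Group F] {n k : ℕ} (A : Fin n → Subgroup F) (s : Fin k → F)
    (hF : IsFreeProductDecomposition A s) (Φ : F ≃* F) (hΦ : PermutesFactors A Φ) :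
    -- the homeomorphism of the boundary induced by `Φ` exists and is unique,
    ∃ Φhat : Boundary A s ≃ₜ Boundary A s,
      IsBoundaryExtension A s Φ Φhat ∧
      (∀ h : Boundary A s → Boundary A s, IsBoundaryExtension A s Φ h → h = Φhat) ∧
      -- and if it has at least three fixed points in `∂_∞(F, 𝒜)`, then:
      (3 ≤ (Function.fixedPoints Φhat ∩ boundaryInfty A s).encard →
        -- the boundary of the fixed subgroup,
        (subgroupBoundary A s (fixedSubgroup Φ) ∩ boundaryInfty A s =
            closure (axisEndpoints A s (fixedSubgroup Φ)) ∩ boundaryInfty A s) ∧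
        ((subgroupBoundary A s (fixedSubgroup Φ) ∩ boundaryInfty A s).Nonempty →
          subgroupBoundary A s (fixedSubgroup Φ) =
            closure (axisEndpoints A s (fixedSubgroup Φ)) ∧
          ∀ ξ ∈ subgroupBoundary A s (fixedSubgroup Φ),
            ξ ∈ Function.fixedPoints Φhat ∧ ¬ IsIsolatedIn (Function.fixedPoints Φhat) ξ) ∧
        -- and the other fixed points at infinity
        (∀ ξ ∈ (Function.fixedPoints Φhat \ subgroupBoundary A s (fixedSubgroup Φ)) ∩
            boundaryInfty A s,
          IsIsolatedIn (Function.fixedPoints Φhat) ξ ∧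
          (IsAttractor Φhat ξ ∨ IsRepeller Φhat ξ))) := by
  obtain ⟨B⟩ := hF.nonempty_sides
  obtain ⟨f⟩ := hΦ.nonempty_twistedPerm
  have hinter := subgroupBoundary_inter_boundaryInfty B (fixedSubgroup Φ)
  refine ⟨f.boundaryHomeo B, TwistedPerm.isBoundaryExtension_boundaryHomeo, fun h hh =>
    hh.unique B TwistedPerm.isBoundaryExtension_boundaryHomeo, fun h3 =>
    ⟨hinter, fun hne => ?_, fun ξ hξ => ?_⟩⟩
  · rw [hinter] at hne
    have heq := subgroupBoundary_eq_closure B f (closure_nonempty_iff.1 (hne.mono fun _ h => h.1))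
    refine ⟨heq, fun ξ hξ => ?_⟩
    rw [heq] at hξ
    exact ⟨closure_axisEndpoints_subset hξ, not_isIsolatedIn_of_mem_closure h3 hξ⟩
  · refine isAttractor_or_isRepeller hξ.2 hξ.1.1 fun hcl => hξ.1.2 ?_
    have h : ξ ∈ closure (axisEndpoints A s (fixedSubgroup Φ)) ∩ boundaryInfty A s := ⟨hcl, hξ.2⟩
    rw [← hinter] at h
    exact h.1
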